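/- Let $k$ be a field of characteristic different from $2$ and $3$, let $E$ be an elliptic curve over $k$ given by a Weierstrass equation, with point at infinity $P_\infty$, and let $\ell$ be a prime different from the characteristic of $k$. Assume that $W_1,W_2\in E(k)$ form a basis of the full $\ell$-torsion $E[\ell]\subset E(\bar k)$. For $i=1,2$ let $h_{W_i}\in k[E]$ be the polynomial function with divisor $\ell W_i-\ell P_\infty$, normalized at infinity: its leading monomial, i.e. $yx^{(\ell-3)/2}$ if $\ell$ is odd and $x$ if $\ell=2$, has coefficient $1$. Let $Q\in E(k)$ with $Q\ne P_\infty$, $Q\neq -W_1$ and $Q\ne -W_2$. Then there is a bijection $$\{P\in E(k)\mid \ell P=Q\}\;\longrightarrow\;\{(\omega_1,\omega_2)\in k^2\mid \omega_i^{\ell}=h_{W_i}(-Q),\ i=1,2\}.$$ More precisely, the map $$P\longmapsto\left(\frac{g_P(W_1)}{h_{W_1}(P)},\frac{g_P(W_2)}{h_{W_2}(P)}\right)$$ is such a bijection, where $g_P\in k[E]$ is the polynomial function with divisor $\ell P+(-Q)-(\ell+1)P_\infty$, normalized at infinity: its leading monomial, i.e. $x^{(\ell+1)/2}$ if $\ell$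 is odd and $y$ if $\ell=2$, has coefficient $1$ (the denominators $h_{W_i}(P)$ are nonzero). -/

import Mathlib

open scoped Polynomial Polynomial.Bivariate
open WeierstrassCurve.Affine

noncomputable section

namespace EllDivision

variable {k : Type*} [Field k]

/-- The maximal ideal of the affine coordinate ring `k[E]` at a rational point. The point at infinity
does not lie on the affine part, and gets the unit ideal. -/
def pointIdeal (E : WeierstrassCurve.Affine k) : E.Point → Ideal E.CoordinateRing
  | .zero => ⊤
  | .some x y _ => CoordinateRing.XYIdeal E x (Polynomial.C y)

/-- The value of a polynomial function on `E` at an affine rational point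
(with the default value `0` at infinity). -/
def value {E : WeierstrassCurve.Affine k} (f : E.CoordinateRing) : E.Point → k
  | .zero => 0
  | .some _ _ h => AdjoinRoot.evalEval h.1 f

/-- The affine part of the divisor of the polynomial function `f` is the sum of the points of
`D`, with multiplicity: the principal ideal `(f)` of the Dedekind domain `k[E]` has the
factorisation `∏ P ∈ D, 𝔪_P`. -/
def HasZeros {E : WeierstrassCurve.Affine k} (f : E.CoordinateRing) (D : Multiset E.Point) : Prop :=
  Ideal.span {f} = (D.map (pointIdeal E)).prod

/-- `f = p(x) + q(x) y` has a pole of order exactly `n` at infinity, and is monic there. As `x` has a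
pole of order `2` and `y` one of order `3`, the leading monomial is `x ^ (n / 2)` for even `n` and
`x ^ ((n - 3) / 2) y` for odd `n`; its coefficient is required to be `1`. -/
def IsMonicAtInfinity {E : WeierstrassCurve.Affine k} (f : E.CoordinateRing) (n : ℕ) : Prop :=
  ∃ p q : k[X], f = p • (1 : E.CoordinateRing) + q • CoordinateRing.mk E Polynomial.X ∧
    ((p.Monic ∧ 2 * p.natDegree = n ∧ (q = 0 ∨ 2 * q.natDegree + 3 < n)) ∨
      (q.Monic ∧ 2 * q.natDegree + 3 = n ∧ (p = 0 ∨ 2 * p.natDegree < n)))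

/-- `h` is the normalised Miller function `h_W`: a polynomial function with divisor
`ℓ W - ℓ P_∞`, monic at infinity. -/
structure IsMillerFunction {E : WeierstrassCurve.Affine k} (ℓ : ℕ) (W : E.Point)
    (h : E.CoordinateRing) : Prop where
  zeros : HasZeros h (Multiset.replicate ℓ W)
  infinity : IsMonicAtInfinity h ℓ

/-- `g` is the normalised function `g_P` for `ℓ P = Q`: a polynomial function with divisor
`ℓ P + (-Q) - (ℓ + 1) P_∞`, monic at infinity. -/
structure IsDivisionFunction {E : WeierstrassCurve.Affine k} (ℓ : ℕ) (P Q : E.Point)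
    (g : E.CoordinateRing) : Prop where
  zeros : HasZeros g (Multiset.replicate ℓ P + {-Q})
  infinity : IsMonicAtInfinity g (ℓ + 1)

/-- The inclusion `E(k) → E(k̄)` into the points over the algebraic closure. -/
def toGeometric [DecidableEq k] [DecidableEq (AlgebraicClosure k)]
    (E : WeierstrassCurve.Affine k) :
    E.Point →+ (WeierstrassCurve.Affine.baseChange E (AlgebraicClosure k)).Point :=
  Point.baseChange (W' := E) k (AlgebraicClosure k)

/-- `W₁, W₂ ∈ E(k)` form a basis of the full geometric `ℓ`-torsion `E[ℓ] ⊆ E(k̄)`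
over `ℤ/ℓ`. -/
structure IsTorsionBasis [DecidableEq k] [DecidableEq (AlgebraicClosure k)]
    (E : WeierstrassCurve.Affine k) (ℓ : ℕ) (W₁ W₂ : E.Point) : Prop where
  torsion₁ : ℓ • W₁ = 0
  torsion₂ : ℓ • W₂ = 0
  independent : ∀ a b : ℤ, a • W₁ + b • W₂ = 0 → (ℓ : ℤ) ∣ a ∧ (ℓ : ℤ) ∣ b
  spans : ∀ T : (WeierstrassCurve.Affine.baseChange E (AlgebraicClosure k)).Point,
    ℓ • T = 0 → ∃ a b : ℤ, T = toGeometric E (a • W₁ + b • W₂)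

end EllDivision

end

/-! Write κ_W(P) = g_P(W) / h_W(P) (`kappa`). Weil reciprocity for g_P and h_W gives κ_W(P)^ℓ =
h_W(-Q) (`kappa_pow`), so the map lands in the pairs of roots. The local term at infinity is a sign,
trivial here because one of the pole orders ℓ, ℓ + 1 is even. Reciprocity is proved inside the
coordinate ring: the product of the values of h over the zeros of g is the norm of h on k[E]/(g)
(`norm_divisorIdeal`), and the two norms are compared through determinants of Sylvester type
(`norm_reciprocity`). The sign depends on the pole orders alone and is read off on one curve over ℚ
(`sign_eq_one_of_even`).

Injectivity over an algebraically closed field is the nondegeneracy of a Weil pairing. For ℓ-torsion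
T the ratio κ_W(P + T) / κ_W(P) is an ℓ-th root of unity, independent of P away from degenerate
positions (`kappa_add_mul_kappa`), and multiplicative in W (`exists_kappa_mul`). If P and P + T₀
have the same image and T₀ ≠ 0, then T₀ pairs trivially with W₁ and W₂, and linear algebra produces
some W ≠ 0 that pairs trivially with all torsion (`exists_translationInvariant`). Take R with ℓR =
-η for the generic point η. Then κ_W(R) is Galois invariant, hence lies in the function field, and
its ℓ-th power is h_W(η) = h_W. But h_W is not an ℓ-th power, since W - P_∞ is not principal
(`eq_zero_of_pow_eq`).

Surjectivity over an algebraically closed field is a count: a nonempty fibre has ℓ² points, and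
there are at most ℓ² pairs of roots. Fibres are nonempty because x(ℓP) is a nonconstant rational
function of x(P) (`HasMulFormula.surjective`).

Over k, a geometric point with rational κ-values is Galois invariant by injectivity. Its coordinates
are also separable: a derivation paired with the invariant differential gives ℓ times as much at ℓP
as at P, and ℓ is invertible. So the point is rational (`exists_map_eq_of_fixed`). -/

noncomputable section

namespace EllDivision

/-! ### Pole orders and leading coefficients at infinity. -/

section PoleOrder

open Polynomial

variable {k : Type*} [Field k] {E : WeierstrassCurve.Affine k}

/-- The coefficient of a polynomial function at the monomial with a pole of order `s` at infinity
(`s ≠ 1`). -/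
def poleCoeff (E : WeierstrassCurve.Affine k) (s : ℕ) : E.CoordinateRing →ₗ[k] k :=
  if Even s then
    (Polynomial.lcoeff k (s / 2)).comp (((CoordinateRing.basis E).coord 0).restrictScalars k)
  else
    (Polynomial.lcoeff k ((s - 3) / 2)).comp (((CoordinateRing.basis E).coord 1).restrictScalars k)

lemma basis_coord_zero (p q : k[X]) : (CoordinateRing.basis E).coord 0
    (p • (1 : E.CoordinateRing) + q • CoordinateRing.mk E Polynomial.X) = p := by
  rw [← CoordinateRing.basis_zero, ← CoordinateRing.basis_one]
  simp [-CoordinateRing.basis_zero, -CoordinateRing.basis_one]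

lemma basis_coord_one (p q : k[X]) : (CoordinateRing.basis E).coord 1
    (p • (1 : E.CoordinateRing) + q • CoordinateRing.mk E Polynomial.X) = q := by
  rw [← CoordinateRing.basis_zero, ← CoordinateRing.basis_one]
  simp [-CoordinateRing.basis_zero, -CoordinateRing.basis_one]

lemma poleCoeff_even (p q : k[X]) (i : ℕ) : poleCoeff E (2 * i)
    (p • (1 : E.CoordinateRing) + q • CoordinateRing.mk E Polynomial.X) = p.coeff i := by
  rw [poleCoeff, if_pos (by simp), LinearMap.comp_apply, LinearMap.restrictScalars_apply,
    basis_coord_zero]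
  simp

lemma poleCoeff_odd (p q : k[X]) (i : ℕ) : poleCoeff E (2 * i + 3)
    (p • (1 : E.CoordinateRing) + q • CoordinateRing.mk E Polynomial.X) = q.coeff i := by
  rw [poleCoeff, if_neg (by grind), LinearMap.comp_apply, LinearMap.restrictScalars_apply,
    basis_coord_one]
  simp

/-- The monomials x^i and x^i y have pole orders 2i and 2i + 3, so 1 is the only gap. At `s = 1`,
`poleCoeff` has a junk value, which is why 1 is excluded throughout. -/
lemma eq_even_or_odd {s : ℕ} (hs : s ≠ 1) : (∃ i, s = 2 * i) ∨ ∃ i, s = 2 * i + 3 := by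
  rcases Nat.even_or_odd' s with ⟨i, h | h⟩
  · exact .inl ⟨i, h⟩
  · exact .inr ⟨i - 1, by omega⟩

lemma eq_zero_of_poleCoeff {f : E.CoordinateRing} (h : ∀ s, s ≠ 1 → poleCoeff E s f = 0) :
    f = 0 := by
  obtain ⟨p, q, rfl⟩ := CoordinateRing.exists_smul_basis_eq f
  have hp : p = 0 := by
    ext i
    rw [← poleCoeff_even p q i, h _ (by omega), coeff_zero]
  have hq : q = 0 := by
    ext i
    rw [← poleCoeff_odd p q i, h _ (by omega), coeff_zero]
  simp [hp, hq]

/-- The order of the pole at infinity. -/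
def poleOrder (f : E.CoordinateRing) : ℕ := (Algebra.norm k[X] f).natDegree

lemma poleOrder_mul {f g : E.CoordinateRing} (hf : f ≠ 0) (hg : g ≠ 0) :
    poleOrder (f * g) = poleOrder f + poleOrder g := by
  rw [poleOrder, map_mul, natDegree_mul]
  · rfl
  · exact (Algebra.norm_ne_zero_iff_of_basis (CoordinateRing.basis E)).mpr hf
  · exact (Algebra.norm_ne_zero_iff_of_basis (CoordinateRing.basis E)).mpr hg

/-- The norm of p + q y has degree max(2 deg p, 2 deg q + 3), because the two numbers have different
parity and no cancellation occurs. -/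
lemma poleOrder_le_iff {f : E.CoordinateRing} {n : ℕ} :
    poleOrder f ≤ n ↔ ∀ s, n < s → s ≠ 1 → poleCoeff E s f = 0 := by
  obtain ⟨p, q, rfl⟩ := CoordinateRing.exists_smul_basis_eq f
  have key : poleOrder (p • (1 : E.CoordinateRing) + q • CoordinateRing.mk E Polynomial.X) ≤ n ↔
      (∀ i, n < 2 * i → p.coeff i = 0) ∧ (∀ i, n < 2 * i + 3 → q.coeff i = 0) := by
    rw [poleOrder, natDegree_le_iff_degree_le, CoordinateRing.degree_norm_smul_basis, max_le_iff]
    refine and_congr ?_ ?_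
    · rcases eq_or_ne p 0 with rfl | hp
      · simp
      · rw [degree_eq_natDegree hp]
        rw [nsmul_eq_mul]
        norm_cast
        constructor
        · intro h i hi
          exact coeff_eq_zero_of_natDegree_lt (by omega)
        · intro h
          by_contra hc
          exact hp (leadingCoeff_eq_zero.mp (h _ (by omega)))
    · rcases eq_or_ne q 0 with rfl | hq
      · simp
      · rw [degree_eq_natDegree hq]
        rw [nsmul_eq_mul]
        norm_cast
        constructor
        · intro h i hi
          exact coeff_eq_zero_of_natDegree_lt (by omega)
        · intro h
          by_contra hc
          exact hq (leadingCoeff_eq_zero.mp (h _ (by omega)))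
  rw [key]
  constructor
  · rintro ⟨h₁, h₂⟩ s hs hs1
    rcases eq_even_or_odd hs1 with ⟨i, rfl⟩ | ⟨i, rfl⟩
    · rw [poleCoeff_even, h₁ i hs]
    · rw [poleCoeff_odd, h₂ i hs]
  · intro h
    exact ⟨fun i hi ↦ by rw [← poleCoeff_even p q i, h _ hi (by omega)],
      fun i hi ↦ by rw [← poleCoeff_odd p q i, h _ hi (by omega)]⟩

lemma poleOrder_ne_one (f : E.CoordinateRing) : poleOrder f ≠ 1 :=
  CoordinateRing.natDegree_norm_ne_one f

/-- `f` has a pole of order `n` at infinity, with leading coefficient `1`. -/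
structure IsMon (f : E.CoordinateRing) (n : ℕ) : Prop where
  ne_one : n ≠ 1
  coeff_eq_one : poleCoeff E n f = 1
  coeff_eq_zero : ∀ s, n < s → s ≠ 1 → poleCoeff E s f = 0

lemma isMonicAtInfinity_iff {f : E.CoordinateRing} {n : ℕ} :
    IsMonicAtInfinity f n ↔ IsMon f n := by
  constructor
  · rintro ⟨p, q, rfl, ⟨hp, rfl, hq⟩ | ⟨hq, rfl, hp⟩⟩
    · refine ⟨by omega, by rw [poleCoeff_even]; exact hp, fun s hs hs1 ↦ ?_⟩
      rcases eq_even_or_odd hs1 with ⟨i, rfl⟩ | ⟨i, rfl⟩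
      · rw [poleCoeff_even, coeff_eq_zero_of_natDegree_lt (by omega)]
      · rw [poleCoeff_odd]
        rcases hq with rfl | hq
        · simp
        · exact coeff_eq_zero_of_natDegree_lt (by omega)
    · refine ⟨by omega, by rw [poleCoeff_odd]; exact hq, fun s hs hs1 ↦ ?_⟩
      rcases eq_even_or_odd hs1 with ⟨i, rfl⟩ | ⟨i, rfl⟩
      · rw [poleCoeff_even]
        rcases hp with rfl | hp
        · simp
        · exact coeff_eq_zero_of_natDegree_lt (by omega)
      · rw [poleCoeff_odd, coeff_eq_zero_of_natDegree_lt (by omega)]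
  · rintro ⟨h1, h2, h3⟩
    obtain ⟨p, q, rfl⟩ := CoordinateRing.exists_smul_basis_eq f
    have hp (i) (hi : n < 2 * i) : p.coeff i = 0 := by
      rw [← poleCoeff_even p q i, h3 _ hi (by omega)]
    have hq (i) (hi : n < 2 * i + 3) : q.coeff i = 0 := by
      rw [← poleCoeff_odd p q i, h3 _ hi (by omega)]
    refine ⟨p, q, rfl, ?_⟩
    rcases eq_even_or_odd h1 with ⟨i, rfl⟩ | ⟨i, rfl⟩
    · left
      rw [poleCoeff_even] at h2
      have hd : p.natDegree = i := natDegree_eq_of_le_of_coeff_ne_zero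
        (natDegree_le_iff_coeff_eq_zero.mpr fun j hj ↦ hp j (by omega)) (by simp [h2])
      refine ⟨by rw [Monic, leadingCoeff, hd, h2], by rw [hd], or_iff_not_imp_left.mpr fun h0 ↦ ?_⟩
      by_contra hc
      exact h0 (leadingCoeff_eq_zero.mp (hq _ (by omega)))
    · right
      rw [poleCoeff_odd] at h2
      have hd : q.natDegree = i := natDegree_eq_of_le_of_coeff_ne_zero
        (natDegree_le_iff_coeff_eq_zero.mpr fun j hj ↦ hq j (by omega)) (by simp [h2])
      refine ⟨by rw [Monic, leadingCoeff, hd, h2], by rw [hd], or_iff_not_imp_left.mpr fun h0 ↦ ?_⟩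
      by_contra hc
      exact h0 (leadingCoeff_eq_zero.mp (hp _ (by omega)))

lemma IsMon.ne_zero {f : E.CoordinateRing} {n : ℕ} (h : IsMon f n) : f ≠ 0 := by
  rintro rfl
  simpa using h.coeff_eq_one

lemma IsMon.poleOrder_eq {f : E.CoordinateRing} {n : ℕ} (h : IsMon f n) : poleOrder f = n := by
  refine le_antisymm (poleOrder_le_iff.mpr h.coeff_eq_zero) ?_
  by_contra hc
  have := poleOrder_le_iff.mp le_rfl n (not_le.mp hc) h.ne_one
  simp [h.coeff_eq_one] at this

lemma exists_smul_isMon {f : E.CoordinateRing} (hf : f ≠ 0) :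
    ∃ c : k, c ≠ 0 ∧ IsMon (c • f) (poleOrder f) := by
  have hle := poleOrder_le_iff.mp (le_refl (poleOrder f))
  have h : poleCoeff E (poleOrder f) f ≠ 0 := by
    intro h0
    have h1 : ∀ s, poleOrder f ≤ s → s ≠ 1 → poleCoeff E s f = 0 := fun s hs hs1 ↦ by
      rcases hs.eq_or_lt with h | h
      · rwa [← h]
      · exact hle s h hs1
    rcases Nat.eq_zero_or_pos (poleOrder f) with h2 | h2
    · exact hf (eq_zero_of_poleCoeff fun s hs ↦ h1 s (by omega) hs)
    · have := poleOrder_le_iff.mpr (fun s (hs : poleOrder f - 1 < s) ↦ h1 s (by omega))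
      omega
  refine ⟨_, inv_ne_zero h, poleOrder_ne_one f, ?_, fun s hs hs1 ↦ ?_⟩
  · rw [map_smul, smul_eq_mul, inv_mul_cancel₀ h]
  · rw [map_smul, hle s hs hs1, smul_zero]

/-- The monomial with a pole of order `s` at infinity. -/
def monomialAt (E : WeierstrassCurve.Affine k) (s : ℕ) : E.CoordinateRing :=
  if Even s then (X ^ (s / 2) : k[X]) • (1 : E.CoordinateRing)
  else (X ^ ((s - 3) / 2) : k[X]) • CoordinateRing.mk E Polynomial.X

lemma monomialAt_even (i : ℕ) : monomialAt E (2 * i) = (X ^ i : k[X]) • (1 : E.CoordinateRing) := by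
  rw [monomialAt, if_pos (by simp)]; simp

lemma monomialAt_odd (i : ℕ) :
    monomialAt E (2 * i + 3) = (X ^ i : k[X]) • CoordinateRing.mk E Polynomial.X := by
  rw [monomialAt, if_neg (by grind)]; simp

lemma isMon_monomialAt {s : ℕ} (hs : s ≠ 1) : IsMon (monomialAt E s) s := by
  rw [← isMonicAtInfinity_iff]
  rcases eq_even_or_odd hs with ⟨i, rfl⟩ | ⟨i, rfl⟩
  · exact ⟨X ^ i, 0, by simp [monomialAt_even], .inl ⟨monic_X_pow i, by simp, .inl rfl⟩⟩
  · exact ⟨0, X ^ i, by simp [monomialAt_odd], .inr ⟨monic_X_pow i, by simp, .inl rfl⟩⟩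

lemma isMon_one : IsMon (1 : E.CoordinateRing) 0 := by
  simpa [monomialAt] using isMon_monomialAt (E := E) (s := 0) (by omega)

lemma poleOrder_add_le {f g : E.CoordinateRing} {n : ℕ} (hf : poleOrder f ≤ n)
    (hg : poleOrder g ≤ n) : poleOrder (f + g) ≤ n := by
  rw [poleOrder_le_iff] at *
  intro s hs hs1
  rw [map_add, hf s hs hs1, hg s hs hs1, add_zero]

lemma poleOrder_smul_le (c : k) (f : E.CoordinateRing) : poleOrder (c • f) ≤ poleOrder f := by
  rw [poleOrder_le_iff]
  intro s hs hs1
  rw [map_smul, poleOrder_le_iff.mp le_rfl s hs hs1, smul_zero]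

lemma poleOrder_mul_le (f g : E.CoordinateRing) : poleOrder (f * g) ≤ poleOrder f + poleOrder g := by
  rcases eq_or_ne f 0 with rfl | hf
  · simp [poleOrder]
  rcases eq_or_ne g 0 with rfl | hg
  · simp [poleOrder]
  exact (poleOrder_mul hf hg).le

/-- Adding a function of smaller pole order does not change the leading term. -/
lemma IsMon.add_of_lt {f g : E.CoordinateRing} {n : ℕ} (hf : IsMon f n)
    (hg : g = 0 ∨ poleOrder g < n) : IsMon (f + g) n := by
  rcases hg with rfl | hg
  · simpa
  refine ⟨hf.ne_one, ?_, fun s hs hs1 ↦ ?_⟩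
  · rw [map_add, hf.coeff_eq_one, poleOrder_le_iff.mp le_rfl n hg hf.ne_one, add_zero]
  · rw [map_add, hf.coeff_eq_zero s hs hs1, poleOrder_le_iff.mp le_rfl s (by omega) hs1, add_zero]

lemma poleOrder_lt_of_coeff {f : E.CoordinateRing} {n : ℕ} (hn : n ≠ 1)
    (h : ∀ s, n ≤ s → s ≠ 1 → poleCoeff E s f = 0) : f = 0 ∨ poleOrder f < n := by
  rcases Nat.eq_zero_or_pos n with rfl | hn0
  · exact .inl (eq_zero_of_poleCoeff fun s hs ↦ h s (by omega) hs)
  · right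
    have := poleOrder_le_iff.mpr (fun s (hs : n - 1 < s) ↦ h s (by omega))
    omega

lemma IsMon.sub_lt {f g : E.CoordinateRing} {n : ℕ} (hf : IsMon f n) (hg : IsMon g n) :
    f - g = 0 ∨ poleOrder (f - g) < n := by
  refine poleOrder_lt_of_coeff hf.ne_one fun s hs hs1 ↦ ?_
  rcases hs.eq_or_lt with rfl | h
  · rw [map_sub, hf.coeff_eq_one, hg.coeff_eq_one, sub_self]
  · rw [map_sub, hf.coeff_eq_zero s h hs1, hg.coeff_eq_zero s h hs1, sub_self]

/-- Only the product of two odd monomials involves the curve: the Weierstrass equation replaces y²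
by x³ plus terms of pole order at most 5. -/
lemma isMon_monomialAt_mul {m n : ℕ} (hm : m ≠ 1) (hn : n ≠ 1) :
    IsMon (monomialAt E m * monomialAt E n) (m + n) := by
  rw [← isMonicAtInfinity_iff]
  have hY := CoordinateRing.smul_basis_mul_Y (W' := E) 0 1
  rcases eq_even_or_odd hm with ⟨i, rfl⟩ | ⟨i, rfl⟩ <;>
    rcases eq_even_or_odd hn with ⟨j, rfl⟩ | ⟨j, rfl⟩ <;>
    simp only [monomialAt_even, monomialAt_odd, smul_mul_smul_comm, one_mul, mul_one, ← pow_add]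
  · exact ⟨X ^ (i + j), 0, by simp, .inl ⟨monic_X_pow _, by simp; ring, .inl rfl⟩⟩
  · exact ⟨0, X ^ (i + j), by simp, .inr ⟨monic_X_pow _, by simp; ring, .inl rfl⟩⟩
  · exact ⟨0, X ^ (i + j), by simp, .inr ⟨monic_X_pow _, by simp; ring, .inl rfl⟩⟩
  · simp only [zero_smul, zero_add, one_smul, one_mul, zero_sub] at hY
    have hc : (X ^ 3 + C E.a₂ * X ^ 2 + C E.a₄ * X + C E.a₆ : k[X]).Monic := by monicity!
    have hcd : (X ^ 3 + C E.a₂ * X ^ 2 + C E.a₄ * X + C E.a₆ : k[X]).natDegree = 3 := by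
      compute_degree!
    refine ⟨X ^ (i + j) * (X ^ 3 + C E.a₂ * X ^ 2 + C E.a₄ * X + C E.a₆),
      X ^ (i + j) * (-(C E.a₁ * X + C E.a₃)), ?_, .inl ⟨(monic_X_pow _).mul hc, ?_, .inr ?_⟩⟩
    · rw [hY, smul_add, smul_smul, smul_smul]
    · rw [(monic_X_pow _).natDegree_mul hc, hcd, natDegree_X_pow]; ring
    · have h1 : (-(C E.a₁ * X + C E.a₃) : k[X]).natDegree ≤ 1 := by compute_degree
      have h2 := natDegree_mul_le (p := (X ^ (i + j) : k[X])) (q := -(C E.a₁ * X + C E.a₃))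
      rw [natDegree_X_pow] at h2
      omega

lemma IsMon.mul {f g : E.CoordinateRing} {m n : ℕ} (hf : IsMon f m) (hg : IsMon g n) :
    IsMon (f * g) (m + n) := by
  have h1 := hf.sub_lt (isMon_monomialAt hf.ne_one)
  have h2 := hg.sub_lt (isMon_monomialAt hg.ne_one)
  have e : f * g = monomialAt E m * monomialAt E n +
      ((f - monomialAt E m) * g + monomialAt E m * (g - monomialAt E n)) := by ring
  rw [e]
  refine (isMon_monomialAt_mul hf.ne_one hg.ne_one).add_of_lt ?_
  have h3 : (f - monomialAt E m) * g = 0 ∨ poleOrder ((f - monomialAt E m) * g) < m + n := by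
    rcases h1 with h1 | h1
    · simp [h1]
    · right
      have := poleOrder_mul_le (f - monomialAt E m) g
      have := hg.poleOrder_eq
      omega
  have h4 : monomialAt E m * (g - monomialAt E n) = 0 ∨
      poleOrder (monomialAt E m * (g - monomialAt E n)) < m + n := by
    rcases h2 with h2 | h2
    · simp [h2]
    · right
      have := poleOrder_mul_le (monomialAt E m) (g - monomialAt E n)
      have := (isMon_monomialAt (E := E) hf.ne_one).poleOrder_eq
      omega
  rcases h3 with h3 | h3
  · rwa [h3, zero_add]
  rcases h4 with h4 | h4
  · rw [h4, add_zero]; exact .inr h3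
  · right
    have := poleOrder_add_le (n := m + n - 1) (by omega) (Nat.le_sub_one_of_lt h4)
      (f := (f - monomialAt E m) * g)
    omega

lemma IsMon.pow {f : E.CoordinateRing} {m : ℕ} (hf : IsMon f m) (n : ℕ) :
    IsMon (f ^ n) (m * n) := by
  induction n with
  | zero => simpa using isMon_one
  | succ n ih => simpa [pow_succ, mul_add] using ih.mul hf

/-- A function without poles is constant. -/
lemma exists_smul_one_of_poleOrder_eq_zero {f : E.CoordinateRing} (hf : poleOrder f = 0) :
    ∃ c : k, f = c • 1 := by
  refine ⟨poleCoeff E 0 f, sub_eq_zero.mp (eq_zero_of_poleCoeff fun s hs ↦ ?_)⟩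
  rcases Nat.eq_zero_or_pos s with rfl | h
  · rw [map_sub, map_smul, isMon_one.coeff_eq_one, smul_eq_mul, mul_one, sub_self]
  · rw [map_sub, map_smul, isMon_one.coeff_eq_zero s h hs, smul_zero,
      poleOrder_le_iff.mp hf.le s h hs, sub_zero]

/-- Two monic functions generating the same ideal are equal. -/
lemma IsMon.eq_of_span_eq {f g : E.CoordinateRing} {m n : ℕ} (hf : IsMon f m) (hg : IsMon g n)
    (h : Ideal.span {f} = Ideal.span {g}) : f = g := by
  obtain ⟨u, hu⟩ := Ideal.span_singleton_eq_span_singleton.mp h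
  -- A unit has no pole, hence is constant; comparing leading coefficients shows that the constant
  -- is 1.
  have h1 : poleOrder (u : E.CoordinateRing) = 0 := by
    have := poleOrder_mul u.ne_zero u⁻¹.ne_zero
    rw [u.mul_inv, isMon_one.poleOrder_eq] at this
    omega
  obtain ⟨c, hc⟩ := exists_smul_one_of_poleOrder_eq_zero h1
  rw [hc, mul_smul_comm, mul_one] at hu
  have hc0 : c ≠ 0 := by
    rintro rfl
    simp [hg.ne_zero.symm] at hu
  have hmn : m = n := by
    have h2 := hf.poleOrder_eq
    have h3 := hg.poleOrder_eq
    have h4 := poleOrder_smul_le c f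
    have h5 := poleOrder_smul_le c⁻¹ g
    rw [← hu, smul_smul, inv_mul_cancel₀ hc0, one_smul] at h5
    rw [hu] at h4 h5
    omega
  subst hmn
  have := hg.coeff_eq_one
  rw [← hu, map_smul, hf.coeff_eq_one, smul_eq_mul, mul_one] at this
  rw [← hu, this, one_smul]

end PoleOrder


/-! ### Norms on quotients along a one-dimensional step. -/

section NormStep

variable {k A : Type*} [Field k] [CommRing A] [Algebra k A]

/-- The norm of the class of `f` modulo `J` in terms of the norm modulo a larger ideal `I`, when
`I / J` is one-dimensional and `f` acts on it as the scalar `c`. -/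
lemma norm_quotient_of_le {I J : Ideal A} (hJI : J ≤ I) {π : A} (hπ : π ∈ I) (hπ' : π ∉ J)
    (hspan : ∀ x ∈ I, ∃ a : k, x - a • π ∈ J) [Module.Finite k (A ⧸ I)] :
    Module.Finite k (A ⧸ J) ∧ Module.finrank k (A ⧸ J) = Module.finrank k (A ⧸ I) + 1 ∧
      ∀ (f : A) (c : k), (∀ x ∈ I, f * x - c • x ∈ J) →
        Algebra.norm k (Ideal.Quotient.mk J f) = c * Algebra.norm k (Ideal.Quotient.mk I f) := by
  let φ : (A ⧸ J) →ₗ[k] (A ⧸ I) := (Ideal.Quotient.factorₐ k hJI).toLinearMap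
  have hφ (x : A) : φ (Ideal.Quotient.mk J x) = Ideal.Quotient.mk I x := rfl
  have hφs : Function.Surjective φ := Ideal.Quotient.factor_surjective hJI
  let W := LinearMap.ker φ
  have hmem (x : A) : Ideal.Quotient.mk J x ∈ W ↔ x ∈ I := by
    rw [LinearMap.mem_ker, hφ, Ideal.Quotient.eq_zero_iff_mem]
  have hsm (c : k) (x : A) : Ideal.Quotient.mk J (c • x) = c • Ideal.Quotient.mk J x := rfl
  let e : ((A ⧸ J) ⧸ W) ≃ₗ[k] (A ⧸ I) := φ.quotKerEquivOfSurjective hφs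
  have he (x : A ⧸ J) : e (W.mkQ x) = φ x := rfl
  let w : W := ⟨Ideal.Quotient.mk J π, (hmem π).mpr hπ⟩
  have hw0 : w ≠ 0 := by
    intro h
    exact hπ' (Ideal.Quotient.eq_zero_iff_mem.mp (congr_arg Subtype.val h))
  have hw (v : W) : ∃ a : k, a • w = v := by
    obtain ⟨v, hv⟩ := v
    obtain ⟨x, rfl⟩ := Ideal.Quotient.mk_surjective v
    obtain ⟨a, ha⟩ := hspan x ((hmem x).mp hv)
    refine ⟨a, Subtype.ext ?_⟩
    change a • Ideal.Quotient.mk J π = Ideal.Quotient.mk J x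
    rw [← hsm]
    exact (Ideal.Quotient.eq.mpr ha).symm
  have hW1 : Module.finrank k W = 1 := finrank_eq_one w hw0 hw
  have hWfin : Module.Finite k W := Module.finite_of_finrank_eq_succ hW1
  have hQfin : Module.Finite k ((A ⧸ J) ⧸ W) := Module.Finite.equiv e.symm
  have hfin : Module.Finite k (A ⧸ J) := Module.Finite.of_submodule_quotient W
  refine ⟨hfin, ?_, fun f c hf ↦ ?_⟩
  · rw [← W.finrank_quotient_add_finrank, hW1, e.finrank_eq]
  · let T := Algebra.lmul k (A ⧸ J) (Ideal.Quotient.mk J f)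
    have hT : W ≤ W.comap T := by
      intro v hv
      obtain ⟨x, rfl⟩ := Ideal.Quotient.mk_surjective v
      change Ideal.Quotient.mk J f * Ideal.Quotient.mk J x ∈ W
      rw [← map_mul, hmem]
      exact I.mul_mem_left _ ((hmem x).mp hv)
    have h1 : T.restrict (p := W) (q := W) (fun x hx ↦ hT hx) = c • LinearMap.id := by
      ext ⟨v, hv⟩
      obtain ⟨x, rfl⟩ := Ideal.Quotient.mk_surjective v
      change Ideal.Quotient.mk J f * Ideal.Quotient.mk J x = c • Ideal.Quotient.mk J x
      rw [← map_mul, ← hsm]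
      exact Ideal.Quotient.eq.mpr (hf x ((hmem x).mp hv))
    have h2 : e.toLinearMap ∘ₗ W.mapQ W T hT ∘ₗ e.symm.toLinearMap =
        Algebra.lmul k (A ⧸ I) (Ideal.Quotient.mk I f) := by
      refine LinearMap.ext fun y ↦ ?_
      obtain ⟨x, rfl⟩ := Ideal.Quotient.mk_surjective y
      have : e.symm (Ideal.Quotient.mk I x) = W.mkQ (Ideal.Quotient.mk J x) := by
        rw [LinearEquiv.symm_apply_eq, he, hφ]
      rw [LinearMap.comp_apply, LinearMap.comp_apply, LinearEquiv.coe_coe, LinearEquiv.coe_coe, this]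
      rfl
    -- The determinant is multiplicative along the invariant line I/J, on which multiplication by f
    -- is the scalar c.
    rw [Algebra.norm_apply, LinearMap.det_eq_det_mul_det W T hT, h1, LinearMap.det_smul, hW1,
      LinearMap.det_id, pow_one, mul_one, ← LinearMap.det_conj _ e, h2, Algebra.norm_apply]

end NormStep

/-! ### Ideals of points and the norm as a product of values. -/

section PointIdeals

open Polynomial

variable {k : Type*} [Field k] {E : WeierstrassCurve.Affine k}

lemma value_some {x y : k} (h : E.Nonsingular x y) (f : E.CoordinateRing) :
    value f (.some x y h) = AdjoinRoot.evalEval h.1 f := rfl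

lemma value_mk {x y : k} (h : E.Nonsingular x y) (f : k[X][Y]) :
    value (CoordinateRing.mk E f) (.some x y h) = f.evalEval x y := by
  exact AdjoinRoot.evalEval_mk _ _

lemma value_mul (f g : E.CoordinateRing) (P : E.Point) :
    value (f * g) P = value f P * value g P := by
  rcases P with _ | ⟨x, y, h⟩
  · simp [value]
  · simp [value_some]

lemma value_pow (f : E.CoordinateRing) {P : E.Point} (hP : P ≠ 0) (n : ℕ) :
    value (f ^ n) P = value f P ^ n := by
  rcases P with _ | ⟨x, y, h⟩
  · exact (hP rfl).elim
  · simp [value_some]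

lemma value_sub (f g : E.CoordinateRing) (P : E.Point) :
    value (f - g) P = value f P - value g P := by
  rcases P with _ | ⟨x, y, h⟩
  · simp [value]
  · simp [value_some]

lemma value_smul_one (c : k) {P : E.Point} (hP : P ≠ 0) :
    value (c • (1 : E.CoordinateRing)) P = c := by
  rcases P with _ | ⟨x, y, h⟩
  · exact (hP rfl).elim
  · have : c • (1 : E.CoordinateRing) = CoordinateRing.mk E (C (C c)) := by
      rw [Algebra.smul_def, mul_one]; rfl
    rw [this, value_mk, evalEval_C, eval_C]

lemma isMaximal_pointIdeal {P : E.Point} (hP : P ≠ 0) : (pointIdeal E P).IsMaximal := by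
  rcases P with _ | ⟨x, y, h⟩
  · exact (hP rfl).elim
  · have e := CoordinateRing.quotientXYIdealEquiv (W' := E) (x := x) (y := C y)
      h.1
    exact Ideal.Quotient.maximal_of_isField _ (e.toMulEquiv.isField (Field.toIsField k))

lemma mem_pointIdeal_iff {P : E.Point} (hP : P ≠ 0) (f : E.CoordinateRing) :
    f ∈ pointIdeal E P ↔ value f P = 0 := by
  rcases P with _ | ⟨x, y, h⟩
  · exact (hP rfl).elim
  · have hm := isMaximal_pointIdeal hP
    have hle : pointIdeal E (.some x y h) ≤ RingHom.ker (AdjoinRoot.evalEval h.1) := by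
      rw [pointIdeal, CoordinateRing.XYIdeal, Ideal.span_le]
      rintro _ (rfl | rfl)
      · exact (value_mk h _).trans (by simp [evalEval_C])
      · exact (value_mk h _).trans (by simp [evalEval_C])
    have hne : RingHom.ker (AdjoinRoot.evalEval h.1) ≠ ⊤ := RingHom.ker_ne_top _
    rw [hm.eq_of_le hne hle, RingHom.mem_ker, value_some]

lemma sub_value_smul_mem {P : E.Point} (hP : P ≠ 0) (f : E.CoordinateRing) :
    f - value f P • 1 ∈ pointIdeal E P := by
  rw [mem_pointIdeal_iff hP, value_sub, value_smul_one _ hP, sub_self]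

/-- The function `x - x(P)`. -/
def vertical (P : E.Point) : E.CoordinateRing :=
  match P with
  | .zero => 1
  | .some x _ _ => CoordinateRing.XClass E x

lemma vertical_ne_zero (P : E.Point) : vertical P ≠ 0 := by
  rcases P with _ | ⟨x, y, h⟩
  · exact one_ne_zero
  · exact CoordinateRing.XClass_ne_zero x

lemma pointIdeal_neg_mul (P : E.Point) :
    pointIdeal E (-P) * pointIdeal E P = Ideal.span {vertical P} := by
  rcases P with _ | ⟨x, y, h⟩
  · change (⊤ : Ideal _) * ⊤ = Ideal.span {1}
    rw [Ideal.mul_top, Ideal.span_singleton_one]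
  · exact CoordinateRing.XYIdeal_neg_mul h

/-- The ideal of functions vanishing on `D`. -/
abbrev divisorIdeal (D : Multiset E.Point) : Ideal E.CoordinateRing :=
  (D.map (pointIdeal E)).prod

/-- Vertical lines make every ideal of this kind invertible up to a principal ideal; this is the
source of all cancellations below. -/
lemma divisorIdeal_neg_mul (D : Multiset E.Point) :
    divisorIdeal (D.map (-·)) * divisorIdeal D = Ideal.span {(D.map vertical).prod} := by
  induction D using Multiset.induction_on with
  | empty => simp [divisorIdeal, Ideal.span_singleton_one]
  | cons P D ih =>
    simp only [divisorIdeal, Multiset.map_cons, Multiset.prod_cons] at ih ⊢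
    rw [mul_mul_mul_comm, ih, pointIdeal_neg_mul, Ideal.span_singleton_mul_span_singleton]

lemma prod_vertical_ne_zero (D : Multiset E.Point) : (D.map vertical).prod ≠ 0 := by
  exact Multiset.prod_ne_zero (by simp [vertical_ne_zero])

lemma divisorIdeal_ne_bot (D : Multiset E.Point) : divisorIdeal D ≠ ⊥ := by
  intro h
  have := divisorIdeal_neg_mul D
  rw [h, Ideal.mul_bot, eq_comm, Ideal.span_singleton_eq_bot] at this
  exact prod_vertical_ne_zero D this

lemma divisorIdeal_mul_left_cancel (D : Multiset E.Point) {I J : Ideal E.CoordinateRing}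
    (h : divisorIdeal D * I = divisorIdeal D * J) : I = J := by
  have := congr_arg (divisorIdeal (D.map (-·)) * ·) h
  simp only [← mul_assoc, divisorIdeal_neg_mul] at this
  exact (Ideal.span_singleton_mul_right_inj (prod_vertical_ne_zero D)).mp this

/-- There is no ideal strictly between 𝔪_P I and I. Since I is invertible, an intermediate M has the
form I K with K ⊇ 𝔪_P. Maximality leaves K = 𝔪_P, excluded by the choice of π, or K = ⊤. -/
lemma exists_uniformizer {P : E.Point} (hP : P ≠ 0) (D : Multiset E.Point) :
    ∃ π ∈ divisorIdeal D, π ∉ divisorIdeal (P ::ₘ D) ∧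
      divisorIdeal D ≤ Ideal.span {π} ⊔ divisorIdeal (P ::ₘ D) := by
  have hm := isMaximal_pointIdeal hP
  set I := divisorIdeal D
  have hJ : divisorIdeal (P ::ₘ D) = pointIdeal E P * I := by simp [divisorIdeal, I]
  set J := divisorIdeal (P ::ₘ D)
  have hJI : J ≤ I := hJ ▸ Ideal.mul_le_right
  have hne : ¬ I ≤ J := by
    intro h
    have h1 : I * pointIdeal E P = I * ⊤ := by
      rw [mul_comm, ← hJ, Ideal.mul_top]; exact le_antisymm hJI h
    exact hm.ne_top (divisorIdeal_mul_left_cancel D h1)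
  obtain ⟨π, hπ, hπJ⟩ := SetLike.not_le_iff_exists.mp hne
  refine ⟨π, hπ, hπJ, ?_⟩
  set M := Ideal.span {π} ⊔ J
  have hMI : M ≤ I := sup_le ((Ideal.span_singleton_le_iff_mem _).mpr hπ) hJI
  set c := (D.map vertical).prod
  set I' := divisorIdeal (D.map (-·))
  have hI' : I' * I = Ideal.span {c} := divisorIdeal_neg_mul D
  have hc : c ≠ 0 := prod_vertical_ne_zero D
  have h1 : I' * M ≤ Ideal.span {c} := hI' ▸ Ideal.mul_mono_right hMI
  -- the ideal quotient of `I' * M` by `c`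
  let K : Ideal E.CoordinateRing := Submodule.comap (LinearMap.mulLeft E.CoordinateRing c) (I' * M)
  have hKmem (a) : a ∈ K ↔ c * a ∈ I' * M := Iff.rfl
  have hcK : Ideal.span {c} * K = I' * M := by
    refine le_antisymm (Ideal.span_singleton_mul_le_iff.mpr fun z hz ↦ hz) fun z hz ↦ ?_
    obtain ⟨a, rfl⟩ := Ideal.mem_span_singleton'.mp (h1 hz)
    rw [mul_comm a c] at hz ⊢
    exact Ideal.mul_mem_mul (Ideal.mem_span_singleton_self c) hz
  have hmK : pointIdeal E P ≤ K := by
    intro a ha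
    rw [hKmem]
    have : c * a ∈ I' * J := by
      rw [hJ, mul_left_comm, hI', mul_comm c a]
      exact Ideal.mul_mem_mul ha (Ideal.mem_span_singleton_self c)
    exact Ideal.mul_mono_right le_sup_right this
  have h2 : I * K = M := by
    refine divisorIdeal_mul_left_cancel (D.map (-·)) ?_
    rw [← mul_assoc, hI', hcK]
  by_cases hKt : K = ⊤
  · rw [← h2, hKt, Ideal.mul_top]
  · exfalso
    have : K = pointIdeal E P := (hm.eq_of_le hKt hmK).symm
    rw [this, mul_comm, ← hJ] at h2
    exact hπJ (h2 ▸ (le_sup_left : _ ≤ M) (Ideal.mem_span_singleton_self π))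

/-- Add the points one at a time: each step contributes a line on which f acts as the scalar f(P),
because f - f(P) lies in 𝔪_P. -/
lemma norm_divisorIdeal (D : Multiset E.Point) (hD : ∀ P ∈ D, P ≠ 0) :
    Module.Finite k (E.CoordinateRing ⧸ divisorIdeal D) ∧
      Module.finrank k (E.CoordinateRing ⧸ divisorIdeal D) = D.card ∧
      ∀ f : E.CoordinateRing, Algebra.norm k (Ideal.Quotient.mk (divisorIdeal D) f) =
        (D.map (value f)).prod := by
  induction D using Multiset.induction_on with
  | empty =>
    have : Subsingleton (E.CoordinateRing ⧸ divisorIdeal (0 : Multiset E.Point)) := by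
      simp only [divisorIdeal, Multiset.map_zero, Multiset.prod_zero]
      exact Ideal.Quotient.subsingleton_iff.mpr Ideal.one_eq_top
    refine ⟨inferInstance, by simp [Module.finrank_zero_of_subsingleton], fun f ↦ ?_⟩
    rw [Algebra.norm_apply, LinearMap.det_eq_one_of_subsingleton]
    simp
  | cons P D ih =>
    obtain ⟨hfin, hcard, hnorm⟩ := ih fun R hR ↦ hD R (by simp [hR])
    have hP := hD P (by simp)
    obtain ⟨π, hπ, hπ', hspan⟩ := exists_uniformizer hP D
    have hJ : divisorIdeal (P ::ₘ D) = pointIdeal E P * divisorIdeal D := by simp [divisorIdeal]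
    have hact (f : E.CoordinateRing) (x) (hx : x ∈ divisorIdeal D) :
        f * x - value f P • x ∈ divisorIdeal (P ::ₘ D) := by
      have : f * x - value f P • x = (f - value f P • 1) * x := by
        rw [sub_mul, smul_mul_assoc, one_mul]
      rw [this, hJ]
      exact Ideal.mul_mem_mul (sub_value_smul_mem hP f) hx
    obtain ⟨h1, h2, h3⟩ := norm_quotient_of_le (k := k) (hJ ▸ Ideal.mul_le_right) hπ hπ'
      (fun x hx ↦ by
        obtain ⟨y, hy, z, hz, rfl⟩ := Submodule.mem_sup.mp (hspan hx)
        obtain ⟨a, rfl⟩ := Ideal.mem_span_singleton'.mp hy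
        refine ⟨value a P, ?_⟩
        rw [add_sub_right_comm]
        exact Ideal.add_mem _ (hact a π hπ) hz)
    refine ⟨h1, by rw [h2, hcard, Multiset.card_cons], fun f ↦ ?_⟩
    rw [h3 f (value f P) (hact f), hnorm, Multiset.map_cons, Multiset.prod_cons]

end PointIdeals


/-! ### Families with distinct pole orders. -/

section TriangularFamilies

variable {k : Type*} [Field k] {E : WeierstrassCurve.Affine k}

lemma exists_sub_smul_lt {f v : E.CoordinateRing} (hf : f ≠ 0) (hv : IsMon v (poleOrder f)) :
    ∃ c : k, f - c • v = 0 ∨ poleOrder (f - c • v) < poleOrder f := by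
  obtain ⟨c, hc, h⟩ := exists_smul_isMon hf
  refine ⟨c⁻¹, ?_⟩
  have e : f - c⁻¹ • v = c⁻¹ • (c • f - v) := by
    rw [smul_sub, smul_smul, inv_mul_cancel₀ hc, one_smul]
  rw [e]
  rcases h.sub_lt hv with h | h
  · left; rw [h, smul_zero]
  · exact .inr ((poleOrder_smul_le _ _).trans_lt h)

variable {ι : Type*} [Fintype ι] {v : ι → E.CoordinateRing} {d : ι → ℕ}

/-- Distinct pole orders exclude cancellation at the top: the member of largest order with a nonzero
coefficient determines the leading term of the sum. -/
lemma coeff_of_sum_smul (hd : Function.Injective d) (hv : ∀ i, IsMon (v i) (d i)) (c : ι → k)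
    {n : ℕ} (h : ∀ s, n < s → s ≠ 1 → poleCoeff E s (∑ i, c i • v i) = 0) :
    (∀ i, n < d i → c i = 0) ∧ ∀ i, d i = n → c i = poleCoeff E n (∑ i, c i • v i) := by
  classical
  have key (i : ι) (hi : ∀ j, d i < d j → c j = 0) :
      poleCoeff E (d i) (∑ i, c i • v i) = c i := by
    rw [map_sum, Finset.sum_eq_single i]
    · rw [map_smul, (hv i).coeff_eq_one, smul_eq_mul, mul_one]
    · intro j _ hj
      rcases lt_or_gt_of_ne (hd.ne hj) with hlt | hlt
      · rw [map_smul, (hv j).coeff_eq_zero _ hlt (hv i).ne_one, smul_zero]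
      · rw [hi j hlt, zero_smul, map_zero]
    · simp
  have h1 : ∀ i, n < d i → c i = 0 := by
    by_contra! hc
    obtain ⟨i, hi⟩ := hc
    obtain ⟨j, hj, hmax⟩ := Finset.exists_max_image (Finset.univ.filter fun i ↦ n < d i ∧ c i ≠ 0) d
      ⟨i, by simpa using hi⟩
    simp only [Finset.mem_filter, Finset.mem_univ, true_and, and_imp] at hj hmax
    refine hj.2 ?_
    rw [← key j, h _ hj.1 (hv j).ne_one]
    intro l hl
    by_contra hcl
    exact absurd (hmax l (hj.1.trans hl) hcl) (by omega)
  refine ⟨h1, ?_⟩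
  rintro i rfl
  exact (key i h1).symm

lemma linearIndependent_of_isMon (hd : Function.Injective d) (hv : ∀ i, IsMon (v i) (d i)) :
    LinearIndependent k v := by
  rw [Fintype.linearIndependent_iff]
  intro c hc i
  obtain ⟨h1, h2⟩ := coeff_of_sum_smul hd hv c (n := 0) (by simp [hc])
  rcases Nat.eq_zero_or_pos (d i) with h | h
  · rw [h2 i h, hc, map_zero]
  · exact h1 i h

lemma exists_sum_smul_of_poleOrder_le (hv : ∀ i, IsMon (v i) (d i)) {N : ℕ}
    (hd : ∀ s ≤ N, s ≠ 1 → ∃ i, d i = s) (f : E.CoordinateRing) (hf : poleOrder f ≤ N) :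
    ∃ c : ι → k, f = ∑ i, c i • v i := by
  suffices f ∈ Submodule.span k (Set.range v) by
    obtain ⟨c, hc⟩ := (Submodule.mem_span_range_iff_exists_fun k).mp this
    exact ⟨c, hc.symm⟩
  induction hn : poleOrder f using Nat.strong_induction_on generalizing f with
  | _ n ih =>
    rcases eq_or_ne f 0 with rfl | hf0
    · exact zero_mem _
    obtain ⟨i, hi⟩ := hd _ hf (poleOrder_ne_one f)
    obtain ⟨c, hc⟩ := exists_sub_smul_lt hf0 (hi ▸ hv i)
    rw [← sub_add_cancel f (c • v i)]
    refine add_mem ?_ (Submodule.smul_mem _ _ (Submodule.subset_span ⟨i, rfl⟩))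
    rcases hc with hc | hc
    · rw [hc]; exact zero_mem _
    · exact ih _ (hn ▸ hc) _ (hc.le.trans hf) rfl

/-- The change of basis between two monic families with the same pole orders is unitriangular. -/
lemma det_eq_one_of_isMon [DecidableEq ι] (hd : Function.Injective d) (hv : ∀ i, IsMon (v i) (d i))
    {w : ι → E.CoordinateRing} (hw : ∀ i, IsMon (w i) (d i)) {M : Matrix ι ι k}
    (hM : ∀ i, w i = ∑ j, M i j • v j) : M.det = 1 := by
  have key (i) := coeff_of_sum_smul hd hv (M i) (n := d i)
    (fun s hs hs1 ↦ by rw [← hM]; exact (hw i).coeff_eq_zero s hs hs1)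
  -- Ordering the indices by pole order makes the matrix triangular.
  let _ : LinearOrder ι := LinearOrder.lift' d hd
  have hlt (i j : ι) : i < j ↔ d i < d j := Iff.rfl
  rw [Matrix.det_of_isLowerTriangular M]
  · refine Finset.prod_eq_one fun i _ ↦ ?_
    rw [(key i).2 i rfl, ← hM, (hw i).coeff_eq_one]
  · intro i j hij
    exact (key i).1 j hij

lemma det_eq_sign_of_isMon [DecidableEq ι] (hd : Function.Injective d)
    (hv : ∀ i, IsMon (v i) (d i)) {w : ι → E.CoordinateRing} (σ : Equiv.Perm ι)
    (hw : ∀ i, IsMon (w i) (d (σ i))) {M : Matrix ι ι k}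
    (hM : ∀ i, w i = ∑ j, M i j • v j) : M.det = Equiv.Perm.sign σ := by
  have h := det_eq_one_of_isMon hd hv (w := fun i ↦ w (σ⁻¹ i)) (M := M.submatrix (σ⁻¹ : Equiv.Perm ι) id)
    (fun i ↦ by simpa using hw (σ⁻¹ i)) (fun i ↦ by simpa using hM (σ⁻¹ i))
  rw [Matrix.det_permute, Equiv.Perm.sign_inv] at h
  have h2 : ((Equiv.Perm.sign σ : ℤˣ) : k) * ((Equiv.Perm.sign σ : ℤˣ) : k) = 1 := by
    rcases Int.units_eq_one_or (Equiv.Perm.sign σ) with h | h <;> simp [h]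
  calc M.det = ((Equiv.Perm.sign σ : ℤˣ) : k) * (((Equiv.Perm.sign σ : ℤˣ) : k) * M.det) := by
        rw [← mul_assoc, h2, one_mul]
    _ = _ := by rw [h, mul_one]

end TriangularFamilies

/-! ### Weil reciprocity for norms, by Sylvester determinants. -/

section Reciprocity

/-- The pole orders of the monomials that form a basis of `k[E] / (g)` for `g` monic with a pole of
order `n`. -/
def gapOrders (n : ℕ) : Finset ℕ := (Finset.range (n + 2)).filter fun s ↦ s ≠ 1 ∧ s ≠ n

lemma mem_gapOrders {n s : ℕ} : s ∈ gapOrders n ↔ s ≤ n + 1 ∧ s ≠ 1 ∧ s ≠ n := by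
  simp [gapOrders, Nat.lt_succ_iff]

/-- Multiples of a monic g of order n realise the orders n + s with s ≠ 1. Those that are missed are
exactly `gapOrders n`, so their number has to be the dimension n of k[E]/(g). -/
lemma card_gapOrders {n : ℕ} (hn : n ≠ 1) : (gapOrders n).card = n := by
  have : gapOrders n = Finset.range (n + 2) \ {1, n} := by
    ext s
    simp [gapOrders]
  rw [this, Finset.card_sdiff_of_subset, Finset.card_pair hn.symm]
  · simp
  · intro s
    simp only [Finset.mem_insert, Finset.mem_singleton, Finset.mem_range]
    omega

/-- The indices of a basis of the functions with a pole of order at most `m + n + 1`. -/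
abbrev SylvesterIndex (m n : ℕ) : Type := (gapOrders n ⊕ Unit) ⊕ gapOrders m

/-- The pole orders of the members of the family `mixedFamily`. -/
def mixedOrder (m n : ℕ) : SylvesterIndex m n → ℕ :=
  Sum.elim (Sum.elim (fun s ↦ m + s) fun _ ↦ m + n) fun t ↦ t

lemma mixedOrder_injective {m n : ℕ} (hn : n ≠ 1) : Function.Injective (mixedOrder m n) := by
  have hs (r) (s : gapOrders r) : (s : ℕ) ≤ r + 1 ∧ (s : ℕ) ≠ 1 ∧ (s : ℕ) ≠ r :=
    mem_gapOrders.mp s.2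
  rintro ((s | u) | t) ((s' | u') | t') h <;>
    simp only [mixedOrder, Sum.elim_inl, Sum.elim_inr] at h
  · rw [Subtype.ext (show (s : ℕ) = s' by omega)]
  · have := hs n s; omega
  · have := hs n s; have := hs m t'; omega
  · have := hs n s'; omega
  · rfl
  · have := hs m t'; omega
  · have := hs n s'; have := hs m t; omega
  · have := hs m t; omega
  · rw [Subtype.ext h]

/-- The orders m + s fill the interval from m to m + n + 1 except m + 1 and m + n. The extra index
supplies m + n, and the `gapOrders m` supply m + 1 and everything below m. -/
lemma mixedOrder_range {m n : ℕ} (hm : m ≠ 1) (hn : n ≠ 1) (s : ℕ) :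
    (∃ i, mixedOrder m n i = s) ↔ s ≤ m + n + 1 ∧ s ≠ 1 := by
  constructor
  · rintro ⟨(s' | u') | t', rfl⟩ <;> simp only [mixedOrder, Sum.elim_inl, Sum.elim_inr]
    · have := mem_gapOrders.mp s'.2; omega
    · omega
    · have := mem_gapOrders.mp t'.2; omega
  · rintro ⟨h1, h2⟩
    by_cases h3 : s ∈ gapOrders m
    · exact ⟨.inr ⟨s, h3⟩, rfl⟩
    · by_cases h4 : s = m + n
      · exact ⟨.inl (.inr ()), h4.symm⟩
      · rw [mem_gapOrders] at h3
        exact ⟨.inl (.inl ⟨s - m, mem_gapOrders.mpr (by omega)⟩), by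
          simp only [mixedOrder, Sum.elim_inl]; omega⟩

/-- The exchange of the roles of `m` and `n`. -/
def sylvesterSwap (m n : ℕ) : SylvesterIndex m n ≃ SylvesterIndex n m where
  toFun := Sum.elim (Sum.elim (fun s ↦ .inr s) fun u ↦ .inl (.inr u)) fun t ↦ .inl (.inl t)
  invFun := Sum.elim (Sum.elim (fun s ↦ .inr s) fun u ↦ .inl (.inr u)) fun t ↦ .inl (.inl t)
  left_inv := by rintro ((s | u) | t) <;> rfl
  right_inv := by rintro ((s | u) | t) <;> rfl

/-- The permutation is built from m and n alone. Its sign is therefore the same for all curves over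
all fields. -/
lemma exists_reciprocityPerm {m n : ℕ} (hm : m ≠ 1) (hn : n ≠ 1) :
    ∃ σ : Equiv.Perm (SylvesterIndex m n), ∀ i,
      mixedOrder m n (σ i) = mixedOrder n m (sylvesterSwap m n i) := by
  have hinj : Function.Injective fun i ↦ mixedOrder n m (sylvesterSwap m n i) :=
    (mixedOrder_injective hm).comp (sylvesterSwap m n).injective
  have hr : Set.range (fun i ↦ mixedOrder n m (sylvesterSwap m n i)) =
      Set.range (mixedOrder m n) := by
    ext s
    have : s ∈ Set.range (fun i ↦ mixedOrder n m (sylvesterSwap m n i)) ↔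
        ∃ i, mixedOrder n m i = s :=
      ⟨fun ⟨i, hi⟩ ↦ ⟨_, hi⟩, fun ⟨i, hi⟩ ↦ ⟨(sylvesterSwap m n).symm i, by simpa using hi⟩⟩
    rw [this, mixedOrder_range hn hm, Set.mem_range, mixedOrder_range hm hn, add_comm m n]
  refine ⟨((Equiv.ofInjective _ hinj).trans (Equiv.setCongr hr)).trans
    (Equiv.ofInjective _ (mixedOrder_injective hn)).symm, fun i ↦ ?_⟩
  exact Equiv.apply_ofInjective_symm (mixedOrder_injective hn) _

variable {k : Type*} [Field k] {E : WeierstrassCurve.Affine k}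

/-- The family `g a_s`, `g h`, `a_t` of functions. -/
def mixedFamily (m n : ℕ) (g h : E.CoordinateRing) : SylvesterIndex m n → E.CoordinateRing :=
  Sum.elim (Sum.elim (fun s ↦ g * monomialAt E s) fun _ ↦ g * h) fun t ↦ monomialAt E t

/-- The family `g a_s`, `g h`, `h a_t` of functions. -/
def sylvesterFamily (m n : ℕ) (g h : E.CoordinateRing) : SylvesterIndex m n → E.CoordinateRing :=
  Sum.elim (Sum.elim (fun s ↦ g * monomialAt E s) fun _ ↦ g * h) fun t ↦ h * monomialAt E t

lemma isMon_mixedFamily {m n : ℕ} {g h : E.CoordinateRing} (hg : IsMon g m) (hh : IsMon h n)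
    (i : SylvesterIndex m n) : IsMon (mixedFamily m n g h i) (mixedOrder m n i) := by
  rcases i with (⟨s, hs⟩ | u) | ⟨t, ht⟩
  · exact hg.mul (isMon_monomialAt (mem_gapOrders.mp hs).2.1)
  · exact hg.mul hh
  · exact isMon_monomialAt (mem_gapOrders.mp ht).2.1

/-- The monomials of pole order in `gapOrders m` are a basis of `k[E] / (g)`. -/
lemma exists_basis_quotient {m : ℕ} {g : E.CoordinateRing} (hg : IsMon g m) :
    ∃ b : Module.Basis (gapOrders m) k (E.CoordinateRing ⧸ Ideal.span {g}),
      ∀ t, b t = Ideal.Quotient.mk _ (monomialAt E t) := by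
  let v : gapOrders m → (E.CoordinateRing ⧸ Ideal.span {g}) :=
    fun t ↦ Ideal.Quotient.mk _ (monomialAt E t)
  have hspan (f : E.CoordinateRing) :
      Ideal.Quotient.mk (Ideal.span {g}) f ∈ Submodule.span k (Set.range v) := by
    induction hn : poleOrder f using Nat.strong_induction_on generalizing f with
    | _ n ih =>
      rcases eq_or_ne f 0 with rfl | hf0
      · rw [map_zero]; exact zero_mem _
      have step (w : E.CoordinateRing) (hw : IsMon w (poleOrder f))
          (hmem : Ideal.Quotient.mk (Ideal.span {g}) w ∈ Submodule.span k (Set.range v)) :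
          Ideal.Quotient.mk (Ideal.span {g}) f ∈ Submodule.span k (Set.range v) := by
        obtain ⟨c, hc⟩ := exists_sub_smul_lt hf0 hw
        rw [← sub_add_cancel f (c • w), map_add]
        refine add_mem ?_ (Submodule.smul_mem _ c hmem)
        rcases hc with hc | hc
        · rw [hc, map_zero]; exact zero_mem _
        · exact ih _ (hn ▸ hc) _ rfl
      have h1 := poleOrder_ne_one f
      by_cases h : poleOrder f ∈ gapOrders m
      · exact step _ (isMon_monomialAt h1) (Submodule.subset_span ⟨⟨_, h⟩, rfl⟩)
      -- An order outside the gaps is the order of a multiple of g, which vanishes in the quotient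
      -- and can be subtracted freely.
      · have hge : m ≤ poleOrder f ∧ poleOrder f - m ≠ 1 := by
          rw [mem_gapOrders] at h; have := hg.ne_one; omega
        refine step (g * monomialAt E (poleOrder f - m)) ?_ ?_
        · have := hg.mul (isMon_monomialAt (E := E) hge.2)
          rwa [Nat.add_sub_cancel' hge.1] at this
        · rw [Ideal.Quotient.eq_zero_iff_mem.mpr
            (Ideal.mul_mem_right _ _ (Ideal.mem_span_singleton_self g))]
          exact zero_mem _
  have hrank : Fintype.card (gapOrders m) =
      Module.finrank k (E.CoordinateRing ⧸ Ideal.span {g}) := by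
    rw [Fintype.card_coe, card_gapOrders hg.ne_one,
      finrank_quotient_span_eq_natDegree_norm (CoordinateRing.basis E) hg.ne_zero]
    exact hg.poleOrder_eq.symm
  refine ⟨basisOfTopLeSpanOfCardEqFinrank v ?_ hrank, fun t ↦ ?_⟩
  · rintro x -
    obtain ⟨f, rfl⟩ := Ideal.Quotient.mk_surjective x
    exact hspan f
  · rw [coe_basisOfTopLeSpanOfCardEqFinrank]

/-- The two families differ only in the last block, h a_t against a_t. Modulo g all other members
vanish, so the matrix is block triangular with an identity block, and the other diagonal block is
the transposed matrix of multiplication by h on k[E]/(g). -/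
lemma exists_sylvester_matrix {m n : ℕ} {g h : E.CoordinateRing} (hg : IsMon g m)
    (hh : IsMon h n) : ∃ M : Matrix (SylvesterIndex m n) (SylvesterIndex m n) k,
      (∀ i, sylvesterFamily m n g h i = ∑ j, M i j • mixedFamily m n g h j) ∧
        M.det = Algebra.norm k (Ideal.Quotient.mk (Ideal.span {g}) h) := by
  have hex (t : gapOrders m) : ∃ c : SylvesterIndex m n → k,
      h * monomialAt E t = ∑ i, c i • mixedFamily m n g h i := by
    refine exists_sum_smul_of_poleOrder_le (isMon_mixedFamily hg hh) (N := m + n + 1)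
      (fun s hs hs1 ↦ (mixedOrder_range hg.ne_one hh.ne_one s).mpr ⟨hs, hs1⟩) _ ?_
    have ht := mem_gapOrders.mp t.2
    have := (hh.mul (isMon_monomialAt (E := E) ht.2.1)).poleOrder_eq
    omega
  choose c hc using hex
  let H : Matrix (gapOrders m) (gapOrders m) k := .of fun t t' ↦ c t (.inr t')
  refine ⟨Matrix.fromBlocks 1 0 (.of fun t i ↦ c t (.inl i)) H, ?_, ?_⟩
  · rintro (i | t)
    · rcases i with s | u <;> simp [Matrix.one_apply, sylvesterFamily, mixedFamily]
    · rw [Fintype.sum_sum_type]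
      simp only [Matrix.fromBlocks_apply₂₁, Matrix.fromBlocks_apply₂₂, Matrix.of_apply, H]
      rw [← Fintype.sum_sum_type (fun i ↦ c t i • mixedFamily m n g h i), ← hc]
      rfl
  · rw [Matrix.det_fromBlocks_zero₁₂, Matrix.det_one, one_mul]
    obtain ⟨b, hb⟩ := exists_basis_quotient hg
    rw [Algebra.norm_apply, ← LinearMap.det_toMatrix b, ← Matrix.det_transpose]
    congr 1
    ext t' t
    rw [LinearMap.toMatrix_apply, Matrix.transpose_apply]
    have : (Algebra.lmul k _ (Ideal.Quotient.mk (Ideal.span {g}) h)) (b t) =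
        ∑ t', H t t' • b t' := by
      change Ideal.Quotient.mk (Ideal.span {g}) h * b t = _
      rw [hb, ← map_mul, hc, Fintype.sum_sum_type, map_add, map_sum, map_sum]
      rw [Finset.sum_eq_zero, zero_add]
      · refine Finset.sum_congr rfl fun t' _ ↦ ?_
        rw [hb]; rfl
      · intro i _
        rw [Ideal.Quotient.eq_zero_iff_mem]
        refine Submodule.smul_of_tower_mem _ _ ?_
        rcases i with s | u
        · exact Ideal.mul_mem_right _ _ (Ideal.mem_span_singleton_self g)
        · exact Ideal.mul_mem_right _ _ (Ideal.mem_span_singleton_self g)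
    rw [this, map_sum, Finsupp.finsetSum_apply]
    simp [Finsupp.single_apply]

/-- Weil reciprocity for norms, up to a sign that depends on the pole orders only. -/
lemma norm_reciprocity {m n : ℕ} {g h : E.CoordinateRing} (hg : IsMon g m)
    (hh : IsMon h n) (σ : Equiv.Perm (SylvesterIndex m n))
    (hσ : ∀ i, mixedOrder m n (σ i) = mixedOrder n m (sylvesterSwap m n i)) :
    Algebra.norm k (Ideal.Quotient.mk (Ideal.span {g}) h) =
      Equiv.Perm.sign σ * Algebra.norm k (Ideal.Quotient.mk (Ideal.span {h}) g) := by
  obtain ⟨M, hM, hMdet⟩ := exists_sylvester_matrix hg hh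
  obtain ⟨M', hM', hMdet'⟩ := exists_sylvester_matrix hh hg
  set e := sylvesterSwap m n
  let w : SylvesterIndex m n → E.CoordinateRing := fun i ↦ mixedFamily n m h g (e i)
  have hw (i) : IsMon (w i) (mixedOrder m n (σ i)) := hσ i ▸ isMon_mixedFamily hh hg (e i)
  have hex (i) : ∃ c : SylvesterIndex m n → k, w i = ∑ j, c j • mixedFamily m n g h j := by
    refine exists_sum_smul_of_poleOrder_le (isMon_mixedFamily hg hh) (N := m + n + 1)
      (fun s hs hs1 ↦ (mixedOrder_range hg.ne_one hh.ne_one s).mpr ⟨hs, hs1⟩) _ ?_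
    rw [(hw i).poleOrder_eq]
    exact ((mixedOrder_range hg.ne_one hh.ne_one _).mp ⟨_, rfl⟩).1
  choose c hc using hex
  have hcdet := det_eq_sign_of_isMon (mixedOrder_injective hh.ne_one) (isMon_mixedFamily hg hh) σ hw
    (M := .of c) hc
  -- The family g a_s, g h, h a_t is symmetric in g and h up to reindexing; only the mixed families
  -- differ.
  have hfam (i) : sylvesterFamily n m h g (e i) = sylvesterFamily m n g h i := by
    rcases i with (s | u) | t
    · rfl
    · exact mul_comm h g
    · rfl
  have hM'' (i) : sylvesterFamily m n g h i = ∑ j, M'.submatrix e e i j • w j := by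
    rw [← hfam, hM', ← e.sum_comp]
    rfl
  -- Both sides express the same functions in a linearly independent family. The matrix `c` between
  -- the two mixed families contributes the sign of σ.
  have hprod : M = M'.submatrix e e * .of c := by
    ext i j
    have hli := linearIndependent_of_isMon (mixedOrder_injective hh.ne_one)
      (isMon_mixedFamily hg hh)
    refine congr_fun (hli.fintypeLinearCombination_injective (a₁ := M i)
      (a₂ := (M'.submatrix e e * Matrix.of c) i) ?_) j
    rw [Fintype.linearCombination_apply, Fintype.linearCombination_apply, ← hM, hM'']
    simp_rw [hc, Finset.smul_sum, smul_smul]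
    rw [Finset.sum_comm]
    simp_rw [← Finset.sum_smul]
    rfl
  rw [← hMdet, ← hMdet', hprod, Matrix.det_mul, Matrix.det_submatrix_equiv_self, hcdet, mul_comm]

end Reciprocity


/-! ### Zeros of functions, lines, and reciprocity for values. -/

section Divisors

open Polynomial

variable {k : Type*} [Field k] {E : WeierstrassCurve.Affine k}

lemma HasZeros.mul {f g : E.CoordinateRing} {D D' : Multiset E.Point} (hf : HasZeros f D)
    (hg : HasZeros g D') : HasZeros (f * g) (D + D') := by
  rw [HasZeros, Multiset.map_add, Multiset.prod_add, ← hf, ← hg,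
    Ideal.span_singleton_mul_span_singleton]

lemma HasZeros.pow {f : E.CoordinateRing} {D : Multiset E.Point} (hf : HasZeros f D) (n : ℕ) :
    HasZeros (f ^ n) (n • D) := by
  rw [HasZeros, Multiset.map_nsmul, Multiset.prod_nsmul, ← hf, Ideal.span_singleton_pow]

lemma eq_of_pointIdeal_le {P R : E.Point} (hP : P ≠ 0)
    (h : pointIdeal E R ≤ pointIdeal E P) : R = P := by
  have hm := isMaximal_pointIdeal hP
  rcases P with _ | ⟨x, y, hxy⟩
  · exact (hP rfl).elim
  rcases R with _ | ⟨x', y', hxy'⟩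
  · exact (hm.ne_top (top_le_iff.mp h)).elim
  · have h1 := h (Ideal.subset_span (Set.mem_insert (CoordinateRing.XClass E x') _))
    have h2 := h (Ideal.subset_span (Set.mem_insert_of_mem _
      (Set.mem_singleton (CoordinateRing.YClass E (C y')))))
    rw [mem_pointIdeal_iff hP, CoordinateRing.XClass, value_mk, evalEval_C, eval_sub, eval_X,
      eval_C, sub_eq_zero] at h1
    rw [mem_pointIdeal_iff hP, CoordinateRing.YClass, value_mk, evalEval_sub, evalEval_X,
      evalEval_C, eval_C, sub_eq_zero] at h2
    subst h1 h2
    rfl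

lemma HasZeros.value_eq_zero_iff {f : E.CoordinateRing} {D : Multiset E.Point} (hf : HasZeros f D)
    {P : E.Point} (hP : P ≠ 0) : value f P = 0 ↔ P ∈ D := by
  have hm := isMaximal_pointIdeal hP
  rw [← mem_pointIdeal_iff hP, ← Ideal.span_singleton_le_iff_mem, hf,
    Ideal.IsPrime.multiset_prod_le hm.isPrime]
  constructor
  · rintro ⟨I, hI, hIP⟩
    obtain ⟨R, hR, rfl⟩ := Multiset.mem_map.mp hI
    exact eq_of_pointIdeal_le hP hIP ▸ hR
  · exact fun h ↦ ⟨_, Multiset.mem_map_of_mem _ h, le_rfl⟩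

lemma HasZeros.norm_eq {g : E.CoordinateRing} {D : Multiset E.Point} (hg : HasZeros g D)
    (hD : ∀ P ∈ D, P ≠ 0) (f : E.CoordinateRing) :
    Algebra.norm k (Ideal.Quotient.mk (Ideal.span {g}) f) = (D.map (value f)).prod := by
  rw [← (norm_divisorIdeal D hD).2.2 f, divisorIdeal, ← hg]

lemma HasZeros.poleOrder_eq {g : E.CoordinateRing} {D : Multiset E.Point} (hg : HasZeros g D)
    (hD : ∀ P ∈ D, P ≠ 0) : poleOrder g = D.card := by
  have hg0 : g ≠ 0 := by
    rintro rfl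
    exact divisorIdeal_ne_bot D (by rw [divisorIdeal, ← hg]; simp)
  rw [← (norm_divisorIdeal D hD).2.1, divisorIdeal, ← hg,
    finrank_quotient_span_eq_natDegree_norm (CoordinateRing.basis E) hg0, poleOrder]

/-- Weil reciprocity up to a sign that depends on the pole orders only. -/
lemma weil_reciprocity_sign {m n : ℕ} {g h : E.CoordinateRing} (hg : IsMon g m) (hh : IsMon h n)
    {D D' : Multiset E.Point} (hgD : HasZeros g D) (hhD : HasZeros h D') (hD : ∀ P ∈ D, P ≠ 0)
    (hD' : ∀ P ∈ D', P ≠ 0) (σ : Equiv.Perm (SylvesterIndex m n))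
    (hσ : ∀ i, mixedOrder m n (σ i) = mixedOrder n m (sylvesterSwap m n i)) :
    (D.map (value h)).prod = Equiv.Perm.sign σ * (D'.map (value g)).prod := by
  rw [← hgD.norm_eq hD, ← hhD.norm_eq hD', norm_reciprocity hg hh σ hσ]

lemma isMon_XClass (a : k) : IsMon (CoordinateRing.XClass E a) 2 := by
  rw [← isMonicAtInfinity_iff]
  refine ⟨X - C a, 0, ?_, .inl ⟨monic_X_sub_C a, by simp, .inl rfl⟩⟩
  rw [CoordinateRing.smul, mul_one, zero_smul, add_zero]
  rfl

lemma isMon_YClass (a : k) : IsMon (CoordinateRing.YClass E (C a)) 3 := by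
  rw [← isMonicAtInfinity_iff]
  refine ⟨-C a, 1, ?_, .inr ⟨monic_one, by simp, .inr (by simp)⟩⟩
  rw [CoordinateRing.smul, mul_one, one_smul, CoordinateRing.YClass, map_sub, C_neg, map_neg]
  ring

lemma hasZeros_vertical (P : E.Point) : HasZeros (vertical P) {-P, P} := by
  rw [HasZeros, ← pointIdeal_neg_mul]
  simp

/-- The chord-tangent relation between point ideals contains the ideal of the vertical line through
the sum S, which is 𝔪_{-S} 𝔪_S; cancelling 𝔪_S leaves the three zeros. -/
lemma hasZeros_line [DecidableEq k] {x₁ x₂ y₁ y₂ : k} (h₁ : E.Nonsingular x₁ y₁)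
    (h₂ : E.Nonsingular x₂ y₂) (hxy : ¬(x₁ = x₂ ∧ y₁ = E.negY x₂ y₂)) :
    HasZeros (CoordinateRing.YClass E (linePolynomial x₁ y₁ (E.slope x₁ x₂ y₁ y₂)))
      {.some x₁ y₁ h₁, .some x₂ y₂ h₂, -(.some x₁ y₁ h₁ + .some x₂ y₂ h₂)} := by
  have h := CoordinateRing.XYIdeal_mul_XYIdeal h₁.1 h₂.1 hxy
  rw [Point.add_some hxy]
  have h3 := pointIdeal_neg_mul (.some _ _ (nonsingular_add h₁ h₂ hxy))
  refine divisorIdeal_mul_left_cancel {.some _ _ (nonsingular_add h₁ h₂ hxy)} ?_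
  simp only [divisorIdeal, Multiset.map_singleton, Multiset.prod_singleton,
    Multiset.insert_eq_cons, Multiset.map_cons, Multiset.prod_cons]
  have h4 : CoordinateRing.XIdeal E (E.addX x₁ x₂ (E.slope x₁ x₂ y₁ y₂)) = _ := h3.symm
  rw [h4] at h
  rw [mul_comm (pointIdeal E _) (Ideal.span _)]
  refine Eq.trans h.symm ?_
  change _ * (pointIdeal E (.some x₁ y₁ h₁) * pointIdeal E (.some x₂ y₂ h₂)) = _
  ring

end Divisors

/-! ### The sign in Weil reciprocity. -/

section Sign

open Polynomial

/-- The curve `y ^ 2 + y = x ^ 3 - x` over `ℚ`. -/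
def curve37a : WeierstrassCurve.Affine ℚ := ⟨0, 0, 1, -1, 0⟩

lemma curve37a_nonsingular {x y : ℚ} (h : y ^ 2 + y = x ^ 3 - x) (h' : 2 * y + 1 ≠ 0) :
    curve37a.Nonsingular x y := by
  rw [nonsingular_iff', equation_iff']
  refine ⟨?_, .inr ?_⟩
  · simp only [curve37a]; linarith
  · simpa [curve37a] using h'

lemma value_XClass {k : Type*} [Field k] {E : WeierstrassCurve.Affine k} (a : k) {x y : k}
    (h : E.Nonsingular x y) : value (CoordinateRing.XClass E a) (.some x y h) = x - a := by
  rw [CoordinateRing.XClass, value_mk, evalEval_C, eval_sub, eval_X, eval_C]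

lemma value_YClass {k : Type*} [Field k] {E : WeierstrassCurve.Affine k} (a : k) {x y : k}
    (h : E.Nonsingular x y) : value (CoordinateRing.YClass E (C a)) (.some x y h) = y - a := by
  rw [CoordinateRing.YClass, value_mk, evalEval_sub, evalEval_X, evalEval_C, eval_C]

lemma curve37a_isMon_hasZeros_YClass : HasZeros (CoordinateRing.YClass curve37a (C 0))
    {.some 0 0 (curve37a_nonsingular (by norm_num) (by norm_num)),
      .some 1 0 (curve37a_nonsingular (by norm_num) (by norm_num)),
      .some (-1) 0 (curve37a_nonsingular (by norm_num) (by norm_num))} := by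
  have h00 : curve37a.Nonsingular 0 0 := curve37a_nonsingular (by norm_num) (by norm_num)
  have h10 : curve37a.Nonsingular 1 0 := curve37a_nonsingular (by norm_num) (by norm_num)
  have h := hasZeros_line h00 h10 (by simp)
  have hs : curve37a.slope 0 1 0 0 = 0 := by rw [slope_of_X_ne (by norm_num)]; norm_num
  have e1 : linePolynomial (0 : ℚ) 0 0 = C 0 := by simp [linePolynomial]
  have e2 : -(Point.some 0 0 h00 + Point.some 1 0 h10) =
      .some (-1) 0 (curve37a_nonsingular (by norm_num) (by norm_num)) := by
    rw [Point.add_of_X_ne' (by norm_num), neg_neg, Point.some.injEq, hs]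
    constructor <;> norm_num [addX, negAddY, curve37a]
  rwa [e2, hs, e1] at h

/-- The sign in Weil reciprocity is `1` if one of the pole orders is even: it can be read off from
functions on the curve `y ^ 2 + y = x ^ 3 - x`. -/
lemma sign_eq_one_of_even {r n : ℕ} (hn : n ≠ 1) (σ : Equiv.Perm (SylvesterIndex (2 * r) n))
    (hσ : ∀ i, mixedOrder (2 * r) n (σ i) = mixedOrder n (2 * r) (sylvesterSwap (2 * r) n i)) :
    Equiv.Perm.sign σ = 1 := by
  have h22 : curve37a.Nonsingular 2 2 := curve37a_nonsingular (by norm_num) (by norm_num)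
  have h00 : curve37a.Nonsingular 0 0 := curve37a_nonsingular (by norm_num) (by norm_num)
  have hg := (isMon_XClass (E := curve37a) 2).pow r
  have hgD := (hasZeros_vertical (.some 2 2 h22)).pow r
  have hx := hasZeros_vertical (.some 0 0 h00)
  have hne (s : ℕ) (D : Multiset curve37a.Point) (hD : ∀ P ∈ D, P ≠ 0) : ∀ P ∈ s • D, P ≠ 0 :=
    fun P hP ↦ hD P (Multiset.mem_of_mem_nsmul hP)
  rw [vertical] at hgD hx
  have hv (P : curve37a.Point) (hP : P ≠ 0) : ∀ R ∈ ({-P, P} : Multiset curve37a.Point), R ≠ 0 := by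
    simp [hP]
  -- In characteristic 0 a single nonzero value distinguishes the two signs.
  have key (w : ℚ) (hw : w ≠ 0) (h : w = ((Equiv.Perm.sign σ : ℤˣ) : ℚ) * w) :
      Equiv.Perm.sign σ = 1 := by
    rcases Int.units_eq_one_or (Equiv.Perm.sign σ) with hs | hs
    · exact hs
    · rw [hs] at h
      exact absurd (by push_cast at h; linarith) hw
  rcases eq_even_or_odd hn with ⟨i, rfl⟩ | ⟨i, rfl⟩
  -- Test pair (x - 2)^r and x^i: both products of values are 4^(i r).
  · have h := weil_reciprocity_sign hg ((isMon_XClass (E := curve37a) 0).pow i) hgD (hx.pow i)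
      (hne _ _ (hv _ (Point.some_ne_zero h22))) (hne _ _ (hv _ (Point.some_ne_zero h00))) σ hσ
    rw [Multiset.map_nsmul, Multiset.prod_nsmul, Multiset.map_nsmul, Multiset.prod_nsmul] at h
    simp only [Point.neg_some, Multiset.insert_eq_cons, Multiset.map_cons, Multiset.map_singleton,
      Multiset.prod_cons, Multiset.prod_singleton, value_pow _ (Point.some_ne_zero _),
      value_XClass] at h
    rw [← mul_pow, ← mul_pow, ← pow_mul, ← pow_mul, mul_comm r i] at h
    exact key (4 ^ (i * r)) (by positivity) (by convert h using 2 <;> norm_num)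
  -- Test pair (x - 2)^r and x^i y. The additional factors agree: y takes the values 2 and -3 at the
  -- zeros of x - 2, and x - 2 the values -2, -1, -3 at the zeros of y, both with product -6.
  · have h := weil_reciprocity_sign hg
      ((isMon_XClass (E := curve37a) 0).pow i |>.mul (isMon_YClass 0)) hgD
      ((hx.pow i).mul curve37a_isMon_hasZeros_YClass)
      (hne _ _ (hv _ (Point.some_ne_zero h22))) ?_ σ hσ
    · rw [Multiset.map_nsmul, Multiset.prod_nsmul, Multiset.map_add, Multiset.prod_add,
        Multiset.map_nsmul, Multiset.prod_nsmul] at h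
      simp only [Point.neg_some, Multiset.insert_eq_cons, Multiset.map_cons,
        Multiset.map_singleton, Multiset.prod_cons, Multiset.prod_singleton, value_mul,
        value_pow _ (Point.some_ne_zero _), value_XClass, value_YClass] at h
      have e : curve37a.negY 2 2 = -3 := by norm_num [negY, curve37a]
      have e1 : (2 - 0 : ℚ) ^ i * (-3 - 0) * ((2 - 0) ^ i * (2 - 0)) = 4 ^ i * (-6) := by
        rw [show (4 : ℚ) = 2 * 2 by norm_num, mul_pow]; ring
      rw [e, e1, mul_pow, ← pow_mul, ← mul_pow, ← mul_pow, ← mul_pow, ← pow_mul, mul_comm r i] at h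
      refine key (4 ^ (i * r) * (-6) ^ r) (by simp) ?_
      convert h using 3 <;> norm_num
    · intro P hP
      rcases Multiset.mem_add.mp hP with hP | hP
      · exact hne _ _ (hv _ (Point.some_ne_zero h00)) P hP
      · simp only [Multiset.insert_eq_cons, Multiset.mem_cons, Multiset.mem_singleton] at hP
        rcases hP with rfl | rfl | rfl <;> exact Point.some_ne_zero _

end Sign


/-! ### Existence of functions with prescribed zeros. -/

section Existence

open Polynomial nonZeroDivisors

variable {k : Type*} [Field k] {E : WeierstrassCurve.Affine k}

/-- Weil reciprocity when one of the pole orders is even. -/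
lemma weil_reciprocity_of_even {r n : ℕ} {g h : E.CoordinateRing} (hg : IsMon g (2 * r))
    (hh : IsMon h n) {D D' : Multiset E.Point} (hgD : HasZeros g D) (hhD : HasZeros h D')
    (hD : ∀ P ∈ D, P ≠ 0) (hD' : ∀ P ∈ D', P ≠ 0) :
    (D.map (value h)).prod = (D'.map (value g)).prod := by
  obtain ⟨σ, hσ⟩ := exists_reciprocityPerm hg.ne_one hh.ne_one
  rw [weil_reciprocity_sign hg hh hgD hhD hD hD' σ hσ, sign_eq_one_of_even hh.ne_one σ hσ]
  simp

variable (E) in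
/-- Weil reciprocity up to a sign. -/
lemma exists_weil_sign {m n : ℕ} (hm : m ≠ 1) (hn : n ≠ 1) :
    ∃ ε : k, ε ≠ 0 ∧ ∀ {g h : E.CoordinateRing} {D D' : Multiset E.Point}, IsMon g m →
      IsMon h n → HasZeros g D → HasZeros h D' → (∀ P ∈ D, P ≠ 0) → (∀ P ∈ D', P ≠ 0) →
        (D.map (value h)).prod = ε * (D'.map (value g)).prod := by
  obtain ⟨σ, hσ⟩ := exists_reciprocityPerm hm hn
  refine ⟨((Equiv.Perm.sign σ : ℤˣ) : k), ?_, fun hg hh hgD hhD hD hD' ↦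
    weil_reciprocity_sign hg hh hgD hhD hD hD' σ hσ⟩
  rcases Int.units_eq_one_or (Equiv.Perm.sign σ) with h | h <;> simp [h]

lemma exists_isMon_of_span {D : Multiset E.Point} (hD : ∀ P ∈ D, P ≠ 0) {f : E.CoordinateRing}
    (hf : HasZeros f D) : ∃ g : E.CoordinateRing, HasZeros g D ∧ IsMon g D.card := by
  have hf0 : f ≠ 0 := by
    rintro rfl
    exact divisorIdeal_ne_bot D (by rw [divisorIdeal, ← hf]; simp)
  obtain ⟨c, hc, h⟩ := exists_smul_isMon hf0
  refine ⟨c • f, ?_, hf.poleOrder_eq hD ▸ h⟩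
  rw [HasZeros, ← hf, Algebra.smul_def]
  exact Ideal.span_singleton_mul_left_unit ((IsUnit.mk0 c hc).map _) f

/-- The fractional ideal of a point. -/
def pointUnit : E.Point → (FractionalIdeal E.CoordinateRing⁰ E.FunctionField)ˣ
  | .zero => 1
  | .some _ _ h => CoordinateRing.XYIdeal' h

lemma coe_pointUnit (P : E.Point) :
    (pointUnit P : FractionalIdeal E.CoordinateRing⁰ E.FunctionField) = pointIdeal E P := by
  rcases P with _ | ⟨x, y, h⟩
  · simp [pointUnit, pointIdeal]
  · rfl

variable [DecidableEq k]

lemma mk_pointUnit (P : E.Point) :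
    Additive.ofMul (ClassGroup.mk E.FunctionField (pointUnit P)) = Point.toClass P := by
  rcases P with _ | ⟨x, y, h⟩
  · simp only [pointUnit, map_one]
    rfl
  · rfl

/-- The class of the ideal of D is the image of the sum of D under the homomorphism from E(k) to the
class group, which is injective. -/
lemma exists_hasZeros_iff (D : Multiset E.Point) :
    (∃ f, HasZeros f D) ↔ D.sum = 0 := by
  let U := (D.map (pointUnit (E := E))).prod
  have hU : (U : FractionalIdeal E.CoordinateRing⁰ E.FunctionField) = divisorIdeal D := by
    simp only [U, divisorIdeal]
    induction D using Multiset.induction_on with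
    | empty => simp
    | cons P D ih => simp [ih, coe_pointUnit]
  have hmk : Additive.ofMul (ClassGroup.mk E.FunctionField U) = Point.toClass D.sum := by
    simp only [U]
    clear hU U
    induction D using Multiset.induction_on with
    | empty => simp
    | cons P D ih =>
      rw [Multiset.map_cons, Multiset.prod_cons, map_mul, ofMul_mul, ih, mk_pointUnit,
        Multiset.sum_cons, map_add]
  rw [← Point.toClass_eq_zero, ← hmk, ofMul_eq_zero, ClassGroup.mk_eq_one_of_coe_ideal hU]
  constructor
  · rintro ⟨f, hf⟩
    refine ⟨f, ?_, hf.symm⟩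
    rintro rfl
    exact divisorIdeal_ne_bot D (by rw [divisorIdeal, ← hf]; simp)
  · rintro ⟨f, -, hf⟩
    exact ⟨f, hf.symm⟩

lemma exists_hasZeros_isMon {D : Multiset E.Point} (hD : ∀ P ∈ D, P ≠ 0) (h : D.sum = 0) :
    ∃ g : E.CoordinateRing, HasZeros g D ∧ IsMon g D.card := by
  obtain ⟨f, hf⟩ := (exists_hasZeros_iff D).mpr h
  exact exists_isMon_of_span hD hf

end Existence

/-! ### Compatibility with homomorphisms of fields. -/

section BaseChange

open Polynomial

variable {R : Type*} [Field R] (E : WeierstrassCurve.Affine R) {F K : Type*} [Field F] [Field K]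
  [Algebra R F] [Algebra R K] (φ : F →ₐ[R] K)

/-- The homomorphism of coordinate rings induced by a homomorphism of fields. -/
def crMap : (E⁄F).CoordinateRing →+* (E⁄K).CoordinateRing :=
  AdjoinRoot.map (Polynomial.mapRingHom (φ : F →+* K)) _ _ (dvd_of_eq (E.baseChange_polynomial φ))

lemma crMap_mk (f : F[X][Y]) : crMap E φ (CoordinateRing.mk (E⁄F) f) =
    CoordinateRing.mk (E⁄K) (f.map (Polynomial.mapRingHom (φ : F →+* K))) := by
  have : (crMap E φ).comp (CoordinateRing.mk (E⁄F)) =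
      (CoordinateRing.mk (E⁄K)).comp (Polynomial.mapRingHom (Polynomial.mapRingHom (φ : F →+* K))) := by
    ext
    · simp [crMap]
    · simp [crMap]
    · simp [crMap]
  exact DFunLike.congr_fun this f

lemma crMap_smul_basis (p q : F[X]) :
    crMap E φ (p • (1 : (E⁄F).CoordinateRing) + q • CoordinateRing.mk (E⁄F) Polynomial.X) =
      (p.map (φ : F →+* K)) • (1 : (E⁄K).CoordinateRing) +
        (q.map (φ : F →+* K)) • CoordinateRing.mk (E⁄K) Polynomial.X := by
  simp only [CoordinateRing.smul, map_add, map_mul, crMap_mk, map_one]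
  simp

variable {E}

lemma IsMonicAtInfinity.crMap {f : (E⁄F).CoordinateRing} {n : ℕ} (hf : IsMonicAtInfinity f n) :
    IsMonicAtInfinity (crMap E φ f) n := by
  obtain ⟨p, q, rfl, h⟩ := hf
  refine ⟨p.map (φ : F →+* K), q.map (φ : F →+* K), crMap_smul_basis E φ p q, ?_⟩
  rcases h with ⟨h1, h2, h3⟩ | ⟨h1, h2, h3⟩
  · refine .inl ⟨h1.map _, by rwa [natDegree_map], ?_⟩
    rwa [natDegree_map, Polynomial.map_eq_zero]
  · refine .inr ⟨h1.map _, by rwa [natDegree_map], ?_⟩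
    rwa [natDegree_map, Polynomial.map_eq_zero]

variable [DecidableEq F] [DecidableEq K]

lemma map_pointIdeal (P : (E⁄F).Point) :
    (pointIdeal (E⁄F) P).map (crMap E φ) = pointIdeal (E⁄K) (Point.map φ P) := by
  rcases P with _ | ⟨x, y, h⟩
  · exact Ideal.map_top _
  · rw [Point.map_some, pointIdeal, pointIdeal, CoordinateRing.XYIdeal, CoordinateRing.XYIdeal,
      Ideal.map_span, Set.image_pair]
    congr 2
    · rw [CoordinateRing.XClass, crMap_mk, CoordinateRing.XClass]; simp
    · rw [CoordinateRing.YClass, crMap_mk, CoordinateRing.YClass]; simp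

lemma HasZeros.crMap {f : (E⁄F).CoordinateRing} {D : Multiset (E⁄F).Point} (hf : HasZeros f D) :
    HasZeros (crMap E φ f) (D.map (Point.map φ)) := by
  have := congr_arg (Ideal.map (EllDivision.crMap E φ)) hf
  rw [Ideal.map_span, Set.image_singleton, ← Ideal.mapHom_apply, map_multiset_prod,
    Multiset.map_map] at this
  rw [HasZeros, this, Multiset.map_map]
  congr 1
  refine Multiset.map_congr rfl fun P _ ↦ ?_
  rw [Function.comp_apply, Ideal.mapHom_apply, map_pointIdeal]
  rfl

lemma value_crMap (f : (E⁄F).CoordinateRing) (P : (E⁄F).Point) :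
    value (crMap E φ f) (Point.map φ P) = φ (value f P) := by
  rcases P with _ | ⟨x, y, h⟩
  · exact (map_zero φ).symm
  · obtain ⟨f, rfl⟩ := AdjoinRoot.mk_surjective f
    rw [Point.map_some]
    change value (crMap E φ (CoordinateRing.mk (E⁄F) f)) _ = φ (value (CoordinateRing.mk (E⁄F) f) _)
    rw [crMap_mk, value_mk, value_mk]
    exact map_mapRingHom_evalEval (f := (φ : F →+* K)) f x y

end BaseChange


/-! ### Addition and duplication formulas for the x-coordinate. -/

section Formulas

variable {L : Type*} [Field L] [DecidableEq L] {C : WeierstrassCurve.Affine L}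

/-- The sum over ±Q eliminates the y-coordinates, so that x((n + 2)P) can be computed from x((n +
1)P), x(nP) and x(P). -/
lemma addX_add_subX {x₁ x₂ y₁ y₂ : L} (h₁ : C.Equation x₁ y₁) (h₂ : C.Equation x₂ y₂)
    (hx : x₁ ≠ x₂) :
    (C.addX x₁ x₂ (C.slope x₁ x₂ y₁ y₂) + C.addX x₁ x₂ (C.slope x₁ x₂ y₁ (C.negY x₂ y₂))) *
      (x₁ - x₂) ^ 2 = 2 * x₁ * x₂ * (x₁ + x₂) + C.b₂ * x₁ * x₂ + C.b₄ * (x₁ + x₂) + C.b₆ := by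
  have hx' : x₁ - x₂ ≠ 0 := sub_ne_zero.mpr hx
  rw [equation_iff] at h₁ h₂
  rw [slope_of_X_ne hx, slope_of_X_ne hx]
  simp only [addX, negY, WeierstrassCurve.b₂, WeierstrassCurve.b₄, WeierstrassCurve.b₆]
  field_simp
  linear_combination 2 * h₁ + 2 * h₂

lemma addX_self {x y : L} (h : C.Equation x y) (hy : y ≠ C.negY x y) :
    C.addX x x (C.slope x x y y) * (4 * x ^ 3 + C.b₂ * x ^ 2 + 2 * C.b₄ * x + C.b₆) =
      x ^ 4 - C.b₄ * x ^ 2 - 2 * C.b₆ * x - C.b₈ := by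
  have hy' : y - C.negY x y ≠ 0 := sub_ne_zero.mpr hy
  have e : 4 * x ^ 3 + C.b₂ * x ^ 2 + 2 * C.b₄ * x + C.b₆ = (y - C.negY x y) ^ 2 := by
    rw [equation_iff] at h
    simp only [negY, WeierstrassCurve.b₂, WeierstrassCurve.b₄, WeierstrassCurve.b₆]
    linear_combination -4 * h
  rw [e, slope_of_Y_ne rfl hy]
  rw [equation_iff] at h
  simp only [addX]
  field_simp
  simp only [negY, WeierstrassCurve.b₄, WeierstrassCurve.b₆, WeierstrassCurve.b₈]
  linear_combination (-(C.a₁ ^ 2) - 4 * C.a₂ - 8 * x) * h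

end Formulas

/-! ### The x-coordinate of a multiple as a rational function. -/

section Multiplication

open Polynomial

universe u

variable {k : Type u} [Field k] (E : WeierstrassCurve.Affine k)

/-- Outside the zeros of a polynomial `B` in `x(P)`, the point `n • P` is affine and its
`x`-coordinate is a rational function of `x(P)`, over all extensions of the base field. -/
def HasMulFormula (n : ℕ) : Prop :=
  ∃ F G B : k[X], B ≠ 0 ∧ ∀ (L : Type u) [Field L] [DecidableEq L] [Algebra k L] (x y : L)
    (h : (E⁄L).Nonsingular x y), aeval x B ≠ 0 → aeval x G ≠ 0 ∧
      ∃ (x' y' : L) (h' : (E⁄L).Nonsingular x' y'),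
        n • Point.some x y h = .some x' y' h' ∧ x' * aeval x G = aeval x F

lemma hasMulFormula_one : HasMulFormula E 1 :=
  ⟨X, 1, 1, one_ne_zero, fun L _ _ _ x y h _ ↦ ⟨by simp, x, y, h, by simp, by simp⟩⟩

/-- On the curve the denominator is (2y + a₁x + a₃)², so it is nonzero exactly where P ≠ -P. As a
polynomial it is nonzero because its leading coefficient is 4. -/
lemma hasMulFormula_two (h2 : (2 : k) ≠ 0) : HasMulFormula E 2 := by
  refine ⟨X ^ 4 - C E.b₄ * X ^ 2 - 2 * C E.b₆ * X - C E.b₈,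
    4 * X ^ 3 + C E.b₂ * X ^ 2 + 2 * C E.b₄ * X + C E.b₆,
    4 * X ^ 3 + C E.b₂ * X ^ 2 + 2 * C E.b₄ * X + C E.b₆, ?_, fun L _ _ _ x y h hB ↦ ⟨hB, ?_⟩⟩
  · intro h0
    have h4 : (4 : k) = 0 := by
      have := congr_arg (fun p ↦ coeff p 3) h0
      have e : (4 * X ^ 3 + C E.b₂ * X ^ 2 + 2 * C E.b₄ * X + C E.b₆ : k[X]) =
          C 4 * X ^ 3 + C E.b₂ * X ^ 2 + C (2 * E.b₄) * X + C E.b₆ := by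
        rw [C_mul, C_ofNat, C_ofNat]
      rw [e] at this
      simpa [coeff_X, coeff_C] using this
    exact h2 (pow_eq_zero_iff two_ne_zero |>.mp (by linear_combination h4 : (2 : k) ^ 2 = 0))
  · have e2 : (E⁄L).b₂ = algebraMap k L E.b₂ := WeierstrassCurve.map_b₂ ..
    have e4 : (E⁄L).b₄ = algebraMap k L E.b₄ := WeierstrassCurve.map_b₄ ..
    have e6 : (E⁄L).b₆ = algebraMap k L E.b₆ := WeierstrassCurve.map_b₆ ..
    have e8 : (E⁄L).b₈ = algebraMap k L E.b₈ := WeierstrassCurve.map_b₈ ..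
    have hb : aeval x (4 * X ^ 3 + C E.b₂ * X ^ 2 + 2 * C E.b₄ * X + C E.b₆ : k[X]) =
        4 * x ^ 3 + (E⁄L).b₂ * x ^ 2 + 2 * (E⁄L).b₄ * x + (E⁄L).b₆ := by
      rw [e2, e4, e6]
      simp only [map_add, map_mul, map_pow, aeval_X, aeval_C, map_ofNat]
    have hy : y ≠ (E⁄L).negY x y := by
      intro hy
      apply hB
      rw [hb]
      have h1 := (equation_iff ..).mp h.1
      simp only [negY] at hy
      simp only [WeierstrassCurve.b₂, WeierstrassCurve.b₄, WeierstrassCurve.b₆]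
      linear_combination -4 * h1 + (2 * y + (E⁄L).a₁ * x + (E⁄L).a₃) * hy
    refine ⟨_, _, _, (two_nsmul _).trans (Point.add_self_of_Y_ne hy), ?_⟩
    rw [hb, addX_self h.1 hy, e4, e6, e8]
    simp only [map_sub, map_mul, map_pow, aeval_X, aeval_C, map_ofNat]

/-- The addition formula is applied to (n + 1)P and P, whose difference is nP. It needs x((n + 1)P)
≠ x(P), hence the condition that F - X G is not the zero polynomial. -/
lemma HasMulFormula.step {n : ℕ} (hn : HasMulFormula E n)
    (hn1 : ∃ F G B : k[X], B ≠ 0 ∧ F - X * G ≠ 0 ∧ ∀ (L : Type u) [Field L] [DecidableEq L]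
      [Algebra k L] (x y : L) (h : (E⁄L).Nonsingular x y), aeval x B ≠ 0 → aeval x G ≠ 0 ∧
      ∃ (x' y' : L) (h' : (E⁄L).Nonsingular x' y'),
        (n + 1) • Point.some x y h = .some x' y' h' ∧ x' * aeval x G = aeval x F) :
    HasMulFormula E (n + 2) := by
  obtain ⟨F', G', B', hB', hn⟩ := hn
  obtain ⟨F, G, B, hB, hFG, hn1⟩ := hn1
  -- With F/G = x((n + 1)P) and F'/G' = x(nP), this is the formula for x((n + 2)P) + x(nP) with the
  -- denominator G² G' cleared.
  refine ⟨(2 * F * X * (F + X * G) + C E.b₂ * F * X * G + C E.b₄ * (F + X * G) * G +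
    C E.b₆ * G ^ 2) * G' - F' * (F - X * G) ^ 2, (F - X * G) ^ 2 * G', B * B' * (F - X * G),
    mul_ne_zero (mul_ne_zero hB hB') hFG, fun L _ _ _ x y h hne ↦ ?_⟩
  simp only [map_mul, mul_ne_zero_iff] at hne
  obtain ⟨⟨hne1, hne2⟩, hne3⟩ := hne
  obtain ⟨hG', x', y', h', hmul', hx'⟩ := hn L x y h hne2
  obtain ⟨hG, u, v, huv, hmul, hu⟩ := hn1 L x y h hne1
  simp only [map_sub, map_mul, aeval_X] at hne3
  have hux : u ≠ x := by
    rintro rfl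
    exact hne3 (by linear_combination -hu)
  have hadd : (n + 2) • Point.some x y h = .some u v huv + .some x y h := by
    rw [show n + 2 = (n + 1) + 1 by ring, add_nsmul _ (n + 1), hmul, one_nsmul]
  have hsub : Point.some x' y' h' = .some u v huv + -.some x y h := by
    rw [← hmul', ← hmul, add_nsmul, one_nsmul, add_neg_cancel_right]
  rw [Point.neg_some, Point.add_of_X_ne hux, Point.some.injEq] at hsub
  have hsum := addX_add_subX huv.1 h.1 hux
  rw [← hsub.1] at hsum
  refine ⟨by simp [hG', hne3], _, _, _, hadd.trans (Point.add_of_X_ne hux), ?_⟩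
  have e2 : (E⁄L).b₂ = algebraMap k L E.b₂ := WeierstrassCurve.map_b₂ ..
  have e4 : (E⁄L).b₄ = algebraMap k L E.b₄ := WeierstrassCurve.map_b₄ ..
  have e6 : (E⁄L).b₆ = algebraMap k L E.b₆ := WeierstrassCurve.map_b₆ ..
  rw [e2, e4, e6] at hsum
  simp only [map_add, map_sub, map_mul, map_pow, aeval_X, aeval_C, map_ofNat]
  rw [← hu, ← hx']
  linear_combination (aeval x G) ^ 2 * aeval x G' * hsum

end Multiplication

/-! ### Points over an algebraically closed field. -/

section AlgClosed

open Polynomial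

variable {L : Type*} [Field L] [IsAlgClosed L] {C : WeierstrassCurve.Affine L}

lemma exists_equation (C : WeierstrassCurve.Affine L) (x : L) : ∃ y, C.Equation x y := by
  have hd : (X ^ 2 + Polynomial.C (C.a₁ * x + C.a₃) * X -
      Polynomial.C (x ^ 3 + C.a₂ * x ^ 2 + C.a₄ * x + C.a₆) : L[X]).degree ≠ 0 := by
    have : (X ^ 2 + Polynomial.C (C.a₁ * x + C.a₃) * X -
      Polynomial.C (x ^ 3 + C.a₂ * x ^ 2 + C.a₄ * x + C.a₆) : L[X]).degree = 2 := by
      compute_degree!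
    rw [this]; norm_num
  obtain ⟨y, hy⟩ := IsAlgClosed.exists_root _ hd
  refine ⟨y, (equation_iff ..).mpr ?_⟩
  simp only [IsRoot, eval_sub, eval_add, eval_pow, eval_X, eval_mul, eval_C] at hy
  linear_combination hy

lemma xRep_fiber_finite {L : Type*} [Field L] {C : WeierstrassCurve.Affine L} (b : Fin 2 → L) :
    (Point.xRep (W' := C) ⁻¹' {b}).Finite := by
  rcases (Point.xRep (W' := C) ⁻¹' {b}).eq_empty_or_nonempty with h | ⟨P, hP⟩
  · rw [h]; exact Set.finite_empty
  · refine (Set.toFinite {P, -P}).subset fun R hR ↦ ?_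
    exact Point.eq_or_eq_neg_of_xRep_eq_xRep (hR.trans hP.symm)

lemma finite_of_xRep {L : Type*} [Field L] {C : WeierstrassCurve.Affine L} {s : Set (Fin 2 → L)}
    (hs : s.Finite) : (Point.xRep (W' := C) ⁻¹' s).Finite :=
  hs.preimage' fun b _ ↦ xRep_fiber_finite b

lemma finite_root_points {L : Type*} [Field L] {C : WeierstrassCurve.Affine L} {B : L[X]}
    (hB : B ≠ 0) : {P : C.Point | ∀ x y h, P = .some x y h → B.eval x = 0}.Finite := by
  refine (finite_of_xRep (s := insert ![1, 0] ((fun x ↦ ![x, 1]) '' B.rootSet L))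
    ((B.rootSet_finite L).image _ |>.insert _)).subset ?_
  rintro (_ | ⟨x, y, h⟩) hP
  · exact Set.mem_insert _ _
  · refine Set.mem_insert_of_mem _ ⟨x, ?_, rfl⟩
    rw [mem_rootSet]
    exact ⟨hB, by simpa using hP x y h rfl⟩

lemma infinite_point [C.IsElliptic] : Infinite C.Point := by
  choose y hy using exists_equation C
  refine Infinite.of_injective (fun x ↦ Point.mk (hy x)) fun x x' h ↦ ?_
  simpa using ((Point.some.injEq ..).mp h).1

/-- A multiple that vanishes for almost all points vanishes for all points. -/
lemma nsmul_eq_zero_of_finite [DecidableEq L] [C.IsElliptic] {s : Set C.Point} (hs : s.Finite)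
    {m : ℕ} (h : ∀ P ∉ s, m • P = 0) (P : C.Point) : m • P = 0 := by
  have := infinite_point (C := C)
  -- Every P is a sum of two points R and P - R outside the finite exceptional set.
  obtain ⟨R, hR⟩ := (hs.union (hs.image (P - ·))).infinite_compl.nonempty
  rw [Set.mem_compl_iff, Set.mem_union, not_or] at hR
  have h2 : P - R ∉ s := fun h ↦ hR.2 ⟨_, h, by simp⟩
  rw [← add_sub_cancel R P, nsmul_add, h R hR.1, h _ h2, add_zero]

end AlgClosed


/-! ### Multiplication by ℓ: formula, finite kernel, surjectivity. -/

section Prime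

open Polynomial

universe u

variable {k : Type u} [Field k] (E : WeierstrassCurve.Affine k)

/-- If x(nP) = x(P) identically, then nP = ±P, so n - 1 or n + 1 kills almost every point. The
resulting multiple, prime to ℓ, would kill all points, including a point of order ℓ. -/
lemma mulFormula_sub_ne_zero [E.IsElliptic] {L : Type u} [Field L] [DecidableEq L] [Algebra k L]
    [IsAlgClosed L] {ℓ : ℕ} (hℓ : ℓ.Prime) (hfin : {T : (E⁄L).Point | ℓ • T = 0}.Finite)
    {T₀ : (E⁄L).Point} (hT₀ : T₀ ≠ 0) (hℓT₀ : ℓ • T₀ = 0) {n : ℕ} (h1n : 1 < n) (hn : n < ℓ)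
    {F G B : k[X]} (hB : B ≠ 0)
    (h : ∀ (x y : L) (h : (E⁄L).Nonsingular x y), aeval x B ≠ 0 → aeval x G ≠ 0 ∧
      ∃ (x' y' : L) (h' : (E⁄L).Nonsingular x' y'),
        n • Point.some x y h = .some x' y' h' ∧ x' * aeval x G = aeval x F) :
    F - X * G ≠ 0 := by
  intro hFG
  rw [sub_eq_zero] at hFG
  have : (E⁄L).IsElliptic := inferInstanceAs (E.map (algebraMap k L)).IsElliptic
  have hbad := finite_root_points (C := E⁄L) (B := B.map (algebraMap k L))
    ((Polynomial.map_ne_zero_iff (algebraMap k L).injective).mpr hB)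
  set s := {P : (E⁄L).Point | ∀ x y h, P = .some x y h → (B.map (algebraMap k L)).eval x = 0}
  have key (P : (E⁄L).Point) (hP : P ∉ s) : (n - 1) • P = 0 ∨ (n + 1) • P = 0 := by
    simp only [s, Set.mem_ofPred_eq, not_forall] at hP
    obtain ⟨x, y, hxy, rfl, hx⟩ := hP
    rw [eval_map_algebraMap] at hx
    obtain ⟨hG, x', y', h', hmul, hx'⟩ := h x y hxy hx
    rw [hFG, map_mul, aeval_X] at hx'
    obtain rfl := mul_right_cancel₀ hG hx'
    rcases (Point.X_eq_iff (h₁ := h') (h₂ := hxy)).mp rfl with he | he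
    · left
      rw [← hmul] at he
      rw [← Nat.sub_add_cancel h1n.le, add_nsmul, one_nsmul] at he
      exact add_eq_right.mp he
    · right
      rw [← hmul] at he
      rw [add_nsmul, one_nsmul, he, neg_add_cancel]
  have hco {m : ℕ} (hm : ℓ.Coprime m) : m • T₀ ≠ 0 := by
    intro h0
    have h1 := addOrderOf_dvd_of_nsmul_eq_zero h0
    have h2 := addOrderOf_dvd_of_nsmul_eq_zero hℓT₀
    have h3 := Nat.dvd_gcd h2 h1
    rw [hm.gcd_eq_one, Nat.dvd_one, AddMonoid.addOrderOf_eq_one_iff] at h3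
    exact hT₀ h3
  have hlt {m : ℕ} (h0 : m ≠ 0) (hm : m < ℓ) : ℓ.Coprime m :=
    Nat.coprime_of_lt_prime h0 hm hℓ
  rcases (show n + 1 ≤ ℓ from hn).lt_or_eq with hn1 | hn1
  · refine hco ((hlt (by omega) (by omega : n - 1 < ℓ)).mul_right (hlt (by omega) hn1)) ?_
    refine nsmul_eq_zero_of_finite hbad (fun P hP ↦ ?_) T₀
    rcases key P hP with h | h
    · rw [mul_nsmul, h, nsmul_zero]
    · rw [mul_nsmul', h, nsmul_zero]
  -- For n + 1 = ℓ the second alternative concerns ℓ-torsion, which is finite by hypothesis and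
  -- joins the exceptional set; then n - 1 kills everything.
  · refine hco (hlt (by omega) (by omega : n - 1 < ℓ)) ?_
    refine nsmul_eq_zero_of_finite (hbad.union hfin) (fun P hP ↦ ?_) T₀
    rw [Set.mem_union, not_or] at hP
    rcases key P hP.1 with h | h
    · exact h
    · exact (hP.2 (hn1 ▸ h)).elim

lemma hasMulFormula_prime [E.IsElliptic] (h2 : (2 : k) ≠ 0) {L : Type u} [Field L] [DecidableEq L]
    [Algebra k L] [IsAlgClosed L] {ℓ : ℕ} (hℓ : ℓ.Prime)
    (hfin : {T : (E⁄L).Point | ℓ • T = 0}.Finite) {T₀ : (E⁄L).Point} (hT₀ : T₀ ≠ 0)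
    (hℓT₀ : ℓ • T₀ = 0) : HasMulFormula E ℓ := by
  have key (n : ℕ) : n + 2 ≤ ℓ → HasMulFormula E (n + 1) ∧ HasMulFormula E (n + 2) := by
    induction n with
    | zero => exact fun _ ↦ ⟨hasMulFormula_one E, hasMulFormula_two E h2⟩
    | succ n ih =>
      intro hn
      obtain ⟨h1, h2⟩ := ih (by omega)
      refine ⟨h2, h1.step E ?_⟩
      obtain ⟨F, G, B, hB, h⟩ := h2
      exact ⟨F, G, B, hB, mulFormula_sub_ne_zero E hℓ hfin hT₀ hℓT₀ (n := n + 2) (by omega)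
        (by omega) hB (h L), h⟩
  have := hℓ.two_le
  have := (key (ℓ - 2) (by omega)).2
  rwa [Nat.sub_add_cancel hℓ.two_le] at this

variable {E}

lemma HasMulFormula.exists_torsion_polynomial {n : ℕ} (h : HasMulFormula E n) :
    ∃ B : k[X], B ≠ 0 ∧ ∀ (L : Type u) [Field L] [DecidableEq L] [Algebra k L] (x y : L)
      (h : (E⁄L).Nonsingular x y), n • Point.some x y h = 0 → aeval x B = 0 := by
  obtain ⟨F, G, B, hB, h⟩ := h
  refine ⟨B, hB, fun L _ _ _ x y hxy hn ↦ ?_⟩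
  by_contra hne
  obtain ⟨-, x', y', h', hmul, -⟩ := h L x y hxy hne
  exact Point.some_ne_zero h' (hmul.symm.trans hn)

lemma HasMulFormula.torsion_finite {n : ℕ} (h : HasMulFormula E n) (L : Type u) [Field L]
    [DecidableEq L] [Algebra k L] : {T : (E⁄L).Point | n • T = 0}.Finite := by
  obtain ⟨B, hB, h⟩ := h.exists_torsion_polynomial
  refine (finite_root_points (C := E⁄L) (B := B.map (algebraMap k L))
    ((Polynomial.map_ne_zero_iff (algebraMap k L).injective).mpr hB)).subset ?_
  rintro T hT x y hxy rfl
  rw [eval_map_algebraMap]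
  exact h L x y hxy hT

/-- The numerator and the denominator in a multiplication formula can be chosen coprime. -/
lemma HasMulFormula.exists_coprime {n : ℕ} (h : HasMulFormula E n) :
    ∃ F G B : k[X], B ≠ 0 ∧ IsCoprime F G ∧ ∀ (L : Type u) [Field L] [DecidableEq L] [Algebra k L]
      (x y : L) (h : (E⁄L).Nonsingular x y), aeval x B ≠ 0 → aeval x G ≠ 0 ∧
      ∃ (x' y' : L) (h' : (E⁄L).Nonsingular x' y'),
        n • Point.some x y h = .some x' y' h' ∧ x' * aeval x G = aeval x F := by
  obtain ⟨F, G, B, hB, h⟩ := h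
  -- If G = 0, the formula forces B to vanish at every point, so any coprime pair will do.
  rcases eq_or_ne G 0 with rfl | hG
  · refine ⟨1, 1, B, hB, isCoprime_one_left, fun L _ _ _ x y hxy hne ↦ ?_⟩
    exact absurd (map_zero _) (h L x y hxy hne).1
  obtain ⟨D, F', G', hD, rfl, rfl⟩ : ∃ D F' G' : k[X], IsCoprime F' G' ∧ F = D * F' ∧ G = D * G' := by
    classical
    have hg : EuclideanDomain.gcd F G ≠ 0 := by
      intro h0
      exact hG (EuclideanDomain.gcd_eq_zero_iff.mp h0).2
    obtain ⟨F', hF'⟩ := EuclideanDomain.gcd_dvd_left F G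
    obtain ⟨G', hG'⟩ := EuclideanDomain.gcd_dvd_right F G
    refine ⟨_, F', G', ?_, hF', hG'⟩
    have := EuclideanDomain.gcd_eq_gcd_ab F G
    refine ⟨EuclideanDomain.gcdA F G, EuclideanDomain.gcdB F G, mul_left_cancel₀ hg ?_⟩
    calc _ = (EuclideanDomain.gcd F G * F') * EuclideanDomain.gcdA F G +
          (EuclideanDomain.gcd F G * G') * EuclideanDomain.gcdB F G := by ring
      _ = _ := by rw [← hF', ← hG', ← this, mul_one]
  refine ⟨F', G', B, hB, hD, fun L _ _ _ x y hxy hne ↦ ?_⟩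
  obtain ⟨hG0, x', y', h', hmul, hx'⟩ := h L x y hxy hne
  rw [map_mul, mul_ne_zero_iff] at hG0
  refine ⟨hG0.2, x', y', h', hmul, mul_left_cancel₀ hG0.1 ?_⟩
  rw [map_mul, map_mul] at hx'
  rw [← hx']; ring

lemma finite_preimage_nsmul {L : Type*} [Field L] [DecidableEq L] {C : WeierstrassCurve.Affine L}
    {n : ℕ} (hfin : {T : C.Point | n • T = 0}.Finite) {s : Set C.Point} (hs : s.Finite) :
    {P : C.Point | n • P ∈ s}.Finite := by
  refine hs.preimage' (f := fun P : C.Point ↦ n • P) fun Q _ ↦ ?_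
  rcases ((fun P : C.Point ↦ n • P) ⁻¹' {Q}).eq_empty_or_nonempty with h | ⟨P, hP⟩
  · rw [h]; exact Set.finite_empty
  · refine (hfin.image (P + ·)).subset fun R hR ↦ ⟨R - P, ?_, by simp⟩
    rw [Set.mem_preimage, Set.mem_singleton_iff] at hP hR
    change n • (R - P) = 0
    rw [nsmul_sub, hP, hR, sub_self]

/-- Multiplication by `n` is surjective on the points over an algebraically closed field. -/
lemma HasMulFormula.surjective [E.IsElliptic] {n : ℕ} (hf : HasMulFormula E n) {L : Type u}
    [Field L] [DecidableEq L] [Algebra k L] [IsAlgClosed L] (Q : (E⁄L).Point) :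
    ∃ P : (E⁄L).Point, n • P = Q := by
  have : (E⁄L).IsElliptic := inferInstanceAs (E.map (algebraMap k L)).IsElliptic
  have hker := hf.torsion_finite L
  obtain ⟨F, G, B, hB, hFG, h⟩ := hf.exists_coprime
  have hBL : B.map (algebraMap k L) ≠ 0 :=
    (Polynomial.map_ne_zero_iff (algebraMap k L).injective).mpr hB
  set F' := F.map (algebraMap k L)
  set G' := G.map (algebraMap k L)
  have hFG' : IsCoprime F' G' := hFG.map (Polynomial.mapRingHom (algebraMap k L))
  have hinf := infinite_point (C := E⁄L)
  have hbad := finite_root_points (C := E⁄L) hBL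
  -- `x(n P)` is not constant
  have hnc (c : L) : ¬ F' = C c * G' := by
    intro hc
    have hs : {P : (E⁄L).Point | n • P ∈ Point.xRep (W' := E⁄L) ⁻¹' {![c, 1]}}.Finite :=
      finite_preimage_nsmul hker (xRep_fiber_finite _)
    obtain ⟨P, hP⟩ := (hbad.union hs).infinite_compl.nonempty
    simp only [Set.mem_compl_iff, Set.mem_union, Set.mem_ofPred_eq, not_or, not_forall] at hP
    obtain ⟨⟨x, y, hxy, rfl, hx⟩, hP⟩ := hP
    rw [eval_map_algebraMap] at hx
    obtain ⟨hG, x', y', h', hmul, hx'⟩ := h L x y hxy hx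
    apply hP
    rw [hmul, Set.mem_preimage, Point.xRep_some, Set.mem_singleton_iff]
    have := congr_arg (eval x) hc
    rw [eval_mul, eval_C, eval_map_algebraMap, eval_map_algebraMap, ← hx'] at this
    rw [mul_right_cancel₀ hG this]
  -- the exceptional values of `x(Q)`
  let S₁ : Set L := (fun x ↦ F'.eval x / G'.eval x) '' (B.map (algebraMap k L)).rootSet L
  -- For these values F - a G has no root. Two such values would make F and G, and hence x(nP),
  -- constant.
  let S₂ : Set L := {a | (F' - C a * G').degree = 0}
  have hS₁ : S₁.Finite := (rootSet_finite _ L).image _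
  have hS₂ : S₂.Finite := by
    refine Set.Subsingleton.finite fun a ha b hb ↦ ?_
    by_contra hab
    obtain ⟨c, hc⟩ : ∃ c, F' - C a * G' = C c := ⟨_, eq_C_of_degree_eq_zero ha⟩
    obtain ⟨d, hd⟩ : ∃ d, F' - C b * G' = C d := ⟨_, eq_C_of_degree_eq_zero hb⟩
    have hab' : b - a ≠ 0 := sub_ne_zero.mpr (Ne.symm hab)
    have hG : G' = C ((b - a)⁻¹ * (c - d)) := by
      have h1 : C (b - a) * G' = C (c - d) := by
        rw [C_sub, C_sub, ← hc, ← hd]; ring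
      rw [C_mul, ← h1, ← mul_assoc, ← C_mul, inv_mul_cancel₀ hab', C_1, one_mul]
    have hF : F' = C (c + a * ((b - a)⁻¹ * (c - d))) := by
      rw [C_add, C_mul, ← hG, ← hc]; ring
    have hg : (b - a)⁻¹ * (c - d) ≠ 0 := by
      intro h0
      obtain ⟨P, hP⟩ := hbad.infinite_compl.nonempty
      simp only [Set.mem_compl_iff, Set.mem_ofPred_eq, not_forall] at hP
      obtain ⟨x, y, hxy, rfl, hx⟩ := hP
      rw [eval_map_algebraMap] at hx
      apply (h L x y hxy hx).1
      rw [← eval_map_algebraMap]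
      change eval x G' = 0
      rw [hG, h0, C_0, eval_zero]
    refine hnc ((c + a * ((b - a)⁻¹ * (c - d))) / ((b - a)⁻¹ * (c - d))) ?_
    rw [hF, hG, ← C_mul, div_mul_cancel₀ _ hg]
  let S : Set (E⁄L).Point := Point.xRep ⁻¹' (insert ![1, 0] ((fun a ↦ ![a, 1]) '' (S₁ ∪ S₂)))
  have hS : S.Finite := finite_of_xRep (((hS₁.union hS₂).image _).insert _)
  have hgood (R : (E⁄L).Point) (hR : R ∉ S) : ∃ P, n • P = R := by
    rcases R with _ | ⟨a, b, hab⟩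
    · exact (hR (Set.mem_insert _ _)).elim
    have ha : a ∉ S₁ ∪ S₂ := fun ha ↦ hR (Set.mem_insert_of_mem _ ⟨a, ha, rfl⟩)
    rw [Set.mem_union, not_or] at ha
    obtain ⟨x, hx⟩ := IsAlgClosed.exists_root _ ha.2
    rw [IsRoot, eval_sub, eval_mul, eval_C, sub_eq_zero] at hx
    have hGx : G'.eval x ≠ 0 := by
      intro h0
      obtain ⟨u, v, huv⟩ := hFG'
      have := congr_arg (eval x) huv
      simp [hx, h0] at this
    have hBx : aeval x B ≠ 0 := by
      intro h0
      refine ha.1 ⟨x, ?_, ?_⟩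
      · rw [mem_rootSet]
        exact ⟨hBL, by simpa using h0⟩
      · simp only [hx]
        rw [mul_div_cancel_right₀ _ hGx]
    obtain ⟨y, hy⟩ := exists_equation (E⁄L) x
    obtain ⟨hG, x', y', h', hmul, hx'⟩ := h L x y (equation_iff_nonsingular.mp hy) hBx
    have hxa : x' = a := by
      rw [← eval_map_algebraMap, ← eval_map_algebraMap] at hx'
      exact mul_right_cancel₀ hGx (hx'.trans hx)
    rcases (Point.X_eq_iff (h₁ := h') (h₂ := hab)).mp hxa with he | he
    · exact ⟨_, hmul.trans he⟩
    · refine ⟨-Point.mk hy, ?_⟩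
      rw [smul_neg, ← neg_eq_iff_eq_neg.mpr he, ← hmul]
      rfl
  -- A translate of Q by a multiple nP avoids the finite exceptional set, so nP + Q is divisible by
  -- n, and then so is Q.
  obtain ⟨P, hP⟩ := ((finite_preimage_nsmul hker hS).union
    (finite_preimage_nsmul hker (hS.image (· - Q)))).infinite_compl.nonempty
  simp only [Set.mem_compl_iff, Set.mem_union, Set.mem_ofPred_eq, not_or] at hP
  obtain ⟨P', hP'⟩ := hgood (n • P + Q) fun hmem ↦ hP.2 ⟨_, hmem, by simp⟩
  exact ⟨P' - P, by rw [nsmul_sub, hP', add_sub_cancel_left]⟩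

end Prime


/-! ### Derivations and the invariant differential. -/

section Tangent

variable {R L : Type*} [CommRing R] [Field L] [Algebra R L]

/-- The value of a derivation of the base field at the coordinates of a point is the `c`-multiple
of the invariant vector field there. -/
def IsTangent (D : Derivation R L L) {W : WeierstrassCurve.Affine L} : W.Point → L → Prop
  | .zero, c => c = 0
  | .some x y _, c => D x = c * (2 * y + W.a₁ * x + W.a₃) ∧
      D y = c * (3 * x ^ 2 + 2 * W.a₂ * x + W.a₄ - W.a₁ * y)

variable {D : Derivation R L L} {W : WeierstrassCurve.Affine L}

/-- At a nonsingular point one of the two partial derivatives is nonzero, and it determines the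
coefficient. -/
lemma IsTangent.unique {P : W.Point} {c d : L} (hc : IsTangent D P c) (hd : IsTangent D P d) :
    c = d := by
  rcases P with _ | ⟨x, y, h⟩
  · exact hc.trans hd.symm
  obtain ⟨h1, h2⟩ := hc
  obtain ⟨h3, h4⟩ := hd
  rcases (nonsingular_iff' ..).mp h |>.2 with h | h
  · refine mul_right_cancel₀ (neg_ne_zero.mpr h) ?_
    linear_combination h4 - h2
  · exact mul_right_cancel₀ h (h1.symm.trans h3)

section Coefficients

variable (h₁ : D W.a₁ = 0) (h₂ : D W.a₂ = 0) (h₃ : D W.a₃ = 0) (h₄ : D W.a₄ = 0) (h₆ : D W.a₆ = 0)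
include h₁ h₂ h₃ h₄ h₆

lemma derivation_equation {x y : L} (h : W.Equation x y) :
    (2 * y + W.a₁ * x + W.a₃) * D y = (3 * x ^ 2 + 2 * W.a₂ * x + W.a₄ - W.a₁ * y) * D x := by
  have := congr_arg D ((equation_iff ..).mp h)
  simp only [map_add, Derivation.leibniz, Derivation.leibniz_pow, h₁, h₂, h₃, h₄, h₆,
    smul_eq_mul, nsmul_eq_mul, mul_zero, add_zero] at this
  push_cast at this
  linear_combination this

lemma exists_isTangent (P : W.Point) : ∃ c, IsTangent D P c := by
  rcases P with _ | ⟨x, y, h⟩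
  · exact ⟨0, rfl⟩
  have e := derivation_equation h₁ h₂ h₃ h₄ h₆ h.1
  rcases (nonsingular_iff' ..).mp h |>.2 with h | h
  · refine ⟨-D y / (W.a₁ * y - (3 * x ^ 2 + 2 * W.a₂ * x + W.a₄)), ?_, ?_⟩
    all_goals rw [div_mul_eq_mul_div, eq_div_iff h]
    · linear_combination e
    · ring
  · refine ⟨D x / (2 * y + W.a₁ * x + W.a₃), ?_, ?_⟩
    · field_simp
    · field_simp
      linear_combination e

omit h₂ h₄ h₆ in
lemma IsTangent.neg {P : W.Point} {c : L} (h : IsTangent D P c) : IsTangent D (-P) (-c) := by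
  rcases P with _ | ⟨x, y, hP⟩
  · change -c = 0
    rw [show c = 0 from h, neg_zero]
  obtain ⟨hx, hy⟩ := h
  rw [Point.neg_some]
  refine ⟨?_, ?_⟩ <;>
    simp only [negY, map_sub, map_neg, Derivation.leibniz, h₁, h₃, smul_eq_mul, hx, hy] <;> ring

omit h₄ h₆ in
-- The computation common to chords and tangents, with ℓ the slope. `hφ` is the derivative at x₁ of
-- the Weierstrass equation restricted to the line, which is (x - x₁)(x - x₂)(x - x₃).
lemma IsTangent.of_slope {x₁ y₁ x₂ y₂ ℓ c d : L} (h1 : W.Nonsingular x₁ y₁)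
    (hP : IsTangent D (.some x₁ y₁ h1) c)
    (hφ : 3 * x₁ ^ 2 + 2 * W.a₂ * x₁ + W.a₄ - W.a₁ * y₁ - ℓ * (2 * y₁ + W.a₁ * x₁ + W.a₃) =
      (x₁ - x₂) * (x₁ - W.addX x₁ x₂ ℓ)) (hy : y₁ - y₂ = ℓ * (x₁ - x₂))
    (hx₂ : D x₂ = d * (2 * y₂ + W.a₁ * x₂ + W.a₃))
    (hℓ : D ℓ = c * (x₁ - W.addX x₁ x₂ ℓ) + d * (x₂ - W.addX x₁ x₂ ℓ))
    (h3 : W.Nonsingular (W.addX x₁ x₂ ℓ) (W.addY x₁ x₂ y₁ ℓ)) :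
    IsTangent D (.some _ _ h3) (c + d) := by
  obtain ⟨hx₁, hy₁⟩ := hP
  have hx : D (W.addX x₁ x₂ ℓ) = (c + d) *
      (2 * W.addY x₁ x₂ y₁ ℓ + W.a₁ * W.addX x₁ x₂ ℓ + W.a₃) := by
    have : D (W.addX x₁ x₂ ℓ) = (2 * ℓ + W.a₁) * D ℓ - D x₁ - D x₂ := by
      simp only [addX, map_sub, map_add, Derivation.leibniz, Derivation.leibniz_pow, h₁, h₂,
        smul_eq_mul, nsmul_eq_mul]
      push_cast
      ring
    rw [this, hℓ, hx₁, hx₂]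
    simp only [addY, negAddY, negY]
    linear_combination (2 * d) * hy
  refine ⟨hx, ?_⟩
  have : D (W.addY x₁ x₂ y₁ ℓ) = -(D ℓ * (W.addX x₁ x₂ ℓ - x₁) +
      ℓ * (D (W.addX x₁ x₂ ℓ) - D x₁) + D y₁) - W.a₁ * D (W.addX x₁ x₂ ℓ) := by
    simp only [addY, negAddY, negY, map_sub, map_add, map_neg, Derivation.leibniz, h₁, h₃,
      smul_eq_mul]
    ring
  rw [this, hx, hℓ, hx₁, hy₁]
  simp only [addY, negAddY, negY]
  simp only [addX] at hφ ⊢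
  linear_combination -(2 * c + d) * hφ

omit h₆ in
-- This is the translation invariance of dx / (2y + a₁x + a₃): the coefficient is the value of this
-- differential on D, and it is additive in the point. The derivative of the slope comes from
-- differentiating its defining equation.
lemma IsTangent.add [DecidableEq L] {P Q : W.Point} {c d : L} (hP : IsTangent D P c)
    (hQ : IsTangent D Q d) : IsTangent D (P + Q) (c + d) := by
  rcases P with _ | ⟨x₁, y₁, h1⟩
  · rw [show c = 0 from hP, zero_add]
    exact hQ
  rcases Q with _ | ⟨x₂, y₂, h2⟩
  · rw [show d = 0 from hQ, add_zero]
    exact hP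
  by_cases hxy : x₁ = x₂ ∧ y₁ = W.negY x₂ y₂
  · obtain ⟨rfl, rfl⟩ := hxy
    rw [Point.add_of_Y_eq rfl rfl]
    have : IsTangent D (.some _ _ h1) (-d) := IsTangent.neg h₁ h₃ hQ
    exact add_eq_zero_iff_eq_neg.mpr (hP.unique this)
  rw [Point.add_some hxy]
  set ℓ := W.slope x₁ x₂ y₁ y₂ with hℓ
  have e1 := (equation_iff ..).mp h1.1
  have e2 := (equation_iff ..).mp h2.1
  by_cases hx : x₁ = x₂
  · subst hx
    have hy : y₁ ≠ W.negY x₁ y₂ := fun h ↦ hxy ⟨rfl, h⟩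
    obtain rfl := Y_eq_of_Y_ne h1.1 h2.1 rfl hy
    have hψ : 2 * y₁ + W.a₁ * x₁ + W.a₃ ≠ 0 := by
      intro h0
      apply hy
      rw [negY]
      linear_combination h0
    have hℓψ : ℓ * (2 * y₁ + W.a₁ * x₁ + W.a₃) =
        3 * x₁ ^ 2 + 2 * W.a₂ * x₁ + W.a₄ - W.a₁ * y₁ := by
      rw [hℓ, slope_of_Y_ne rfl hy, show y₁ - W.negY x₁ y₁ = 2 * y₁ + W.a₁ * x₁ + W.a₃ by
        rw [negY]; ring, div_mul_cancel₀ _ hψ]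
    obtain rfl := IsTangent.unique hP hQ
    refine IsTangent.of_slope h₁ h₂ h₃ h1 hP ?_ (by ring) hQ.1 ?_ _
    · rw [hℓψ]; ring
    · have h5 := congr_arg D hℓψ
      simp only [map_add, map_sub, Derivation.leibniz, Derivation.leibniz_pow, h₁, h₂, h₃, h₄,
        smul_eq_mul, nsmul_eq_mul, mul_zero, add_zero, hP.1, hP.2] at h5
      have n2 : D 2 = 0 := D.map_natCast 2
      have n3 : D 3 = 0 := D.map_natCast 3
      rw [n2, n3] at h5
      push_cast at h5
      refine mul_right_cancel₀ hψ ?_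
      rw [addX]
      linear_combination h5 + (c * W.a₁ + 2 * c * ℓ) * hℓψ
  · have hx' : x₁ - x₂ ≠ 0 := sub_ne_zero.mpr hx
    have hy : y₁ - y₂ = ℓ * (x₁ - x₂) := by
      rw [hℓ, slope_of_X_ne hx, div_mul_cancel₀ _ hx']
    have hφ : 3 * x₁ ^ 2 + 2 * W.a₂ * x₁ + W.a₄ - W.a₁ * y₁ - ℓ * (2 * y₁ + W.a₁ * x₁ + W.a₃) =
        (x₁ - x₂) * (x₁ - W.addX x₁ x₂ ℓ) := by
      refine mul_right_cancel₀ hx' ?_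
      rw [addX]
      linear_combination e2 - e1 + (y₁ - ℓ * (x₁ - x₂) + y₂ + W.a₁ * x₂ + W.a₃) * hy
    refine IsTangent.of_slope h₁ h₂ h₃ h1 hP hφ hy hQ.1 ?_ _
    have h5 := congr_arg D hy
    simp only [map_sub, Derivation.leibniz, smul_eq_mul, hP.1, hP.2, hQ.1, hQ.2] at h5
    refine mul_right_cancel₀ hx' ?_
    rw [addX] at hφ ⊢
    linear_combination -h5 + (c - d) * hφ - (W.a₁ * d + 2 * d * ℓ) * hy

omit h₆ in
lemma IsTangent.nsmul [DecidableEq L] {P : W.Point} {c : L} (h : IsTangent D P c) (n : ℕ) :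
    IsTangent D (n • P) (n * c) := by
  induction n with
  | zero => rw [zero_smul, Nat.cast_zero, zero_mul]; rfl
  | succ n ih =>
    rw [add_smul, one_smul, Nat.cast_add, add_mul, Nat.cast_one, one_mul]
    exact ih.add h₁ h₂ h₃ h₄ h

end Coefficients

end Tangent

/-! ### Rationality of Galois invariant points. -/

section Descent

/-- If all derivations of k(s) over k vanish, so do the Kähler differentials; a finitely generated
extension without differentials is separable algebraic. -/
lemma isSeparable_of_derivation {k L : Type*} [Field k] [Field L] [Algebra k L] {s : Set L}
    (hs : s.Finite) (h : ∀ D : Derivation k (IntermediateField.adjoin k s)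
      (IntermediateField.adjoin k s), ∀ (x : L) (hx : x ∈ s),
        D ⟨x, IntermediateField.subset_adjoin k s hx⟩ = 0) {x : L} (hx : x ∈ s) :
    IsSeparable k x := by
  set M := IntermediateField.adjoin k s
  have hM : Algebra.EssFiniteType k M :=
    IntermediateField.essFiniteType_iff.mpr (IntermediateField.fg_adjoin_of_finite hs)
  have hD (D : Derivation k M M) (z : M) : D z = 0 := by
    obtain ⟨z, hz⟩ := z
    induction hz using IntermediateField.adjoin_induction with
    | mem z hz => exact h D z hz
    | algebraMap a => exact D.map_algebraMap a
    | add a b ha hb iha ihb => exact (D.map_add ⟨a, ha⟩ ⟨b, hb⟩).trans (by rw [iha, ihb, add_zero])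
    | inv a ha iha => exact (D.leibniz_inv ⟨a, ha⟩).trans (by rw [iha, smul_zero])
    | mul a b ha hb iha ihb =>
      exact (D.leibniz ⟨a, ha⟩ ⟨b, hb⟩).trans (by rw [iha, ihb, smul_zero, smul_zero, add_zero])
  have hu : Algebra.FormallyUnramified k M := by
    refine ⟨subsingleton_of_forall_eq 0 fun ω ↦ ?_⟩
    rw [← Module.forall_dual_apply_eq_zero_iff M]
    intro φ
    have hφ : φ = 0 := by
      apply KaehlerDifferential.linearMapEquivDerivation k M |>.injective
      ext z
      exact congr_arg Subtype.val ((hD _ z).trans (by simp))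
    rw [hφ, LinearMap.zero_apply]
  have := (Algebra.FormallyUnramified.iff_isSeparable k M).mp hu
  have := Algebra.IsSeparable.isSeparable k (⟨x, IntermediateField.subset_adjoin k s hx⟩ : M)
  rwa [IsSeparable, ← minpoly.algebraMap_eq (algebraMap M L).injective] at this

/-- All conjugates coincide by invariance and are distinct by separability, so the minimal
polynomial is linear. -/
lemma mem_range_of_fixed {k L : Type*} [Field k] [Field L] [Algebra k L] [IsAlgClosure k L] {x : L}
    (hx : IsSeparable k x) (h : ∀ σ : L ≃ₐ[k] L, σ x = x) : x ∈ (algebraMap k L).range := by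
  have : Algebra.IsAlgebraic k L := IsAlgClosure.isAlgebraic
  have : IsAlgClosed L := IsAlgClosure.isAlgClosed k
  have : Normal k L := IsAlgClosure.normal k L
  have hroots (y : L) (hy : y ∈ (minpoly k x).aroots L) : y = x := by
    rw [Polynomial.mem_aroots] at hy
    obtain ⟨σ, rfl⟩ := minpoly.exists_algEquiv_of_root' (Algebra.IsAlgebraic.isAlgebraic x) hy.2
    exact h σ
  rw [← minpoly.natDegree_eq_one_iff]
  have hsplit := IsAlgClosed.splits ((minpoly k x).map (algebraMap k L))
  have hcard := hsplit.natDegree_eq_card_roots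
  rw [Polynomial.natDegree_map] at hcard
  rw [hcard]
  have hnd : ((minpoly k x).aroots L).Nodup := Polynomial.nodup_roots (Polynomial.Separable.map hx)
  have hmem : x ∈ (minpoly k x).aroots L := by
    rw [Polynomial.mem_aroots]
    exact ⟨minpoly.ne_zero (Algebra.IsIntegral.isIntegral x), minpoly.aeval k x⟩
  have : (minpoly k x).aroots L = {x} := by
    refine (Multiset.Nodup.ext hnd (Multiset.nodup_singleton x)).mpr fun y ↦ ?_
    rw [Multiset.mem_singleton]
    exact ⟨hroots y, fun h ↦ h ▸ hmem⟩
  change ((minpoly k x).aroots L).card = 1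
  rw [this, Multiset.card_singleton]

/-- A Galois invariant point is rational if a multiple of it by an integer prime to the
characteristic is rational and not zero. -/
lemma exists_map_eq_of_fixed {k L : Type*} [Field k] [DecidableEq k] [Field L] [DecidableEq L]
    [Algebra k L] [IsAlgClosure k L] (E : WeierstrassCurve.Affine k) {n : ℕ} (hn : (n : k) ≠ 0)
    {P : (E⁄L).Point} {Q : (E⁄k).Point} (hQ : Q ≠ 0)
    (hP : n • P = Point.map (Algebra.ofId k L) Q)
    (hσ : ∀ σ : L ≃ₐ[k] L, Point.map (W' := E) (σ : L →ₐ[k] L) P = P) :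
    ∃ P₀ : (E⁄k).Point, Point.map (Algebra.ofId k L) P₀ = P := by
  classical
  rcases P with _ | ⟨x, y, h⟩
  · exact ⟨0, Point.map_zero _⟩
  set s : Set L := {x, y}
  set M := IntermediateField.adjoin k s
  have hxs : x ∈ s := Set.mem_insert x _
  have hys : y ∈ s := Set.mem_insert_of_mem _ rfl
  let x' : M := ⟨x, IntermediateField.subset_adjoin k s hxs⟩
  let y' : M := ⟨y, IntermediateField.subset_adjoin k s hys⟩
  have h' : (E⁄M).Nonsingular x' y' :=
    (E.baseChange_nonsingular (f := M.val) M.val.injective x' y').mp h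
  have hmul : n • Point.some x' y' h' = Point.map (Algebra.ofId k M) Q := by
    apply Point.map_injective (W' := E) M.val
    rw [map_nsmul, Point.map_map, Point.map_some]
    exact hP
  -- A derivation of k(P) kills the coordinates of the rational point nP, so n times its coefficient
  -- c at P is 0. As n is invertible, c = 0, and D kills the coordinates of P.
  have hsep {z : L} (hz : z ∈ s) : IsSeparable k z := by
    refine isSeparable_of_derivation (s := s) (by simp [s]) (fun D z hz ↦ ?_) hz
    have hA (a : k) : D (algebraMap k M a) = 0 := D.map_algebraMap a
    have a₁ : D (E⁄M).a₁ = 0 := hA _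
    have a₂ : D (E⁄M).a₂ = 0 := hA _
    have a₃ : D (E⁄M).a₃ = 0 := hA _
    have a₄ : D (E⁄M).a₄ = 0 := hA _
    have a₆ : D (E⁄M).a₆ = 0 := hA _
    obtain ⟨c, hc⟩ := exists_isTangent a₁ a₂ a₃ a₄ a₆ (.some x' y' h')
    have h1 := hc.nsmul a₁ a₂ a₃ a₄ n
    have h2 : IsTangent D (n • Point.some x' y' h') 0 := by
      rw [hmul]
      rcases Q with _ | ⟨u, v, huv⟩
      · exact (hQ rfl).elim
      rw [Point.map_some]
      refine ⟨?_, ?_⟩ <;> rw [zero_mul] <;> exact hA _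
    have hc0 : c = 0 := by
      refine (mul_eq_zero.mp (h1.unique h2)).resolve_left ?_
      rw [← map_natCast (algebraMap k M)]
      exact (map_ne_zero _).mpr hn
    rw [hc0] at hc
    obtain ⟨hx, hy⟩ := hc
    rw [zero_mul] at hx hy
    rcases hz with rfl | rfl
    · exact hx
    · exact hy
  obtain ⟨x₀, rfl⟩ := mem_range_of_fixed (hsep hxs) fun σ ↦ by
    have := hσ σ
    rw [Point.map_some, Point.some.injEq] at this
    exact this.1
  obtain ⟨y₀, rfl⟩ := mem_range_of_fixed (hsep hys) fun σ ↦ by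
    have := hσ σ
    rw [Point.map_some, Point.some.injEq] at this
    exact this.2
  refine ⟨.some x₀ y₀ ((E.baseChange_nonsingular (f := Algebra.ofId k L)
    (Algebra.ofId k L).injective x₀ y₀).mp h), ?_⟩
  rw [Point.map_some]
  rfl

end Descent


/-! ### The quotient g_P(W) / h_W(P) and its functional equations. -/

section Pairing

variable {k : Type*} [Field k] {E : WeierstrassCurve.Affine k}

open Classical in
/-- The polynomial function, monic at infinity, whose zeros are the points of `D`, if it exists. -/
def fn (D : Multiset E.Point) : E.CoordinateRing :=
  if h : ∃ g : E.CoordinateRing, HasZeros g D ∧ IsMon g D.card then h.choose else 0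

/-- The product of the values of the function with zeros `D` at the points of `D'`. -/
def ev (D D' : Multiset E.Point) : k :=
  (D'.map (value (fn D))).prod

lemma ev_add_right (D D₁ D₂ : Multiset E.Point) : ev D (D₁ + D₂) = ev D D₁ * ev D D₂ := by
  simp [ev]

lemma ev_singleton (D : Multiset E.Point) (P : E.Point) : ev D {P} = value (fn D) P := by
  simp [ev]

lemma ev_cons (D D' : Multiset E.Point) (P : E.Point) :
    ev D (P ::ₘ D') = value (fn D) P * ev D D' := by
  simp [ev]

lemma ev_replicate (D : Multiset E.Point) (n : ℕ) (P : E.Point) :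
    ev D (Multiset.replicate n P) = value (fn D) P ^ n := by
  simp [ev]

lemma HasZeros.eq_fn {D : Multiset E.Point} {g : E.CoordinateRing} {n : ℕ} (hg : HasZeros g D)
    (hn : IsMon g n) (hD : ∀ P ∈ D, P ≠ 0) : g = fn D := by
  have h : ∃ g : E.CoordinateRing, HasZeros g D ∧ IsMon g D.card := exists_isMon_of_span hD hg
  rw [fn, dif_pos h]
  exact hn.eq_of_span_eq h.choose_spec.2 (hg.trans h.choose_spec.1.symm)

variable [DecidableEq k]

/-- A divisor `D - deg(D) P_∞` with `D` affine and effective that is principal. -/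
structure IsPrincipal (D : Multiset E.Point) : Prop where
  ne_zero : ∀ P ∈ D, P ≠ 0
  sum_eq_zero : D.sum = 0

namespace IsPrincipal

variable {D D' : Multiset E.Point}

lemma hasZeros (hD : IsPrincipal D) : HasZeros (fn D) D := by
  have h := exists_hasZeros_isMon hD.1 hD.2
  rw [fn, dif_pos h]
  exact h.choose_spec.1

lemma isMon (hD : IsPrincipal D) : IsMon (fn D) D.card := by
  have h := exists_hasZeros_isMon hD.1 hD.2
  rw [fn, dif_pos h]
  exact h.choose_spec.2

lemma add (hD : IsPrincipal D) (hD' : IsPrincipal D') : IsPrincipal (D + D') where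
  ne_zero P hP := (Multiset.mem_add.mp hP).elim (hD.1 P) (hD'.1 P)
  sum_eq_zero := by rw [Multiset.sum_add, hD.2, hD'.2, add_zero]

lemma nsmul (hD : IsPrincipal D) (n : ℕ) : IsPrincipal (n • D) where
  ne_zero P hP := hD.1 P (Multiset.mem_of_mem_nsmul hP)
  sum_eq_zero := by rw [Multiset.sum_nsmul, hD.2, nsmul_zero]

lemma replicate {W : E.Point} {n : ℕ} (hW : W ≠ 0) (h : n • W = 0) :
    IsPrincipal (Multiset.replicate n W) where
  ne_zero P hP := Multiset.eq_of_mem_replicate hP ▸ hW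
  sum_eq_zero := by rw [Multiset.sum_replicate, h]

lemma fn_add (hD : IsPrincipal D) (hD' : IsPrincipal D') : fn (D + D') = fn D * fn D' :=
  ((hD.hasZeros.mul hD'.hasZeros).eq_fn (hD.isMon.mul hD'.isMon) (hD.add hD').1).symm

lemma fn_nsmul (hD : IsPrincipal D) (n : ℕ) : fn (n • D) = fn D ^ n :=
  ((hD.hasZeros.pow n).eq_fn (hD.isMon.pow n) (hD.nsmul n).1).symm

lemma value_fn_ne_zero (hD : IsPrincipal D) {P : E.Point} (hP : P ≠ 0) (h : P ∉ D) :
    value (fn D) P ≠ 0 :=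
  (hD.hasZeros.value_eq_zero_iff hP).not.mpr h

lemma ev_comm_of_even (hD : IsPrincipal D) (hD' : IsPrincipal D') (h : Even D.card) :
    ev D' D = ev D D' := by
  obtain ⟨r, hr⟩ := h
  have := hD.isMon
  rw [hr, ← two_mul] at this
  exact weil_reciprocity_of_even this hD'.isMon hD.hasZeros hD'.hasZeros hD.1 hD'.1

end IsPrincipal

variable (E) in
-- One constant ε serves all pairs with the given degrees. Its value is irrelevant wherever it
-- cancels or is absorbed into a constant; if no such pair exists, any ε works.
lemma exists_ev_comm (m n : ℕ) : ∃ ε : k, ε ≠ 0 ∧ ∀ {D D' : Multiset E.Point}, IsPrincipal D →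
    IsPrincipal D' → D.card = m → D'.card = n → ev D' D = ε * ev D D' := by
  by_cases h : ∃ D D' : Multiset E.Point, IsPrincipal D ∧ IsPrincipal D' ∧ D.card = m ∧ D'.card = n
  · obtain ⟨D, D', hD, hD', rfl, rfl⟩ := h
    obtain ⟨ε, hε, h⟩ := exists_weil_sign E hD.isMon.ne_one hD'.isMon.ne_one
    refine ⟨ε, hε, fun h1 h2 h3 h4 ↦ h (h3 ▸ h1.isMon) (h4 ▸ h2.isMon) h1.hasZeros h2.hasZeros
      h1.1 h2.1⟩
  · exact ⟨1, one_ne_zero, fun h1 h2 h3 h4 ↦ (h ⟨_, _, h1, h2, h3, h4⟩).elim⟩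

/-- The zeros of the function `g_P`. -/
def divisionDivisor (ℓ : ℕ) (P : E.Point) : Multiset E.Point :=
  Multiset.replicate ℓ P + {-(ℓ • P)}

/-- The quotient `g_P(W) / h_W(P)`. -/
def kappa (ℓ : ℕ) (W P : E.Point) : k :=
  value (fn (divisionDivisor ℓ P)) W / value (fn (Multiset.replicate ℓ W)) P

variable {ℓ : ℕ}

lemma isPrincipal_divisionDivisor {P : E.Point} (hP : ℓ • P ≠ 0) :
    IsPrincipal (divisionDivisor ℓ P) where
  ne_zero R hR := by
    rw [divisionDivisor, Multiset.mem_add, Multiset.mem_singleton] at hR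
    rcases hR with hR | rfl
    · rw [Multiset.eq_of_mem_replicate hR]
      rintro rfl
      exact hP (nsmul_zero ℓ)
    · exact neg_ne_zero.mpr hP
  sum_eq_zero := by simp [divisionDivisor]

lemma card_divisionDivisor (P : E.Point) : (divisionDivisor ℓ P).card = ℓ + 1 := by
  simp [divisionDivisor]

lemma not_mem_divisionDivisor {P R : E.Point} (h : R ≠ P) (h' : R ≠ -(ℓ • P)) :
    R ∉ divisionDivisor ℓ P := by
  rw [divisionDivisor, Multiset.mem_add, Multiset.mem_singleton, not_or]
  exact ⟨fun hR ↦ h (Multiset.eq_of_mem_replicate hR), h'⟩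

lemma ev_divisionDivisor (D : Multiset E.Point) (P : E.Point) :
    ev D (divisionDivisor ℓ P) = value (fn D) P ^ ℓ * value (fn D) (-(ℓ • P)) := by
  rw [divisionDivisor, ev_add_right, ev_replicate, ev_singleton]

lemma value_miller_ne_zero {W P : E.Point} (hW : W ≠ 0) (hℓW : ℓ • W = 0) (hP : P ≠ 0)
    (h : P ≠ W) : value (fn (Multiset.replicate ℓ W)) P ≠ 0 :=
  (IsPrincipal.replicate hW hℓW).value_fn_ne_zero hP fun h' ↦ h (Multiset.eq_of_mem_replicate h')

lemma ne_of_nsmul {P W : E.Point} (hℓW : ℓ • W = 0) (hP : ℓ • P ≠ 0) : P ≠ W :=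
  fun h ↦ hP (h ▸ hℓW)

/-- Reciprocity reads h_W(P)^ℓ h_W(-ℓP) = g_P(W)^ℓ. No sign appears, since ℓ + 1 is even for odd ℓ,
and ℓ itself is even for ℓ = 2. -/
lemma kappa_pow (hℓ : ℓ.Prime) {W P : E.Point} (hW : W ≠ 0) (hℓW : ℓ • W = 0) (hP : ℓ • P ≠ 0) :
    kappa ℓ W P ^ ℓ = value (fn (Multiset.replicate ℓ W)) (-(ℓ • P)) := by
  have hD := isPrincipal_divisionDivisor hP
  have hD' := IsPrincipal.replicate hW hℓW
  have h : ev (Multiset.replicate ℓ W) (divisionDivisor ℓ P) =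
      ev (divisionDivisor ℓ P) (Multiset.replicate ℓ W) := by
    rcases hℓ.eq_two_or_odd' with rfl | hodd
    · exact (hD'.ev_comm_of_even hD (by simp)).symm
    · refine hD.ev_comm_of_even hD' ?_
      rw [card_divisionDivisor]
      exact hodd.add_one
  have hh := value_miller_ne_zero hW hℓW (ne_of_nsmul (nsmul_zero ℓ) hP) (ne_of_nsmul hℓW hP)
  rw [ev_divisionDivisor, ev_replicate] at h
  rw [kappa, div_pow, ← h, mul_div_cancel_left₀ _ (pow_ne_zero _ hh)]

lemma kappa_ne_zero {W P : E.Point} (hW : W ≠ 0) (hℓW : ℓ • W = 0) (hP : ℓ • P ≠ 0)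
    (h : W ≠ -(ℓ • P)) : kappa ℓ W P ≠ 0 :=
  div_ne_zero ((isPrincipal_divisionDivisor hP).value_fn_ne_zero hW
    (not_mem_divisionDivisor (ne_of_nsmul hℓW hP).symm h))
    (value_miller_ne_zero hW hℓW (ne_of_nsmul (nsmul_zero ℓ) hP) (ne_of_nsmul hℓW hP))

/-- Up to a factor that depends only on `Q = ℓ P`, the quotient `g_P(W) / h_W(P)` is additive
in `W`. -/
lemma exists_kappa_mul {W W' Q : E.Point} (hW : W ≠ 0) (hℓW : ℓ • W = 0) (hW' : W' ≠ 0)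
    (hℓW' : ℓ • W' = 0) (hWW' : W + W' ≠ 0) (hQ : ℓ • Q ≠ 0) :
    ∃ c : k, c ≠ 0 ∧ ∀ P : E.Point, ℓ • P = Q →
      kappa ℓ W P * kappa ℓ W' P = c * kappa ℓ (W + W') P := by
  set W'' := W + W' with hW''
  have hℓW'' : ℓ • W'' = 0 := by rw [hW'', nsmul_add, hℓW, hℓW', add_zero]
  have hL : IsPrincipal {W, W', -W''} := by
    refine ⟨fun P hP ↦ ?_, ?_⟩
    · simp only [Multiset.insert_eq_cons, Multiset.mem_cons, Multiset.mem_singleton] at hP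
      rcases hP with rfl | rfl | rfl
      exacts [hW, hW', neg_ne_zero.mpr hWW']
    · simp only [Multiset.insert_eq_cons, Multiset.sum_cons, Multiset.sum_singleton]
      rw [hW'']; abel
  have hv : IsPrincipal {W'', -W''} := by
    refine ⟨fun P hP ↦ ?_, ?_⟩
    · simp only [Multiset.insert_eq_cons, Multiset.mem_cons, Multiset.mem_singleton] at hP
      rcases hP with rfl | rfl
      exacts [hWW', neg_ne_zero.mpr hWW']
    · simp
  -- With L the line through W, W', -W'' and v the vertical line through ±W'', this is h_W h_W' v^ℓ
  -- = L^ℓ h_W''.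
  have hfn : fn (.replicate ℓ W) * fn (.replicate ℓ W') * fn {W'', -W''} ^ ℓ =
      fn {W, W', -W''} ^ ℓ * fn (.replicate ℓ W'') := by
    have h1 := IsPrincipal.replicate hW hℓW
    have h2 := IsPrincipal.replicate hW' hℓW'
    have h3 := IsPrincipal.replicate hWW' hℓW''
    rw [← h1.fn_add h2, ← hv.fn_nsmul, ← hL.fn_nsmul, ← (h1.add h2).fn_add (hv.nsmul ℓ),
      ← (hL.nsmul ℓ).fn_add h3]
    congr 1
    simp only [Multiset.insert_eq_cons, ← Multiset.singleton_add, nsmul_add,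
      Multiset.nsmul_singleton]
    abel
  obtain ⟨ε₃, hε₃, h₃⟩ := exists_ev_comm E (ℓ + 1) 3
  obtain ⟨ε₂, hε₂, h₂⟩ := exists_ev_comm E (ℓ + 1) 2
  have hQ0 : -Q ≠ 0 := neg_ne_zero.mpr (ne_of_nsmul (nsmul_zero ℓ) hQ)
  have hnegQ {T : E.Point} (hT : ℓ • T = 0) : -Q ≠ T := by
    rintro rfl
    rw [smul_neg, neg_eq_zero] at hT
    exact hQ hT
  have hnegW : ℓ • -W'' = 0 := by rw [smul_neg, hℓW'', neg_zero]
  have notL {P : E.Point} (h : ∀ T : E.Point, ℓ • T = 0 → P ≠ T) :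
      P ∉ ({W, W', -W''} : Multiset E.Point) := by
    simp only [Multiset.insert_eq_cons, Multiset.mem_cons, Multiset.mem_singleton, not_or]
    exact ⟨h _ hℓW, h _ hℓW', h _ hnegW⟩
  have notv {P : E.Point} (h : ∀ T : E.Point, ℓ • T = 0 → P ≠ T) :
      P ∉ ({W'', -W''} : Multiset E.Point) := by
    simp only [Multiset.insert_eq_cons, Multiset.mem_cons, Multiset.mem_singleton, not_or]
    exact ⟨h _ hℓW'', h _ hnegW⟩
  have hLQ := hL.value_fn_ne_zero hQ0 (notL fun T hT ↦ hnegQ hT)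
  have hvQ := hv.value_fn_ne_zero hQ0 (notv fun T hT ↦ hnegQ hT)
  -- Reciprocity of g_P with L and with v expresses g_P(W) g_P(W') / g_P(W'') as this constant times
  -- (L(P)/v(P))^ℓ. The last factor is the corresponding quotient of the values of h at P.
  refine ⟨ε₂ * value (fn {W, W', -W''}) (-Q) / (ε₃ * value (fn {W'', -W''}) (-Q)),
    div_ne_zero (mul_ne_zero hε₂ hLQ) (mul_ne_zero hε₃ hvQ), ?_⟩
  rintro P rfl
  have hP : ℓ • P ≠ 0 := ne_of_nsmul (nsmul_zero ℓ) hQ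
  have hP0 : P ≠ 0 := ne_of_nsmul (nsmul_zero ℓ) hP
  have hD := isPrincipal_divisionDivisor hP
  have hvP := hv.value_fn_ne_zero hP0 (notv fun T hT ↦ ne_of_nsmul hT hP)
  have hg : value (fn (divisionDivisor ℓ P)) (-W'') ≠ 0 :=
    hD.value_fn_ne_zero (neg_ne_zero.mpr hWW')
      (not_mem_divisionDivisor (ne_of_nsmul hnegW hP).symm (hnegQ hnegW).symm)
  have r₃ := h₃ hD hL (card_divisionDivisor P) rfl
  have r₂ := h₂ hD hv (card_divisionDivisor P) rfl
  simp only [ev_divisionDivisor, Multiset.insert_eq_cons, ev_cons, ev_singleton] at r₃ r₂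
  have hfn := congr_arg (value · P) hfn
  simp only [value_mul, value_pow _ hP0, Multiset.insert_eq_cons] at hfn
  simp only [Multiset.insert_eq_cons] at hvQ hvP ⊢
  have hm := value_miller_ne_zero hW hℓW hP0 (ne_of_nsmul hℓW hP)
  have hm' := value_miller_ne_zero hW' hℓW' hP0 (ne_of_nsmul hℓW' hP)
  have hm'' := value_miller_ne_zero hWW' hℓW'' hP0 (ne_of_nsmul hℓW'' hP)
  rw [kappa, kappa, kappa, div_mul_div_comm, div_mul_div_comm, div_eq_div_iff
    (mul_ne_zero hm hm') (mul_ne_zero (mul_ne_zero hε₃ hvQ) hm'')]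
  refine mul_right_cancel₀ (mul_ne_zero hg (pow_ne_zero ℓ hvP)) ?_
  set g := value (fn (divisionDivisor ℓ P))
  set L := value (fn (W ::ₘ W' ::ₘ {-W''}))
  set v := value (fn (W'' ::ₘ {-W''}))
  set h := value (fn (.replicate ℓ W)) P
  set h' := value (fn (.replicate ℓ W')) P
  set h'' := value (fn (.replicate ℓ W'')) P
  linear_combination (-(v (-(ℓ • P))) * h'' * v P ^ ℓ) * r₃ + (h * h' * v P ^ ℓ *
    L (-(ℓ • P))) * r₂ -
    (L (-(ℓ • P)) * v (-(ℓ • P)) * v P ^ ℓ) * hfn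

/-- The effect on `g_P(W) / h_W(P)` of a translation of `P` by a torsion point does not depend
on `P`. -/
lemma kappa_add_mul_kappa {W P R T : E.Point} (hW : W ≠ 0) (hℓW : ℓ • W = 0) (hT : ℓ • T = 0)
    (hP : ℓ • P ≠ 0) (hR : ℓ • R ≠ 0) (hPR : ℓ • (P + R) ≠ 0) (hP' : W ≠ -(ℓ • P)) (hR' : W ≠ -(ℓ • R)) :
    kappa ℓ W (P + T) * kappa ℓ W R = kappa ℓ W P * kappa ℓ W (R + T) := by
  have hPT : ℓ • (P + T) = ℓ • P := by rw [nsmul_add, hT, add_zero]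
  have hRT : ℓ • (R + T) = ℓ • R := by rw [nsmul_add, hT, add_zero]
  set Z := P + T + R with hZ
  have hℓZ : ℓ • Z = ℓ • (P + R) := by rw [hZ, nsmul_add, hPT, nsmul_add]
  have h0 {A : E.Point} (hA : ℓ • A ≠ 0) : A ≠ 0 := ne_of_nsmul (nsmul_zero ℓ) hA
  have hZ0 : -Z ≠ 0 := neg_ne_zero.mpr (h0 (hℓZ ▸ hPR))
  have hZW : W ≠ -Z := by
    rintro rfl
    rw [smul_neg, neg_eq_zero, hℓZ] at hℓW
    exact hPR hℓW
  have hψ {A B : E.Point} (hA : ℓ • A ≠ 0) (hB : ℓ • B ≠ 0) (hAB : A + B = Z) :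
      IsPrincipal {A, B, -Z} := by
    refine ⟨fun P hP ↦ ?_, ?_⟩
    · simp only [Multiset.insert_eq_cons, Multiset.mem_cons, Multiset.mem_singleton] at hP
      rcases hP with rfl | rfl | rfl
      exacts [h0 hA, h0 hB, hZ0]
    · simp only [Multiset.insert_eq_cons, Multiset.sum_cons, Multiset.sum_singleton]
      rw [← hAB]; abel
  have h1 := hψ (hPT ▸ hP) hR hZ.symm
  have h2 : IsPrincipal {P, R + T, -Z} := hψ hP (hRT ▸ hR) (by rw [hZ]; abel)
  -- Both sides have the same zeros: the g's differ by the ℓ-th power of the quotient of two lines,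
  -- with zeros P + T, R, -Z and P, R + T, -Z.
  have hfn : fn (divisionDivisor ℓ (P + T)) * fn (divisionDivisor ℓ R) * fn {P, R + T, -Z} ^ ℓ =
      fn (divisionDivisor ℓ P) * fn (divisionDivisor ℓ (R + T)) * fn {P + T, R, -Z} ^ ℓ := by
    have g1 := isPrincipal_divisionDivisor (hPT ▸ hP)
    have g2 := isPrincipal_divisionDivisor hR
    have g3 := isPrincipal_divisionDivisor hP
    have g4 := isPrincipal_divisionDivisor (hRT ▸ hR)
    rw [← g1.fn_add g2, ← g3.fn_add g4, ← h2.fn_nsmul, ← h1.fn_nsmul,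
      ← (g1.add g2).fn_add (h2.nsmul ℓ), ← (g3.add g4).fn_add (h1.nsmul ℓ)]
    congr 1
    simp only [divisionDivisor, hPT, hRT, Multiset.insert_eq_cons, ← Multiset.singleton_add,
      nsmul_add, Multiset.nsmul_singleton]
    abel
  have hh := IsPrincipal.replicate hW hℓW
  -- Reciprocity with h_W turns the ℓ-th powers of the lines at W into values of h_W; ε and h_W(-Z)
  -- occur on both sides and cancel.
  obtain ⟨ε, hε, hrec⟩ := exists_ev_comm E ℓ 3
  have r1 := hrec hh h1 (Multiset.card_replicate ..) rfl
  have r2 := hrec hh h2 (Multiset.card_replicate ..) rfl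
  rw [ev_replicate] at r1 r2
  simp only [Multiset.insert_eq_cons, ev_cons, ev_singleton] at r1 r2
  have hfn := congr_arg (value · W) hfn
  simp only [value_mul, value_pow _ hW, Multiset.insert_eq_cons] at hfn
  have hm {A : E.Point} (hA : ℓ • A ≠ 0) : value (fn (Multiset.replicate ℓ W)) A ≠ 0 :=
    value_miller_ne_zero hW hℓW (h0 hA) (ne_of_nsmul hℓW hA)
  have hmZ : value (fn (Multiset.replicate ℓ W)) (-Z) ≠ 0 := value_miller_ne_zero hW hℓW hZ0 hZW.symm
  rw [r1, r2] at hfn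
  rw [kappa, kappa, kappa, kappa, div_mul_div_comm, div_mul_div_comm, div_eq_div_iff
    (mul_ne_zero (hm (hPT ▸ hP)) (hm hR)) (mul_ne_zero (hm hP) (hm (hRT ▸ hR)))]
  refine mul_right_cancel₀ (mul_ne_zero hmZ hε) ?_
  linear_combination hfn

end Pairing

/-! ### Compatibility of the quotients with homomorphisms of fields. -/

section Naturality

variable {R : Type*} [Field R] {E : WeierstrassCurve.Affine R} {F K : Type*} [Field F] [Field K]
  [Algebra R F] [Algebra R K] [DecidableEq F] [DecidableEq K] (φ : F →ₐ[R] K)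

lemma IsPrincipal.map {D : Multiset (E⁄F).Point} (hD : IsPrincipal D) :
    IsPrincipal (D.map (Point.map φ)) where
  ne_zero P hP := by
    obtain ⟨S, hS, rfl⟩ := Multiset.mem_map.mp hP
    exact (map_ne_zero_iff _ (Point.map_injective φ)).mpr (hD.1 _ hS)
  sum_eq_zero := by rw [← map_multiset_sum, hD.2, map_zero]

lemma IsPrincipal.crMap_fn {D : Multiset (E⁄F).Point} (hD : IsPrincipal D) :
    crMap E φ (fn D) = fn (D.map (Point.map φ)) :=
  (hD.hasZeros.crMap φ).eq_fn (isMonicAtInfinity_iff.mp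
    ((isMonicAtInfinity_iff.mpr hD.isMon).crMap φ)) (hD.map φ).1

lemma value_fn_map {D : Multiset (E⁄F).Point} (hD : IsPrincipal D) (P : (E⁄F).Point) :
    value (fn (D.map (Point.map φ))) (Point.map φ P) = φ (value (fn D) P) := by
  rw [← hD.crMap_fn, value_crMap]

lemma kappa_map {ℓ : ℕ} {W P : (E⁄F).Point} (hW : W ≠ 0) (hℓW : ℓ • W = 0) (hP : ℓ • P ≠ 0) :
    kappa ℓ (Point.map φ W) (Point.map φ P) = φ (kappa ℓ W P) := by
  rw [kappa, kappa, map_div₀, ← value_fn_map φ (isPrincipal_divisionDivisor hP),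
    ← value_fn_map φ (IsPrincipal.replicate hW hℓW)]
  simp [divisionDivisor]

end Naturality


/-! ### The function h_W is not an ℓ-th power. -/

section Roots

open Polynomial

variable {F : Type*} [Field F] {C : WeierstrassCurve.Affine F}

lemma exists_mul_eq_of_le {P : C.Point} {I : Ideal C.CoordinateRing} (h : I ≤ pointIdeal C P) :
    ∃ J : Ideal C.CoordinateRing, pointIdeal C P * J = I := by
  set v := vertical P
  have hv := pointIdeal_neg_mul P
  have h1 : pointIdeal C (-P) * I ≤ Ideal.span {v} := hv ▸ Ideal.mul_mono_right h
  let J : Ideal C.CoordinateRing :=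
    Submodule.comap (LinearMap.mulLeft C.CoordinateRing v) (pointIdeal C (-P) * I)
  have hJ : Ideal.span {v} * J = pointIdeal C (-P) * I := by
    refine le_antisymm (Ideal.span_singleton_mul_le_iff.mpr fun z hz ↦ hz) fun z hz ↦ ?_
    obtain ⟨a, rfl⟩ := Ideal.mem_span_singleton'.mp (h1 hz)
    rw [mul_comm a v] at hz ⊢
    exact Ideal.mul_mem_mul (Ideal.mem_span_singleton_self v) hz
  refine ⟨J, divisorIdeal_mul_left_cancel {-P} ?_⟩
  rw [divisorIdeal, Multiset.map_singleton, Multiset.prod_singleton, ← mul_assoc, hv, hJ]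

/-- An n-th root of the ideal of nD lies in each 𝔪_P with P in D, so one copy of 𝔪_P can be split
off at a time. -/
lemma eq_divisorIdeal_of_pow_eq {D : Multiset C.Point} {I : Ideal C.CoordinateRing} {n : ℕ}
    (hn : n ≠ 0) (h : I ^ n = divisorIdeal D ^ n) : I = divisorIdeal D := by
  induction D using Multiset.induction_on generalizing I with
  | empty =>
    simp only [divisorIdeal, Multiset.map_zero, Multiset.prod_zero, one_pow] at h ⊢
    rw [Ideal.one_eq_top] at h ⊢
    exact top_le_iff.mp (h ▸ Ideal.pow_le_self hn)
  | cons P D ih =>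
    have hI : I ≤ pointIdeal C P := by
      rcases eq_or_ne P 0 with rfl | hP
      · exact (le_top : I ≤ (⊤ : Ideal C.CoordinateRing))
      · have hm := (isMaximal_pointIdeal hP).isPrime
        refine (Ideal.IsPrime.pow_le_iff hn).mp (h.le.trans ?_)
        refine (Ideal.pow_le_self hn).trans ?_
        rw [divisorIdeal, Multiset.map_cons, Multiset.prod_cons]
        exact Ideal.mul_le_left
    obtain ⟨J, rfl⟩ := exists_mul_eq_of_le hI
    rw [divisorIdeal, Multiset.map_cons, Multiset.prod_cons] at h ⊢
    congr 1
    refine ih (divisorIdeal_mul_left_cancel (Multiset.replicate n P) ?_)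
    rw [divisorIdeal, Multiset.map_replicate, Multiset.prod_replicate, ← mul_pow, h, mul_pow]

/-- A polynomial in x is a constant times a product of vertical lines, whose zeros come in pairs ±P.
-/
lemma exists_hasZeros_polynomial [IsAlgClosed F] [C.IsElliptic] [DecidableEq F] {p : F[X]}
    (hp : p ≠ 0) : ∃ D : Multiset C.Point, D.sum = 0 ∧
      HasZeros (algebraMap F[X] C.CoordinateRing p) D := by
  rw [(IsAlgClosed.splits p).eq_prod_roots]
  have hlc : IsUnit (algebraMap F[X] C.CoordinateRing (Polynomial.C p.leadingCoeff)) :=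
    (isUnit_C.mpr (isUnit_iff_ne_zero.mpr (leadingCoeff_ne_zero.mpr hp))).map _
  have key (s : Multiset F) : ∃ D : Multiset C.Point, D.sum = 0 ∧ HasZeros
      (algebraMap F[X] C.CoordinateRing (s.map fun a ↦ X - Polynomial.C a).prod) D := by
    induction s using Multiset.induction_on with
    | empty => exact ⟨0, rfl, by simp [HasZeros, Ideal.one_eq_top]⟩
    | cons a s ih =>
      obtain ⟨D, hD, h⟩ := ih
      obtain ⟨b, hb⟩ := exists_equation C a
      refine ⟨{-Point.mk hb, Point.mk hb} + D, ?_, ?_⟩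
      · rw [Multiset.sum_add, hD]; simp
      · rw [Multiset.map_cons, Multiset.prod_cons, map_mul]
        exact (hasZeros_vertical (Point.mk hb)).mul h
  obtain ⟨D, hD, h⟩ := key p.roots
  refine ⟨D, hD, ?_⟩
  rw [HasZeros, map_mul, Ideal.span_singleton_mul_left_unit hlc]
  exact h

instance : Module.Finite F[X] C.CoordinateRing :=
  Module.Finite.of_basis (CoordinateRing.basis C)

/-- The function with divisor `n W - n P_∞` is not an `n`-th power for `W ≠ P_∞`. -/
lemma eq_zero_of_pow_eq [IsAlgClosed F] [C.IsElliptic] [DecidableEq F] {n : ℕ} (hn : n ≠ 0)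
    {W : C.Point} {h : C.CoordinateRing} (hh : HasZeros h (Multiset.replicate n W))
    {u : FractionRing C.CoordinateRing} (hu : u ^ n = algebraMap _ _ h) : W = 0 := by
  obtain ⟨v, d, hd, rfl⟩ := IsFractionRing.div_surjective C.CoordinateRing u
  have hd0 := nonZeroDivisors.ne_zero hd
  have hinj := IsFractionRing.injective C.CoordinateRing (FractionRing C.CoordinateRing)
  have hvd : v ^ n = d ^ n * h := by
    apply hinj
    rw [div_pow, div_eq_iff (pow_ne_zero _ ((map_ne_zero_iff _ hinj).mpr hd0))] at hu
    rw [map_mul, map_pow, map_pow, hu, mul_comm]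
  -- By integrality d divides a nonzero polynomial p in x, so u can be written with denominator p,
  -- whose zeros sum to 0.
  obtain ⟨p, hp, hp0⟩ := Submodule.exists_mem_ne_zero_of_ne_bot
    (Ideal.comap_ne_bot_of_integral_mem hd0 (Ideal.mem_span_singleton_self d)
      (Algebra.IsIntegral.isIntegral (R := F[X]) d))
  obtain ⟨e, he⟩ := Ideal.mem_span_singleton'.mp (Ideal.mem_comap.mp hp)
  obtain ⟨D, hD, hpD⟩ := exists_hasZeros_polynomial (C := C) hp0
  -- From (e v)^n = p^n h, the zeros of e v are W and those of p. Their sum is W, and it must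
  -- vanish.
  have hve : HasZeros (e * v) (W ::ₘ D) := by
    refine eq_divisorIdeal_of_pow_eq hn ?_
    rw [Ideal.span_singleton_pow, mul_pow, hvd, ← mul_assoc, ← mul_pow, he,
      ← Ideal.span_singleton_mul_span_singleton, ← Ideal.span_singleton_pow, hpD, hh,
      divisorIdeal, Multiset.map_cons, Multiset.prod_cons, mul_pow, Multiset.map_replicate,
      Multiset.prod_replicate, mul_comm]
  have := (exists_hasZeros_iff _).mp ⟨_, hve⟩
  rwa [Multiset.sum_cons, hD, add_zero] at this

end Roots

/-! ### The generic point. -/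

section GenericPoint

open Polynomial

universe u

variable {F : Type u} [Field F] [DecidableEq F] (C : WeierstrassCurve.Affine F)

instance {L : Type*} [Field L] [Algebra F L] [C.IsElliptic] : (C⁄L).IsElliptic :=
  inferInstanceAs (C.map (algebraMap F L)).IsElliptic

variable {C} in
/-- A torsion point over an extension of an algebraically closed field is rational. -/
lemma HasMulFormula.exists_map_eq [IsAlgClosed F] [C.IsElliptic] {n : ℕ}
    (hC : HasMulFormula C n) {L : Type u} [Field L] [DecidableEq L] [Algebra F L]
    {T : (C⁄L).Point} (hT : n • T = 0) :
    ∃ S : (C⁄F).Point, n • S = 0 ∧ Point.map (Algebra.ofId F L) S = T := by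
  suffices h : ∃ S : (C⁄F).Point, Point.map (Algebra.ofId F L) S = T by
    obtain ⟨S, rfl⟩ := h
    refine ⟨S, Point.map_injective (Algebra.ofId F L) ?_, rfl⟩
    rw [map_nsmul, hT, map_zero]
  obtain ⟨B, hB, h⟩ := hC.exists_torsion_polynomial
  rcases T with _ | ⟨x, y, hxy⟩
  · exact ⟨0, rfl⟩
  -- The x-coordinate is algebraic over F, hence in F; over it lie only the rational points ±S.
  have hx : IsIntegral F x := IsAlgebraic.isIntegral ⟨B, hB, h L x y hxy hT⟩
  obtain ⟨a, rfl⟩ := minpoly.mem_range_of_degree_eq_one (A := F) (x := x)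
    (IsAlgClosed.degree_eq_one_of_irreducible F (minpoly.irreducible hx))
  obtain ⟨b, hb⟩ := exists_equation (C⁄F) a
  have hab := equation_iff_nonsingular.mp hb
  have hS := Point.map_some (W' := C) (Algebra.ofId F L) hab
  rcases Point.X_eq_iff (h₁ := hxy) (h₂ := (C.baseChange_nonsingular
    (f := Algebra.ofId F L) (Algebra.ofId F L).injective a b).mpr hab) |>.mp rfl with he | he
  · exact ⟨_, hS.trans he.symm⟩
  · exact ⟨-.some _ _ hab, by rw [map_neg, hS]; exact he.symm⟩

/-- The function field. -/
abbrev GenericField : Type u := FractionRing (C⁄F).CoordinateRing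

omit [DecidableEq F] in
-- The point is the pair of coordinate functions (x, y), at which every function evaluates to
-- itself.
lemma exists_generic_point [C.IsElliptic] [DecidableEq (GenericField C)] :
    ∃ η : (C⁄(GenericField C)).Point, η ≠ 0 ∧ ∀ f : (C⁄F).CoordinateRing,
      value (crMap C (Algebra.ofId F (GenericField C)) f) η = algebraMap _ _ f := by
  let ι := algebraMap (C⁄F).CoordinateRing (GenericField C)
  let x : GenericField C := ι (CoordinateRing.mk (C⁄F) (Polynomial.C X))
  let y : GenericField C := ι (CoordinateRing.mk (C⁄F) Y)
  have hcomp : (evalEvalRingHom x y).comp (Polynomial.mapRingHom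
      (Polynomial.mapRingHom (algebraMap F (GenericField C)))) =
      ι.comp (CoordinateRing.mk (C⁄F)) := by
    ext a
    · simp
      rfl
    · simp
      rfl
    · simp
      rfl
  have hev (f : F[X][Y]) : (f.map (Polynomial.mapRingHom
      (algebraMap F (GenericField C)))).evalEval x y = ι (CoordinateRing.mk (C⁄F) f) :=
    congr($hcomp f)
  have h : (C⁄(GenericField C)).Equation x y := by
    have := hev (C⁄F).polynomial
    rw [CoordinateRing.mk, AdjoinRoot.mk_self, map_zero] at this
    rw [Equation, ← this]
    congr 1
    exact C.baseChange_polynomial (Algebra.ofId F (GenericField C))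
  refine ⟨Point.mk h, Point.some_ne_zero _, fun f ↦ ?_⟩
  obtain ⟨f, rfl⟩ := AdjoinRoot.mk_surjective f
  exact (congr_arg (value · _) (crMap_mk C _ f)).trans ((value_mk _ _).trans (hev f))

/-- The function x - x(P) vanishes at P, but at the generic point its value is itself, which is not
0. -/
lemma generic_ne_map [C.IsElliptic] [DecidableEq (GenericField C)]
    {η : (C⁄(GenericField C)).Point} (hη : η ≠ 0) (h : ∀ f : (C⁄F).CoordinateRing,
      value (crMap C (Algebra.ofId F (GenericField C)) f) η = algebraMap _ _ f)
    (P : (C⁄F).Point) : Point.map (Algebra.ofId F (GenericField C)) P ≠ η := by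
  rintro rfl
  have hP : P ≠ 0 := by
    rintro rfl
    exact hη (map_zero _)
  have h1 := h (vertical P)
  rw [value_crMap, ((hasZeros_vertical P).value_eq_zero_iff hP).mpr (by simp), map_zero] at h1
  exact (map_ne_zero_iff _ (IsFractionRing.injective (C⁄F).CoordinateRing (GenericField C))).mpr
    (vertical_ne_zero P) h1.symm

end GenericPoint


/-! ### Translation by torsion and the kernel of the pairing. -/

section Translation

variable {k : Type*} [Field k] [DecidableEq k] {E : WeierstrassCurve.Affine k}

/-- The quotient `g_P(W) / h_W(P)` is invariant under the translation of `P` by `T` in the fibre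
over `Q`. -/
def TranslationInvariant (ℓ : ℕ) (Q W T : E.Point) : Prop :=
  ∀ R : E.Point, ℓ • R = Q → kappa ℓ W (R + T) = kappa ℓ W R

variable {ℓ : ℕ} {Q W W' T T' : E.Point}

namespace TranslationInvariant

lemma zero : TranslationInvariant ℓ Q W 0 := fun R _ ↦ by rw [add_zero]

lemma add (hT : ℓ • T = 0) (h : TranslationInvariant ℓ Q W T)
    (h' : TranslationInvariant ℓ Q W T') : TranslationInvariant ℓ Q W (T + T') := fun R hR ↦ by
  rw [← add_assoc, h' (R + T) (by rw [nsmul_add, hR, hT, add_zero]), h R hR]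

lemma neg (hT : ℓ • T = 0) (h : TranslationInvariant ℓ Q W T) :
    TranslationInvariant ℓ Q W (-T) := fun R hR ↦ by
  rw [← h (R + -T) (by rw [nsmul_add, hR, smul_neg, hT, neg_zero, add_zero]), neg_add_cancel_right]

lemma nsmul (hT : ℓ • T = 0) (h : TranslationInvariant ℓ Q W T) (n : ℕ) :
    TranslationInvariant ℓ Q W (n • T) := by
  induction n with
  | zero => rw [zero_smul]; exact zero
  | succ n ih =>
    rw [succ_nsmul]
    exact ih.add (by rw [smul_comm, hT, smul_zero]) h

lemma zsmul (hT : ℓ • T = 0) (h : TranslationInvariant ℓ Q W T) (n : ℤ) :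
    TranslationInvariant ℓ Q W (n • T) := by
  obtain ⟨n, rfl | rfl⟩ := n.eq_nat_or_neg
  · rw [natCast_zsmul]
    exact h.nsmul hT n
  · rw [neg_smul, natCast_zsmul]
    exact (h.nsmul hT n).neg (by rw [smul_comm, hT, smul_zero])

lemma add_left (hW : W ≠ 0) (hℓW : ℓ • W = 0) (hW' : W' ≠ 0) (hℓW' : ℓ • W' = 0)
    (hWW' : W + W' ≠ 0) (hQ : ℓ • Q ≠ 0) (hT : ℓ • T = 0) (h : TranslationInvariant ℓ Q W T)
    (h' : TranslationInvariant ℓ Q W' T) : TranslationInvariant ℓ Q (W + W') T := fun R hR ↦ by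
  obtain ⟨c, hc, hmul⟩ := exists_kappa_mul hW hℓW hW' hℓW' hWW' hQ
  refine mul_left_cancel₀ hc ?_
  rw [← hmul R hR, ← hmul (R + T) (by rw [nsmul_add, hR, hT, add_zero]), h R hR, h' R hR]

end TranslationInvariant

lemma ne_neg_of_nsmul_ne (hQ : ℓ • Q ≠ 0) (hℓW : ℓ • W = 0) : W ≠ -Q := by
  rintro rfl
  rw [smul_neg, neg_eq_zero] at hℓW
  exact hQ hℓW

/-- One instance of invariance in one fibre spreads to the fibre over Q, because the effect of a
translation does not depend on the point. -/
lemma translationInvariant_of_kappa_eq {R₀ : E.Point} (hW : W ≠ 0) (hℓW : ℓ • W = 0)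
    (hT : ℓ • T = 0) (hQ : ℓ • Q ≠ 0) (hR₀ : ℓ • R₀ ≠ 0) (hW₀ : W ≠ -(ℓ • R₀))
    (hR₀Q : ℓ • R₀ + Q ≠ 0) (h : kappa ℓ W (R₀ + T) = kappa ℓ W R₀) :
    TranslationInvariant ℓ Q W T := by
  rintro R rfl
  have hR : ℓ • R ≠ 0 := ne_of_nsmul (nsmul_zero ℓ) hQ
  have := kappa_add_mul_kappa hW hℓW hT hR₀ hR (by rwa [nsmul_add]) hW₀ (ne_neg_of_nsmul_ne hQ hℓW)
  rw [h] at this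
  exact (mul_left_cancel₀ (kappa_ne_zero hW hℓW hR₀ hW₀) this).symm

variable {W₁ W₂ : E.Point} {a b : ℤ}

/-- If `g_P(W) / h_W(P)` is invariant under the translation by `T₀` for both elements `W` of a basis
of the torsion, then there is a `W ≠ 0` for which it is invariant under all translations. -/
lemma exists_translationInvariant (hℓ : ℓ.Prime) (hℓ₁ : ℓ • W₁ = 0) (hℓ₂ : ℓ • W₂ = 0)
    (hind : ∀ a b : ℤ, a • W₁ + b • W₂ = 0 → (ℓ : ℤ) ∣ a ∧ (ℓ : ℤ) ∣ b) (hb : ¬ (ℓ : ℤ) ∣ b)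
    (hQ : ℓ • Q ≠ 0) (hQ₂ : Q + Q ≠ 0) {R₀ : E.Point} (hR₀ : ℓ • R₀ = Q)
    (h₁ : TranslationInvariant ℓ Q W₁ (a • W₁ + b • W₂))
    (h₂ : TranslationInvariant ℓ Q W₂ (a • W₁ + b • W₂)) :
    ∃ m n : ℕ, m • W₁ + n • W₂ ≠ 0 ∧
      ∀ c d : ℤ, TranslationInvariant ℓ Q (m • W₁ + n • W₂) (c • W₁ + d • W₂) := by
  have hT₀ : ℓ • (a • W₁ + b • W₂) = 0 := by
    rw [nsmul_add, smul_comm, hℓ₁, smul_comm ℓ b, hℓ₂, smul_zero, smul_zero, add_zero]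
  have hne {c d : ℤ} (h : ¬ ((ℓ : ℤ) ∣ c ∧ (ℓ : ℤ) ∣ d)) : c • W₁ + d • W₂ ≠ 0 :=
    fun h0 ↦ h (hind c d h0)
  have hone : ¬ (ℓ : ℤ) ∣ 1 := by
    rw [← Nat.cast_one, Int.natCast_dvd_natCast, Nat.dvd_one]
    exact hℓ.one_lt.ne'
  have hW₁ : W₁ ≠ 0 := by simpa using hne (c := 1) (d := 0) (fun h ↦ hone h.1)
  have hbW₁ (n : ℕ) : n • W₁ + W₂ ≠ 0 := by
    simpa using hne (c := n) (d := 1) (fun h ↦ hone h.2)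
  have hℓb (n : ℕ) : ℓ • (n • W₁ + W₂) = 0 := by
    rw [nsmul_add, smul_comm, hℓ₁, hℓ₂, smul_zero, add_zero]
  have hQ0 : Q ≠ 0 := ne_of_nsmul (nsmul_zero ℓ) hQ
  subst hR₀
  -- it suffices to have the invariance under `W₁`
  suffices ∃ m n : ℕ, m • W₁ + n • W₂ ≠ 0 ∧
      TranslationInvariant ℓ (ℓ • R₀) (m • W₁ + n • W₂) (a • W₁ + b • W₂) ∧
      kappa ℓ (m • W₁ + n • W₂) (R₀ + W₁) = kappa ℓ (m • W₁ + n • W₂) R₀ by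
    obtain ⟨m, n, h0, hI, hS⟩ := this
    refine ⟨m, n, h0, fun c d ↦ ?_⟩
    set W := m • W₁ + n • W₂
    have hℓW : ℓ • W = 0 := by
      rw [nsmul_add, smul_comm, hℓ₁, smul_comm ℓ n, hℓ₂, smul_zero, smul_zero, add_zero]
    have hz {T : E.Point} (hT : ℓ • T = 0) (z : ℤ) : ℓ • (z • T) = 0 := by
      rw [smul_comm, hT, smul_zero]
    have I₁ : TranslationInvariant ℓ (ℓ • R₀) W W₁ :=
      translationInvariant_of_kappa_eq h0 hℓW hℓ₁ hQ hQ0 (ne_neg_of_nsmul_ne hQ hℓW) hQ₂ hS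
    have I₂ : TranslationInvariant ℓ (ℓ • R₀) W W₂ := by
      -- As b is prime to ℓ, W₂ is a combination of W₁ and T₀ by Bézout, so invariance under these
      -- two suffices.
      obtain ⟨u, v, huv⟩ : IsCoprime (ℓ : ℤ) b :=
        (Nat.prime_iff_prime_int.mp hℓ).coprime_iff_not_dvd.mpr hb
      have : W₂ = v • ((-a) • W₁ + (a • W₁ + b • W₂)) := by
        rw [neg_smul, neg_add_cancel_left, smul_smul]
        nth_rw 1 [← one_smul ℤ W₂, ← huv, add_smul, mul_smul, natCast_zsmul, hℓ₂, smul_zero,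
          zero_add]
      rw [this]
      exact ((I₁.zsmul hℓ₁ _).add (hz hℓ₁ _) hI).zsmul
        (by rw [nsmul_add, hz hℓ₁, hT₀, add_zero]) v
    exact (I₁.zsmul hℓ₁ c).add (hz hℓ₁ c) (I₂.zsmul hℓ₂ d)
  have hR₁ : ℓ • (R₀ + W₁) = ℓ • R₀ := by rw [nsmul_add, hℓ₁, add_zero]
  have hκ {W : E.Point} (hW : W ≠ 0) (hℓW : ℓ • W = 0) : kappa ℓ W R₀ ≠ 0 :=
    kappa_ne_zero hW hℓW hQ0 (ne_neg_of_nsmul_ne hQ hℓW)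
  -- The pairing of W with W₁, with values in the ℓ-th roots of unity; the task is to find a nonzero
  -- W in its kernel.
  let ρ (W : E.Point) : k := kappa ℓ W (R₀ + W₁) / kappa ℓ W R₀
  have hρ {W : E.Point} (hW : W ≠ 0) (hℓW : ℓ • W = 0) : ρ W ^ ℓ = 1 := by
    have := pow_ne_zero ℓ (hκ hW hℓW)
    rw [div_pow, kappa_pow hℓ hW hℓW (hR₁ ▸ hQ0), hR₁, ← kappa_pow hℓ hW hℓW hQ0, div_self this]
  by_cases h1 : ρ W₁ = 1
  · refine ⟨1, 0, by simpa using hW₁, by simpa using h₁, ?_⟩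
    rw [div_eq_one_iff_eq (hκ hW₁ hℓ₁)] at h1
    simpa using h1
  have : NeZero ℓ := ⟨hℓ.ne_zero⟩
  have hprim : IsPrimitiveRoot (ρ W₁) ℓ := by
    have := Fact.mk hℓ
    rw [← orderOf_eq_prime (hρ hW₁ hℓ₁) h1]
    exact IsPrimitiveRoot.orderOf _
  have hW₂ : W₂ ≠ 0 := by simpa using hbW₁ 0
  -- If ρ(W₁) is primitive, some n satisfies ρ(W₁)^n = ρ(W₂)⁻¹, and n W₁ + W₂ is in the kernel.
  obtain ⟨n, -, hn⟩ := hprim.eq_pow_of_pow_eq_one (ξ := (ρ W₂)⁻¹)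
    (by rw [inv_pow, hρ hW₂ hℓ₂, inv_one])
  have hρn (n : ℕ) : ρ (n • W₁ + W₂) = ρ W₁ ^ n * ρ W₂ ∧
      TranslationInvariant ℓ (ℓ • R₀) (n • W₁ + W₂) (a • W₁ + b • W₂) := by
    induction n with
    | zero => simpa using h₂
    | succ n ih =>
      have e : (n + 1) • W₁ + W₂ = W₁ + (n • W₁ + W₂) := by
        rw [succ_nsmul, add_comm (n • W₁), add_assoc]
      have hne' := e ▸ hbW₁ (n + 1)
      refine ⟨?_, ?_⟩
      · rw [e, pow_succ', mul_assoc, ← ih.1]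
        obtain ⟨c, hc, hmul⟩ := exists_kappa_mul hW₁ hℓ₁ (hbW₁ n) (hℓb n) hne' hQ
        change _ / _ = _ / _ * (_ / _)
        rw [div_mul_div_comm, hmul _ hR₁, hmul _ rfl, mul_div_mul_left _ _ hc]
      · rw [e]
        exact TranslationInvariant.add_left hW₁ hℓ₁ (hbW₁ n) (hℓb n) hne' hQ hT₀ h₁ ih.2
  refine ⟨n, 1, by simpa using hbW₁ n, by simpa using (hρn n).2, ?_⟩
  have h2 : ρ (n • W₁ + W₂) = 1 := by
    rw [(hρn n).1, hn, inv_mul_cancel₀]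
    intro h0
    have := hρ hW₂ hℓ₂
    rw [h0, zero_pow hℓ.ne_zero] at this
    exact zero_ne_one this
  rw [div_eq_one_iff_eq (hκ (hbW₁ n) (hℓb n))] at h2
  simpa using h2

end Translation

/-! ### Injectivity, by passage to the generic fibre. -/

section Generic

open Polynomial

universe u

variable {F : Type u} [Field F] [DecidableEq F] [IsAlgClosed F] {C : WeierstrassCurve.Affine F}
  [C.IsElliptic]

/-- The algebraic closure of the function field. -/
abbrev GenericClosure (C : WeierstrassCurve.Affine F) : Type u := AlgebraicClosure (GenericField C)

omit [IsAlgClosed F] [C.IsElliptic] in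
lemma map_ofId_comp {K L : Type*} [Field K] [Field L] [DecidableEq K] [DecidableEq L]
    [Algebra F K] [Algebra F L] (φ : K →ₐ[F] L) (P : (C⁄F).Point) :
    Point.map φ (Point.map (Algebra.ofId F K) P) = Point.map (Algebra.ofId F L) P := by
  rw [Point.map_map]
  congr 2
  exact Subsingleton.elim _ _

variable [DecidableEq (GenericField C)] [DecidableEq (GenericClosure C)]

/-- The quotient `g_R(W) / h_W(R)` is not Galois invariant on the fibre over the generic point. -/
lemma not_translationInvariant_generic {ℓ : ℕ} (hℓ : ℓ.Prime) (hF : (ℓ : F) ≠ 0)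
    {η : (C⁄(GenericField C)).Point} (hη : η ≠ 0)
    (h : ∀ f : (C⁄F).CoordinateRing,
      value (crMap C (Algebra.ofId F (GenericField C)) f) η = algebraMap _ _ f)
    {W : (C⁄F).Point} (hW : W ≠ 0) (hℓW : ℓ • W = 0) {R₀ : (C⁄(GenericClosure C)).Point}
    (hR₀ : ℓ • R₀ = -Point.map (IsScalarTower.toAlgHom F (GenericField C) (GenericClosure C)) η)
    (hI : ∀ T : (C⁄(GenericClosure C)).Point, ℓ • T = 0 → TranslationInvariant ℓ (ℓ • R₀)
      (Point.map (Algebra.ofId F (GenericClosure C)) W) T) : False := by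
  set ψ := IsScalarTower.toAlgHom F (GenericField C) (GenericClosure C) with hψ
  set W' := Point.map (Algebra.ofId F (GenericClosure C)) W with hW'
  have hR₀0 : ℓ • R₀ ≠ 0 := by
    rw [hR₀, neg_ne_zero, map_ne_zero_iff _ (Point.map_injective ψ)]
    exact hη
  have hW'0 : W' ≠ 0 := (map_ne_zero_iff _ (Point.map_injective _)).mpr hW
  have hℓW' : ℓ • W' = 0 := by rw [hW', ← map_nsmul, hℓW, map_zero]
  set f := fn (Multiset.replicate ℓ W)
  have hf := IsPrincipal.replicate hW hℓW
  set f' := algebraMap (C⁄F).CoordinateRing (GenericField C) f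
  have hf0 : f' ≠ 0 := (map_ne_zero_iff _ (IsFractionRing.injective _ _)).mpr hf.isMon.ne_zero
  have hf' : f' = _ := (h f).symm
  set κ := kappa ℓ W' R₀
  -- The choice ℓ R₀ = -η makes the ℓ-th power equal to h_W(η), which is h_W itself as an element of
  -- the function field.
  have hpow : κ ^ ℓ = ψ f' := by
    rw [kappa_pow hℓ hW'0 hℓW' hR₀0, hR₀, neg_neg, hf', ← value_crMap, hf.crMap_fn,
      (hf.map _).crMap_fn, Multiset.map_map, Multiset.map_replicate, Function.comp_apply,
      map_ofId_comp]
  -- An automorphism moves R₀ by an ℓ-torsion point, and κ is invariant under such translations by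
  -- hypothesis.
  have hfix (σ : GenericClosure C ≃ₐ[GenericField C] GenericClosure C) : σ κ = κ := by
    let σ' : GenericClosure C →ₐ[F] GenericClosure C := (σ : _ →ₐ[GenericField C] _).restrictScalars F
    have hση : Point.map σ' (Point.map ψ η) = Point.map ψ η := by
      rw [Point.map_map]
      congr 2
      exact AlgHom.ext fun x ↦ σ.commutes x
    have hσR : ℓ • (Point.map σ' R₀ - R₀) = 0 := by
      rw [nsmul_sub, ← map_nsmul, hR₀, map_neg, hση, sub_self]
    have h1 : kappa ℓ (Point.map σ' W') (Point.map σ' R₀) = σ' κ := kappa_map σ' hW'0 hℓW' hR₀0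
    rw [map_ofId_comp σ' W] at h1
    have h2 := hI _ hσR R₀ rfl
    rw [add_sub_cancel] at h2
    exact h1.symm.trans h2
  have hsep : IsSeparable (GenericField C) κ := by
    have hℓK : (ℓ : GenericField C) ≠ 0 := by
      rw [← map_natCast (algebraMap F (GenericField C))]
      exact (_root_.map_ne_zero _).mpr hF
    refine (separable_X_pow_sub_C f' hℓK hf0).of_dvd (minpoly.dvd _ _ ?_)
    rw [map_sub, map_pow, aeval_X, aeval_C, hpow]
    exact sub_self _
  obtain ⟨u, hu⟩ := mem_range_of_fixed hsep hfix
  refine hW (eq_zero_of_pow_eq hℓ.ne_zero hf.hasZeros (u := u) ?_)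
  apply (algebraMap (GenericField C) (GenericClosure C)).injective
  rw [map_pow, hu, hpow]
  rfl

omit [DecidableEq (GenericField C)] [DecidableEq (GenericClosure C)] in
/-- A point of a fibre of the multiplication by `ℓ` over a nonzero point is determined by the
quotients `g_P(W) / h_W(P)` for `W` in a basis of the torsion. -/
lemma eq_of_kappa_eq {ℓ : ℕ} (hℓ : ℓ.Prime) (h2 : (2 : F) ≠ 0) (hF : (ℓ : F) ≠ 0)
    (hC : HasMulFormula C ℓ) {W₁ W₂ : (C⁄F).Point} (hℓ₁ : ℓ • W₁ = 0) (hℓ₂ : ℓ • W₂ = 0)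
    (hind : ∀ a b : ℤ, a • W₁ + b • W₂ = 0 → (ℓ : ℤ) ∣ a ∧ (ℓ : ℤ) ∣ b)
    (hspan : ∀ T : (C⁄F).Point, ℓ • T = 0 → ∃ a b : ℤ, T = a • W₁ + b • W₂)
    {P P' : (C⁄F).Point} (hP : ℓ • P ≠ 0) (hP' : ℓ • P' = ℓ • P)
    (hP₁ : W₁ ≠ -(ℓ • P)) (hP₂ : W₂ ≠ -(ℓ • P)) (h₁ : kappa ℓ W₁ P' = kappa ℓ W₁ P)
    (h₂ : kappa ℓ W₂ P' = kappa ℓ W₂ P) : P' = P := by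
  classical
  by_contra hne
  obtain ⟨η, hη, hval⟩ := exists_generic_point C
  let ψ := IsScalarTower.toAlgHom F (GenericField C) (GenericClosure C)
  let ι : (C⁄F).Point →+ (C⁄(GenericClosure C)).Point := Point.map (Algebra.ofId F (GenericClosure C))
  have hι : Function.Injective ι := Point.map_injective _
  -- Torsion over the extension is already defined over F while Q is not, so neither ℓ nor 2 kills
  -- Q: the transfer of invariance meets no degenerate position.
  let Q := -Point.map ψ η
  have hrat (S : (C⁄F).Point) : ι S ≠ Q := by
    intro h
    apply generic_ne_map C hη hval (-S)
    apply Point.map_injective ψ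
    rw [map_ofId_comp]
    change ι (-S) = _
    rw [map_neg, h]
    exact neg_neg _
  have htors {n : ℕ} (hn : HasMulFormula C n) : n • Q ≠ 0 := by
    intro h
    obtain ⟨S, -, hS⟩ := hn.exists_map_eq h
    exact hrat S hS
  obtain ⟨R₀, hR₀⟩ := hC.surjective Q
  have hQ : ℓ • Q ≠ 0 := htors hC
  have hQ₂ : Q + Q ≠ 0 := by
    rw [← two_nsmul]
    exact htors (hasMulFormula_two C h2)
  have hone : ¬ (ℓ : ℤ) ∣ 1 := by
    rw [← Nat.cast_one, Int.natCast_dvd_natCast, Nat.dvd_one]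
    exact hℓ.one_lt.ne'
  have hW₁ : W₁ ≠ 0 := fun h ↦ hone (hind 1 0 (by simp [h])).1
  have hW₂ : W₂ ≠ 0 := fun h ↦ hone (hind 0 1 (by simp [h])).2
  set T₀ := P' - P with hT₀
  have hℓT₀ : ℓ • T₀ = 0 := by rw [hT₀, nsmul_sub, hP', sub_self]
  -- The coincidence of the κ-values at P and P' becomes invariance under T₀ in the generic fibre.
  have htrans {W : (C⁄F).Point} (hW : W ≠ 0) (hℓW : ℓ • W = 0) (hPW : W ≠ -(ℓ • P))
      (h : kappa ℓ W P' = kappa ℓ W P) : TranslationInvariant ℓ Q (ι W) (ι T₀) := by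
    refine translationInvariant_of_kappa_eq (R₀ := ι P) ((map_ne_zero_iff _ hι).mpr hW)
      (by rw [← map_nsmul, hℓW, map_zero]) (by rw [← map_nsmul, hℓT₀, map_zero]) hQ ?_ ?_ ?_ ?_
    · rw [← map_nsmul]
      exact (map_ne_zero_iff _ hι).mpr hP
    · rw [← map_nsmul, ← map_neg]
      exact hι.ne hPW
    · intro h0
      rw [← map_nsmul] at h0
      apply hrat (-(ℓ • P))
      rw [map_neg]
      exact neg_eq_of_add_eq_zero_right h0
    · rw [← map_add, hT₀, add_sub_cancel, kappa_map _ hW hℓW (hP' ▸ hP), kappa_map _ hW hℓW hP, h]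
  have I₁ := htrans hW₁ hℓ₁ hP₁ h₁
  have I₂ := htrans hW₂ hℓ₂ hP₂ h₂
  have hι_ind : ∀ a b : ℤ, a • ι W₁ + b • ι W₂ = 0 → (ℓ : ℤ) ∣ a ∧ (ℓ : ℤ) ∣ b := by
    intro a b hab
    refine hind a b (hι ?_)
    rw [map_add, map_zsmul, map_zsmul, hab, map_zero]
  have hι₁ : ℓ • ι W₁ = 0 := by rw [← map_nsmul, hℓ₁, map_zero]
  have hι₂ : ℓ • ι W₂ = 0 := by rw [← map_nsmul, hℓ₂, map_zero]
  obtain ⟨m, n, h0, hI⟩ : ∃ m n : ℕ, m • ι W₁ + n • ι W₂ ≠ 0 ∧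
      ∀ c d : ℤ, TranslationInvariant ℓ Q (m • ι W₁ + n • ι W₂) (c • ι W₁ + d • ι W₂) := by
    obtain ⟨a, b, hab⟩ := hspan T₀ hℓT₀
    have hab' : ι T₀ = a • ι W₁ + b • ι W₂ := by rw [hab, map_add, map_zsmul, map_zsmul]
    rw [hab'] at I₁ I₂
    -- Since T₀ ≠ 0, ℓ does not divide both coefficients; if it divides b, the roles of W₁ and W₂
    -- are exchanged.
    by_cases hb : (ℓ : ℤ) ∣ b
    · have ha : ¬ (ℓ : ℤ) ∣ a := by
        rintro ⟨a, rfl⟩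
        obtain ⟨b, rfl⟩ := hb
        apply hne
        rw [← sub_eq_zero, ← hT₀, hab, mul_comm, mul_smul, natCast_zsmul, hℓ₁, mul_comm, mul_smul,
          natCast_zsmul, hℓ₂, smul_zero, smul_zero, add_zero]
      rw [add_comm] at I₁ I₂
      obtain ⟨m, n, h0, hI⟩ := exists_translationInvariant hℓ hι₂ hι₁
        (fun a b h ↦ (hι_ind b a (by rwa [add_comm])).symm) ha hQ hQ₂ hR₀ I₂ I₁
      refine ⟨n, m, by rwa [add_comm], fun c d ↦ ?_⟩
      rw [add_comm (n • _), add_comm (c • _)]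
      exact hI d c
    · exact exists_translationInvariant hℓ hι₁ hι₂ hι_ind hb hQ hQ₂ hR₀ I₁ I₂
  have hW : m • W₁ + n • W₂ ≠ 0 := by
    intro h
    apply h0
    rw [← map_nsmul, ← map_nsmul, ← map_add, h, map_zero]
  refine not_translationInvariant_generic hℓ hF hη hval hW ?_ hR₀ fun T hT ↦ ?_
  · rw [nsmul_add, smul_comm, hℓ₁, smul_comm ℓ n, hℓ₂, smul_zero, smul_zero, add_zero]
  · obtain ⟨S, hS, rfl⟩ := hC.exists_map_eq hT
    obtain ⟨c, d, rfl⟩ := hspan S hS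
    have := hI c d
    rw [hR₀]
    change TranslationInvariant ℓ Q (ι _) (ι _)
    rw [map_add, map_add, map_nsmul, map_nsmul, map_zsmul, map_zsmul]
    exact this

end Generic


/-! ### Bijectivity over an algebraically closed field. -/

section Closed

open Polynomial

universe u

/-- `W₁, W₂` is a basis of the rational `ℓ`-torsion. -/
structure IsRationalBasis {F : Type*} [Field F] [DecidableEq F] {D : WeierstrassCurve.Affine F}
    (ℓ : ℕ) (W₁ W₂ : D.Point) : Prop where
  torsion₁ : ℓ • W₁ = 0
  torsion₂ : ℓ • W₂ = 0
  independent : ∀ a b : ℤ, a • W₁ + b • W₂ = 0 → (ℓ : ℤ) ∣ a ∧ (ℓ : ℤ) ∣ b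
  spans : ∀ T : D.Point, ℓ • T = 0 → ∃ a b : ℤ, T = a • W₁ + b • W₂

namespace IsRationalBasis

variable {F : Type u} [Field F] [DecidableEq F] {D : WeierstrassCurve.Affine F} {ℓ : ℕ}
  {W₁ W₂ : D.Point}

lemma ne_zero (hW : IsRationalBasis ℓ W₁ W₂) (hℓ : ℓ.Prime) : W₁ ≠ 0 ∧ W₂ ≠ 0 := by
  have hone : ¬ (ℓ : ℤ) ∣ 1 := by
    rw [← Nat.cast_one, Int.natCast_dvd_natCast, Nat.dvd_one]
    exact hℓ.one_lt.ne'
  exact ⟨fun h ↦ hone (hW.independent 1 0 (by simp [h])).1,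
    fun h ↦ hone (hW.independent 0 1 (by simp [h])).2⟩

lemma torsion_finite (hW : IsRationalBasis ℓ W₁ W₂) (hℓ : ℓ.Prime) :
    {T : D.Point | ℓ • T = 0}.Finite := by
  have hfin {W : D.Point} (h : ℓ • W = 0) : (AddSubgroup.zmultiples W : Set D.Point).Finite :=
    (isOfFinAddOrder_iff_nsmul_eq_zero.mpr ⟨ℓ, hℓ.pos, h⟩).finite_zmultiples
  refine ((hfin hW.torsion₁).image2 (· + ·) (hfin hW.torsion₂)).subset fun T hT ↦ ?_
  obtain ⟨a, b, rfl⟩ := hW.spans T hT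
  exact ⟨_, ⟨a, rfl⟩, _, ⟨b, rfl⟩, rfl⟩

variable [IsAlgClosed F] [D.IsElliptic]

lemma hasMulFormula (hW : IsRationalBasis ℓ W₁ W₂) (hℓ : ℓ.Prime) (h2 : (2 : F) ≠ 0) :
    HasMulFormula D ℓ := by
  have key : ∀ D' : WeierstrassCurve.Affine F, D⁄F = D' → {T : D'.Point | ℓ • T = 0}.Finite →
      ∀ T : D'.Point, T ≠ 0 → ℓ • T = 0 → HasMulFormula D ℓ := by
    rintro _ rfl hfin T hT hℓT
    exact hasMulFormula_prime D h2 hℓ hfin hT hℓT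
  exact key D (WeierstrassCurve.map_id D) (hW.torsion_finite hℓ) W₁ (hW.ne_zero hℓ).1 hW.torsion₁

lemma surjective (hW : IsRationalBasis ℓ W₁ W₂) (hℓ : ℓ.Prime) (h2 : (2 : F) ≠ 0) (Q : D.Point) :
    ∃ P : D.Point, ℓ • P = Q := by
  have key : ∀ D' : WeierstrassCurve.Affine F, D⁄F = D' → ∀ Q : D'.Point,
      ∃ P : D'.Point, ℓ • P = Q := by
    rintro _ rfl Q
    exact (hW.hasMulFormula hℓ h2).surjective Q
  exact key D (WeierstrassCurve.map_id D) Q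

lemma eq_of_kappa_eq (hW : IsRationalBasis ℓ W₁ W₂) (hℓ : ℓ.Prime) (h2 : (2 : F) ≠ 0)
    (hF : (ℓ : F) ≠ 0) {P P' : D.Point} (hP : ℓ • P ≠ 0) (hP' : ℓ • P' = ℓ • P)
    (hP₁ : W₁ ≠ -(ℓ • P)) (hP₂ : W₂ ≠ -(ℓ • P)) (h₁ : kappa ℓ W₁ P' = kappa ℓ W₁ P)
    (h₂ : kappa ℓ W₂ P' = kappa ℓ W₂ P) : P' = P := by
  have key : ∀ D' : WeierstrassCurve.Affine F, D⁄F = D' → ∀ W₁ W₂ P P' : D'.Point,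
      IsRationalBasis ℓ W₁ W₂ → ℓ • P ≠ 0 → ℓ • P' = ℓ • P → W₁ ≠ -(ℓ • P) → W₂ ≠ -(ℓ • P) →
        kappa ℓ W₁ P' = kappa ℓ W₁ P → kappa ℓ W₂ P' = kappa ℓ W₂ P → P' = P := by
    rintro _ rfl W₁ W₂ P P' hB hP hP' hP₁ hP₂ h₁ h₂
    exact EllDivision.eq_of_kappa_eq hℓ h2 hF (hW.hasMulFormula hℓ h2) hB.torsion₁ hB.torsion₂
      hB.independent hB.spans hP hP' hP₁ hP₂ h₁ h₂
  exact key D (WeierstrassCurve.map_id D) W₁ W₂ P P' hW hP hP' hP₁ hP₂ h₁ h₂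

/-- Translating one point of the fibre by the torsion gives ℓ² points with distinct pairs of values,
and there are at most ℓ² pairs of roots, so every pair occurs. -/
lemma exists_kappa_eq (hW : IsRationalBasis ℓ W₁ W₂) (hℓ : ℓ.Prime) (h2 : (2 : F) ≠ 0)
    (hF : (ℓ : F) ≠ 0) {Q : D.Point} (hQ : Q ≠ 0) (hQ₁ : W₁ ≠ -Q) (hQ₂ : W₂ ≠ -Q) {ω₁ ω₂ : F}
    (hω₁ : ω₁ ^ ℓ = value (fn (Multiset.replicate ℓ W₁)) (-Q))
    (hω₂ : ω₂ ^ ℓ = value (fn (Multiset.replicate ℓ W₂)) (-Q)) :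
    ∃ P : D.Point, ℓ • P = Q ∧ kappa ℓ W₁ P = ω₁ ∧ kappa ℓ W₂ P = ω₂ := by
  obtain ⟨P₀, rfl⟩ := hW.surjective hℓ h2 Q
  let t (i : Fin ℓ × Fin ℓ) : D.Point := P₀ + ((i.1 : ℤ) • W₁ + (i.2 : ℤ) • W₂)
  have ht (i) : ℓ • t i = ℓ • P₀ := by
    rw [nsmul_add, nsmul_add, smul_comm, hW.torsion₁, smul_comm ℓ (i.2 : ℤ), hW.torsion₂, smul_zero,
      smul_zero, add_zero, add_zero]
  let Φ (i : Fin ℓ × Fin ℓ) : F × F := (kappa ℓ W₁ (t i), kappa ℓ W₂ (t i))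
  have hΦ : Function.Injective Φ := by
    intro i j hij
    have h := hW.eq_of_kappa_eq hℓ h2 hF (P := t j) (P' := t i) (by rwa [ht]) (by rw [ht, ht])
      (by rwa [ht]) (by rwa [ht]) (congr_arg Prod.fst hij) (congr_arg Prod.snd hij)
    have h0 : ((i.1 : ℤ) - j.1) • W₁ + ((i.2 : ℤ) - j.2) • W₂ = 0 := by
      rw [sub_smul, sub_smul, ← add_sub_add_comm, sub_eq_zero]
      exact add_left_cancel h
    have hlt (x y : Fin ℓ) (h : (ℓ : ℤ) ∣ (x : ℤ) - y) : x = y := by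
      have := Int.eq_zero_of_abs_lt_dvd h (by rw [abs_lt]; omega)
      omega
    obtain ⟨h1, h2⟩ := hW.independent _ _ h0
    exact Prod.ext (hlt _ _ h1) (hlt _ _ h2)
  obtain ⟨hW₁, hW₂⟩ := hW.ne_zero hℓ
  let a (W : D.Point) : F := value (fn (Multiset.replicate ℓ W)) (-(ℓ • P₀))
  let S : Finset (F × F) := (nthRoots ℓ (a W₁)).toFinset ×ˢ (nthRoots ℓ (a W₂)).toFinset
  have hS : S.card ≤ ℓ * ℓ := by
    rw [Finset.card_product]
    exact Nat.mul_le_mul ((Multiset.toFinset_card_le _).trans (card_nthRoots ..))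
      ((Multiset.toFinset_card_le _).trans (card_nthRoots ..))
  have hmem (x y : F) : (x, y) ∈ S ↔ x ^ ℓ = a W₁ ∧ y ^ ℓ = a W₂ := by
    simp only [S, Finset.mem_product, Multiset.mem_toFinset, mem_nthRoots hℓ.pos]
  have himage : Finset.univ.image Φ = S := by
    refine Finset.eq_of_subset_of_card_le (fun x hx ↦ ?_) ?_
    · obtain ⟨i, -, rfl⟩ := Finset.mem_image.mp hx
      rw [hmem, kappa_pow hℓ hW₁ hW.torsion₁ (by rwa [ht]), kappa_pow hℓ hW₂ hW.torsion₂
        (by rwa [ht]), ht]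
      exact ⟨rfl, rfl⟩
    · rw [Finset.card_image_of_injective _ hΦ, Finset.card_univ, Fintype.card_prod, Fintype.card_fin]
      exact hS
  obtain ⟨i, -, hi⟩ := Finset.mem_image.mp (himage ▸ (hmem ω₁ ω₂).mpr ⟨hω₁, hω₂⟩)
  exact ⟨t i, ht i, congr_arg Prod.fst hi, congr_arg Prod.snd hi⟩

end IsRationalBasis

end Closed

/-! ### Descent to the base field. -/

section Rational

universe u

variable {k : Type u} [Field k] [DecidableEq k] {L : Type u} [Field L] [DecidableEq L] [Algebra k L]
  [IsAlgClosure k L] {E : WeierstrassCurve.Affine k} [E.IsElliptic] {ℓ : ℕ} {W₁ W₂ : (E⁄k).Point}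

/-- The quotients `g_P(W) / h_W(P)` for `W` in a basis of the geometric torsion give a bijection from
the rational points of the fibre over `Q` to the rational `ℓ`-th roots of the `h_W(-Q)`. -/
lemma kappa_bijective (hℓ : ℓ.Prime) (h2 : (2 : k) ≠ 0) (hk : (ℓ : k) ≠ 0)
    (hW : IsRationalBasis ℓ (Point.map (Algebra.ofId k L) W₁) (Point.map (Algebra.ofId k L) W₂))
    {Q : (E⁄k).Point} (hQ : Q ≠ 0) (hQ₁ : W₁ ≠ -Q) (hQ₂ : W₂ ≠ -Q) :
    (∀ P P' : (E⁄k).Point, ℓ • P = Q → ℓ • P' = Q → kappa ℓ W₁ P' = kappa ℓ W₁ P →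
      kappa ℓ W₂ P' = kappa ℓ W₂ P → P' = P) ∧
    ∀ ω₁ ω₂ : k, ω₁ ^ ℓ = value (fn (Multiset.replicate ℓ W₁)) (-Q) →
      ω₂ ^ ℓ = value (fn (Multiset.replicate ℓ W₂)) (-Q) →
        ∃ P : (E⁄k).Point, ℓ • P = Q ∧ kappa ℓ W₁ P = ω₁ ∧ kappa ℓ W₂ P = ω₂ := by
  have : IsAlgClosed L := IsAlgClosure.isAlgClosed k
  let ι : (E⁄k).Point →+ (E⁄L).Point := Point.map (Algebra.ofId k L)
  have hι : Function.Injective ι := Point.map_injective _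
  have h2L : (2 : L) ≠ 0 := by
    rw [← map_ofNat (algebraMap k L) 2]
    exact (map_ne_zero _).mpr h2
  have hkL : (ℓ : L) ≠ 0 := by
    rw [← map_natCast (algebraMap k L)]
    exact (map_ne_zero _).mpr hk
  have htor {W : (E⁄k).Point} (h : ℓ • ι W = 0) : ℓ • W = 0 := by
    rw [← map_nsmul] at h
    exact (map_eq_zero_iff _ hι).mp h
  have hne {W : (E⁄k).Point} (h : ι W ≠ 0) : W ≠ 0 := (map_ne_zero_iff _ hι).mp h
  have t₁ := htor hW.torsion₁
  have t₂ := htor hW.torsion₂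
  have n₁ := hne (hW.ne_zero hℓ).1
  have n₂ := hne (hW.ne_zero hℓ).2
  have hιQ : ι Q ≠ 0 := (map_ne_zero_iff _ hι).mpr hQ
  have hιQ₁ : ι W₁ ≠ -ι Q := by rw [← map_neg]; exact hι.ne hQ₁
  have hιQ₂ : ι W₂ ≠ -ι Q := by rw [← map_neg]; exact hι.ne hQ₂
  have hκ {W P : (E⁄k).Point} (hW : W ≠ 0) (hℓW : ℓ • W = 0) (hP : ℓ • P = Q) :
      kappa ℓ (ι W) (ι P) = algebraMap k L (kappa ℓ W P) :=
    kappa_map (Algebra.ofId k L) hW hℓW (hP ▸ hQ)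
  have hinj {P P' : (E⁄L).Point} (hP : ℓ • P = ι Q) (hP' : ℓ • P' = ι Q)
      (h₁ : kappa ℓ (ι W₁) P' = kappa ℓ (ι W₁) P) (h₂ : kappa ℓ (ι W₂) P' = kappa ℓ (ι W₂) P) :
      P' = P :=
    hW.eq_of_kappa_eq hℓ h2L hkL (hP ▸ hιQ) (hP'.trans hP.symm) (by rwa [hP]) (by rwa [hP]) h₁ h₂
  refine ⟨fun P P' hP hP' h₁ h₂ ↦ hι (hinj ?_ ?_ ?_ ?_), fun ω₁ ω₂ hω₁ hω₂ ↦ ?_⟩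
  · rw [← map_nsmul, hP]
  · rw [← map_nsmul, hP']
  · rw [hκ n₁ t₁ hP, hκ n₁ t₁ hP', h₁]
  · rw [hκ n₂ t₂ hP, hκ n₂ t₂ hP', h₂]
  have hval {W : (E⁄k).Point} (hW : W ≠ 0) (hℓW : ℓ • W = 0) {ω : k}
      (h : ω ^ ℓ = value (fn (Multiset.replicate ℓ W)) (-Q)) :
      algebraMap k L ω ^ ℓ = value (fn (Multiset.replicate ℓ (ι W))) (-ι Q) := by
    rw [← map_pow, h, ← map_neg, ← Multiset.map_replicate]
    exact (value_fn_map (Algebra.ofId k L) (IsPrincipal.replicate hW hℓW) (-Q)).symm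
  obtain ⟨P, hP, h₁, h₂⟩ := hW.exists_kappa_eq hℓ h2L hkL hιQ hιQ₁ hιQ₂
    (hval n₁ t₁ hω₁) (hval n₂ t₂ hω₂)
  -- A conjugate of P lies in the same fibre and has the same rational κ-values, so it is P by
  -- injectivity.
  have hσ (σ : L ≃ₐ[k] L) : Point.map (W' := E) (σ : L →ₐ[k] L) P = P := by
    have hσι (S : (E⁄k).Point) : Point.map (σ : L →ₐ[k] L) (ι S) = ι S := map_ofId_comp _ S
    have hσκ {W : (E⁄k).Point} (hW : W ≠ 0) (hℓW : ℓ • W = 0) {ω : k}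
        (h : kappa ℓ (ι W) P = algebraMap k L ω) :
        kappa ℓ (ι W) (Point.map (σ : L →ₐ[k] L) P) = kappa ℓ (ι W) P := by
      have := kappa_map (σ : L →ₐ[k] L) (W := ι W) (P := P) ((map_ne_zero_iff _ hι).mpr hW)
        (by rw [← map_nsmul, hℓW, map_zero]) (hP ▸ hιQ)
      rw [hσι] at this
      rw [this, h]
      exact σ.commutes ω
    exact hinj hP (by rw [← map_nsmul, hP, hσι]) (hσκ n₁ t₁ h₁) (hσκ n₂ t₂ h₂)
  obtain ⟨P₀, rfl⟩ := exists_map_eq_of_fixed E hk hQ hP hσ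
  have hP₀ : ℓ • P₀ = Q := hι (by rw [map_nsmul]; exact hP)
  exact ⟨P₀, hP₀, (algebraMap k L).injective ((hκ n₁ t₁ hP₀).symm.trans h₁),
    (algebraMap k L).injective ((hκ n₂ t₂ hP₀).symm.trans h₂)⟩

end Rational

end EllDivision

end

/-! ### The main theorem. -/

theorem mainTheorem2 {k : Type*} [Field k] [DecidableEq k] [DecidableEq (AlgebraicClosure k)]
    (E : WeierstrassCurve.Affine k) [E.IsElliptic]
    (char_ne_two : (2 : k) ≠ 0) (char_ne_three : (3 : k) ≠ 0)
    (ℓ : ℕ) (hℓ : ℓ.Prime) (char_ne_ℓ : (ℓ : k) ≠ 0)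
    (W₁ W₂ : E.Point) (hW : EllDivision.IsTorsionBasis E ℓ W₁ W₂)
    (h₁ h₂ : E.CoordinateRing)
    (hh₁ : EllDivision.IsMillerFunction ℓ W₁ h₁) (hh₂ : EllDivision.IsMillerFunction ℓ W₂ h₂)
    (Q : E.Point) (hQ : Q ≠ 0) (hQ₁ : -Q ≠ W₁) (hQ₂ : -Q ≠ W₂) :
    ∃ e : {P : E.Point // ℓ • P = Q} ≃
        {ω : k × k // ω.1 ^ ℓ = EllDivision.value h₁ (-Q) ∧ ω.2 ^ ℓ = EllDivision.value h₂ (-Q)},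
      ∀ P : {P : E.Point // ℓ • P = Q}, ∃ g : E.CoordinateRing,
        EllDivision.IsDivisionFunction ℓ P.1 Q g ∧
        EllDivision.value h₁ P.1 ≠ 0 ∧ EllDivision.value h₂ P.1 ≠ 0 ∧
        (e P).1 = (EllDivision.value g W₁ / EllDivision.value h₁ P.1,
          EllDivision.value g W₂ / EllDivision.value h₂ P.1) := by
  open EllDivision in
  have hE : ∀ a b : ℤ, toGeometric E (a • W₁ + b • W₂) =
      a • toGeometric E W₁ + b • toGeometric E W₂ := fun a b ↦ by
    rw [map_add, map_zsmul, map_zsmul]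
  have hinj : Function.Injective (toGeometric E) := Point.map_injective _
  have hB : IsRationalBasis ℓ (toGeometric E W₁) (toGeometric E W₂) := by
    refine ⟨by rw [← map_nsmul, hW.torsion₁, map_zero], by rw [← map_nsmul, hW.torsion₂, map_zero],
      fun a b h ↦ hW.independent a b (hinj ?_), fun T hT ↦ ?_⟩
    · rw [hE, h, map_zero]
    · obtain ⟨a, b, h⟩ := hW.spans T hT
      exact ⟨a, b, h.trans (hE a b)⟩
  have n₁ : W₁ ≠ 0 := fun h ↦ (hB.ne_zero hℓ).1 (by rw [h, map_zero])
  have n₂ : W₂ ≠ 0 := fun h ↦ (hB.ne_zero hℓ).2 (by rw [h, map_zero])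
  obtain ⟨inj, surj⟩ := kappa_bijective (L := AlgebraicClosure k) (E := E) (W₁ := W₁) (W₂ := W₂)
    (Q := Q) hℓ char_ne_two char_ne_ℓ hB hQ hQ₁.symm hQ₂.symm
  -- Zeros and normalisation determine a function uniquely, so the given Miller functions are the
  -- chosen ones.
  obtain rfl := hh₁.zeros.eq_fn (isMonicAtInfinity_iff.mp hh₁.infinity)
    (IsPrincipal.replicate n₁ hW.torsion₁).1
  obtain rfl := hh₂.zeros.eq_fn (isMonicAtInfinity_iff.mp hh₂.infinity)
    (IsPrincipal.replicate n₂ hW.torsion₂).1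
  let κ (P : {P : E.Point // ℓ • P = Q}) : {ω : k × k //
      ω.1 ^ ℓ = value (fn (Multiset.replicate ℓ W₁)) (-Q) ∧
        ω.2 ^ ℓ = value (fn (Multiset.replicate ℓ W₂)) (-Q)} :=
    ⟨(kappa ℓ W₁ P.1, kappa ℓ W₂ P.1), by
      have hP : ℓ • P.1 ≠ 0 := P.2.symm ▸ hQ
      rw [kappa_pow hℓ n₁ hW.torsion₁ hP, kappa_pow hℓ n₂ hW.torsion₂ hP, P.2]
      exact ⟨rfl, rfl⟩⟩
  have hκ : Function.Bijective κ := by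
    refine ⟨fun P P' h ↦ Subtype.ext ?_, fun ⟨⟨ω₁, ω₂⟩, hω₁, hω₂⟩ ↦ ?_⟩
    · have h := congr_arg Subtype.val h
      exact inj P'.1 P.1 P'.2 P.2 (congr_arg Prod.fst h) (congr_arg Prod.snd h)
    · obtain ⟨P, hP, h₁, h₂⟩ := surj ω₁ ω₂ hω₁ hω₂
      exact ⟨⟨P, hP⟩, Subtype.ext (Prod.ext h₁ h₂)⟩
  refine ⟨Equiv.ofBijective κ hκ, fun ⟨P, hP⟩ ↦ ⟨fn (divisionDivisor ℓ P), ⟨?_, ?_⟩, ?_, ?_, rfl⟩⟩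
  · change HasZeros _ (Multiset.replicate ℓ P + {-Q})
    rw [← hP]
    exact (isPrincipal_divisionDivisor (hP.symm ▸ hQ)).hasZeros
  · rw [isMonicAtInfinity_iff, ← card_divisionDivisor (ℓ := ℓ) P]
    exact (isPrincipal_divisionDivisor (hP.symm ▸ hQ)).isMon
  · exact value_miller_ne_zero n₁ hW.torsion₁ (ne_of_nsmul (nsmul_zero ℓ) (hP.symm ▸ hQ))
      (ne_of_nsmul hW.torsion₁ (hP.symm ▸ hQ))
  · exact value_miller_ne_zero n₂ hW.torsion₂ (ne_of_nsmul (nsmul_zero ℓ) (hP.symm ▸ hQ))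
      (ne_of_nsmul hW.torsion₂ (hP.symm ▸ hQ))
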